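/- **Setting.** Let $\phi,\psi:\mathbb R\to\mathbb R$ be the orthonormal scaling function and wavelet of a multiresolution analysis of $L^2(\mathbb R)$ such that $\psi$ has exactly $N_\psi\ge 1$ vanishing moments ($\int\psi^2=1$, $\int t^p\psi(t)\,dt=0$ for $0\le p<N_\psi$, $\int t^{N_\psi}\psi(t)\,dt\ne0$), $\phi,\psi\in L^1(\mathbb R)$ are compactly supported, $\int\phi=1$, $\sup_x|\widehat\psi(x)|(1+|x|)^\alpha<\infty$ for some $\alpha>1$, and $\sum_{k\in\mathbb Z}k^m\phi(\cdot-k)$ is (almost everywhere) a polynomial of degree $m$ for $0\le m<N_\psi$. Let $h_{j,\ell}=2^{-j/2}\int\phi(t+\ell)\psi(2^{-j}t)\,dt$. For $\boldsymbol\theta=(H,\lambda,\sigma^2)\in\Xi=\{\min\{H,\lambda,\sigma^2\}>0\}$, a tempered fractional Brownian motion (tfBm) with parameter $\boldsymbol\theta$ is a process with the law of $$B_{H,\lambda}(t)=\int_{\mathbb R}\{e^{-\lambda(t-u)_+}(t-u)_+^{H-1/2}-e^{-\lambda(-u)_+}(-u)_+^{H-1/2}\}\,B(du),$$ where $B(du)$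 is an independently scattered Gaussian random measure with $\mathbb E B(du)^2=\sigma^2du$; that is, a centred Gaussian process with the covariance given by this representation. Let $B=\{B(t)\}_{t\in\mathbb R}$ be a process which, under the probability measure $\mathbb P_{\boldsymbol\theta}$ (expectation $\mathbb E_{\boldsymbol\theta}$), is a tfBm with parameter $\boldsymbol\theta$, for each $\boldsymbol\theta\in\Xi$. Put $d(2^j,k)=\sum_{\ell\in\mathbb Z}B(\ell)h_{j,2^jk-\ell}$. Fix a finite nonempty set $J$ of octaves $j\ge1$ and, for $n$ with $j\le\lfloor\log_2 n\rfloor$ for all $j\in J$, let $n_j=\lfloor n/2^j\rfloor$, $$W(2^j)=\frac1{n_j}\sum_{k=1}^{n_j}d^2(2^j,k),\qquad \eta_j(\boldsymbol\theta)=\log_2\mathbb E_{\boldsymbol\theta}d^2(2^j,0)+\frac{\Psi(n_j/2)}{\log 2}-\log_2\frac{n_j}2,\qquad \Psi=\frac{\Gamma'}{\Gamma},$$ $w_j=2^{-(j-1)/2}$, and $f_n(\boldsymbol\theta)=\sum_{j\in J}w_j\big(\log_2W(2^j)-\eta_j(\boldsymbol\theta)\big)^2$. **Theorem.** There are symmetric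 positive semidefinite $3\times3$ matrices $\Sigma(\boldsymbol\theta)$ such that the following holds. Let $\boldsymbol\theta_0$ be the true parameter value and $U_0$ a bounded neighbourhood of $\boldsymbol\theta_0$ with $\overline U_0\subset\Xi$. (i) Suppose the wavelet spectrum is identifiable on $\overline U_0$: for $\boldsymbol\theta\ne\boldsymbol\theta'$ in $\overline U_0$, $(\mathbb E_{\boldsymbol\theta}W(2^j))_{j\in J}\ne(\mathbb E_{\boldsymbol\theta'}W(2^j))_{j\in J}$. Then there is a sequence of random vectors $\widehat{\boldsymbol\theta}_n$ which minimise $f_n$ over $\overline U_0$, and every such sequence satisfies $\widehat{\boldsymbol\theta}_n\to\boldsymbol\theta_0$ in $\mathbb P_{\boldsymbol\theta_0}$-probability as $n\to\infty$. (ii) If, in addition, $$\det\Big(\sum_{j\in J}\frac{w_j\,\partial_\ell\mathbb E_{\boldsymbol\theta_0}d^2(2^j,0)\,\partial_i\mathbb E_{\boldsymbol\theta_0}d^2(2^j,0)}{[\mathbb E_{\boldsymbol\theta_0}d^2(2^j,0)]^2}\Big)_{i,\ell=1,2,3}>0,$$ then every such sequence satisfies $\sqrt n(\widehat{\boldsymbol\theta}_n-\boldsymbol\theta_0)\xrightarrow{d}\mathcal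 N(0,\Sigma(\boldsymbol\theta_0))$ under $\mathbb P_{\boldsymbol\theta_0}$ as $n\to\infty$. -/

import Mathlib

open MeasureTheory ProbabilityTheory Filter Topology

noncomputable section

namespace TfBm

/-! ### Wavelet multiresolution analysis -/

/-- The atom `t ↦ 2^(-j/2) f (2^(-j) t - k)`. -/
def atom (f : ℝ → ℝ) (j k : ℤ) (t : ℝ) : ℝ :=
  (2 : ℝ) ^ (-(j : ℝ) / 2) * f (t / (2 : ℝ) ^ j - k)

/-- The closed linear span in `L²(ℝ)` of the atoms of `f` at octave `j`. For `f` a scaling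
function this is the approximation space `V_j`, for `f` a wavelet the detail space `W_j`. -/
def octaveSpace (f : ℝ → ℝ) (j : ℤ) : Submodule ℝ (Lp ℝ 2 (volume : Measure ℝ)) :=
  (Submodule.span ℝ
    {g : Lp ℝ 2 (volume : Measure ℝ) | ∃ k : ℤ, (g : ℝ → ℝ) =ᵐ[volume] atom f j k}).topologicalClosure

/-- `φ` and `ψ` are the (real, orthonormal) scaling function and wavelet of a multiresolution
analysis of `L²(ℝ)`, larger octaves being coarser. -/
structure IsMRA (φ ψ : ℝ → ℝ) : Prop where
  memLp_scaling : MemLp φ 2 volume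
  memLp_wavelet : MemLp ψ 2 volume
  orthonormal_scaling : ∀ k l : ℤ, ∫ t : ℝ, φ (t - k) * φ (t - l) = if k = l then 1 else 0
  orthonormal_wavelet : ∀ k l : ℤ, ∫ t : ℝ, ψ (t - k) * ψ (t - l) = if k = l then 1 else 0
  orthogonal : ∀ k l : ℤ, ∫ t : ℝ, φ (t - k) * ψ (t - l) = 0
  nested : ∀ j : ℤ, octaveSpace φ (j + 1) ≤ octaveSpace φ j
  iInf_eq_bot : ⨅ j : ℤ, octaveSpace φ j = ⊥
  dense : (⨆ j : ℤ, octaveSpace φ j).topologicalClosure = ⊤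
  detail : octaveSpace φ (-1) = octaveSpace φ 0 ⊔ octaveSpace ψ 0

/-- The standing conditions on the wavelet analysis: an MRA whose wavelet has exactly `N ≥ 1`
vanishing moments, with integrable and compactly supported `φ`, `ψ`, `∫ φ = 1`, with
`sup_x |ψ̂(x)| (1 + |x|)^α < ∞` for some `α > 1`, and such that `∑_k k^m φ(· - k)` is a
polynomial of degree `m` for `m < N`. -/
structure IsWaveletSystem (φ ψ : ℝ → ℝ) (N : ℕ) (α : ℝ) : Prop extends IsMRA φ ψ where
  one_le : 1 ≤ N
  unit_norm : ∫ t : ℝ, ψ t ^ 2 = 1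
  vanishing_moments : ∀ p < N, ∫ t : ℝ, t ^ p * ψ t = 0
  moment_ne_zero : ∫ t : ℝ, t ^ N * ψ t ≠ 0
  integrable_scaling : Integrable φ volume
  integrable_wavelet : Integrable ψ volume
  compact_scaling : HasCompactSupport φ
  compact_wavelet : HasCompactSupport ψ
  integral_scaling : ∫ t : ℝ, φ t = 1
  one_lt : 1 < α
  fourier_decay : ∃ C : ℝ, ∀ x : ℝ,
    ‖∫ t : ℝ, Complex.exp (-(Complex.I * x * t)) * (ψ t : ℂ)‖ * (1 + |x|) ^ α ≤ C
  polynomial : ∀ m < N, ∃ p : Polynomial ℝ, p.degree = m ∧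
    ∀ᵐ t : ℝ, ∑' k : ℤ, (k : ℝ) ^ m * φ (t - k) = p.eval t

/-- The filter `h_{j,ℓ} = 2^(-j/2) ∫ φ(t + ℓ) ψ(2^(-j) t) dt`. -/
def filterCoeff (φ ψ : ℝ → ℝ) (j : ℕ) (l : ℤ) : ℝ :=
  (2 : ℝ) ^ (-(j : ℝ) / 2) * ∫ t : ℝ, φ (t + l) * ψ (t / (2 : ℝ) ^ j)

/-! ### Tempered fractional Brownian motion -/

/-- The moving average kernel
`e^{-λ (t-u)_+} (t-u)_+^{H-1/2} - e^{-λ (-u)_+} (-u)_+^{H-1/2}`, where the power of a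
positive part is `0` when the positive part vanishes. -/
def maKernel (H lam t u : ℝ) : ℝ :=
  (if u < t then Real.exp (-lam * (t - u)) * (t - u) ^ (H - 1 / 2) else 0) -
    (if u < 0 then Real.exp (-lam * (-u)) * (-u) ^ (H - 1 / 2) else 0)

variable {Ω : Type*} [MeasurableSpace Ω]

/-- Under `μ`, the process `B` has the law of the moving average
`B(t) = ∫ maKernel H λ t u M(du)` against an independently scattered Gaussian random measure
`M` with control measure `E M(du)² = σ² du`: it is a centred Gaussian process with the
covariance that the isometry of the stochastic integral yields. -/
structure IsTfBm (B : ℝ → Ω → ℝ) (μ : Measure Ω) (H lam sigmaSq : ℝ) : Prop where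
  gaussian : IsGaussianProcess B μ
  centered : ∀ t, ∫ ω, B t ω ∂μ = 0
  covariance_eq : ∀ s t, cov[B s, B t; μ] =
    sigmaSq * ∫ u : ℝ, maKernel H lam s u * maKernel H lam t u

/-- Parameter vectors `θ = (H, λ, σ²)`, with coordinates `θ 0`, `θ 1`, `θ 2`. -/
abbrev Param : Type := EuclideanSpace ℝ (Fin 3)

/-- The parameter space `Ξ = {(H, λ, σ²) : min(H, λ, σ²) > 0}`. -/
def paramSpace : Set Param := {θ | 0 < θ 0 ∧ 0 < θ 1 ∧ 0 < θ 2}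

/-- A statistical model for tfBm: the observed process `B` is a tfBm with parameters `θ`
under the probability measure `P θ`, for every `θ` in the parameter space. -/
structure IsTfBmModel (B : ℝ → Ω → ℝ) (P : Param → Measure Ω) : Prop where
  measurable : ∀ t, Measurable (B t)
  isTfBm : ∀ θ ∈ paramSpace, IsTfBm B (P θ) (θ 0) (θ 1) (θ 2)

/-! ### The estimator -/

/-- Wavelet coefficient `d(2^j, k) = ∑_ℓ B(ℓ) h_{j, 2^j k - ℓ}` of the process in discrete time. -/
def waveletCoeff (φ ψ : ℝ → ℝ) (B : ℝ → Ω → ℝ) (j : ℕ) (k : ℤ) (ω : Ω) : ℝ :=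
  ∑' l : ℤ, B l ω * filterCoeff φ ψ j (2 ^ j * k - l)

/-- The number `n_j` of wavelet coefficients at octave `j`: `n / 2^j`, rounded down. -/
def numCoeff (n j : ℕ) : ℕ := n / 2 ^ j

/-- Sample wavelet variance `W(2^j) = (1/n_j) ∑_{k=1}^{n_j} d(2^j, k)²`. -/
def waveletVar (φ ψ : ℝ → ℝ) (B : ℝ → Ω → ℝ) (n j : ℕ) (ω : Ω) : ℝ :=
  (1 / (numCoeff n j : ℝ)) *
    ∑ k ∈ Finset.Icc 1 (numCoeff n j), waveletCoeff φ ψ B j (k : ℤ) ω ^ 2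

/-- Discrete time wavelet spectrum `E_θ d(2^j, 0)²`. -/
def spectrum (φ ψ : ℝ → ℝ) (B : ℝ → Ω → ℝ) (P : Param → Measure Ω) (j : ℕ) (θ : Param) : ℝ :=
  ∫ ω, waveletCoeff φ ψ B j 0 ω ^ 2 ∂(P θ)

/-- Bias correction `B(j) = Ψ(n_j/2) / log 2 - log₂ (n_j/2)`, with `Ψ = Γ'/Γ`. -/
def biasCorrection (n j : ℕ) : ℝ :=
  logDeriv Real.Gamma ((numCoeff n j : ℝ) / 2) / Real.log 2 -
    Real.logb 2 ((numCoeff n j : ℝ) / 2)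

/-- Bias-corrected log-spectrum `η_j(θ) = log₂ E_θ d(2^j, 0)² + B(j)`. -/
def logSpectrum (φ ψ : ℝ → ℝ) (B : ℝ → Ω → ℝ) (P : Param → Measure Ω) (n j : ℕ)
    (θ : Param) : ℝ :=
  Real.logb 2 (spectrum φ ψ B P j θ) + biasCorrection n j

/-- Regression weight `w_j = 1 / 2^((j-1)/2)`. -/
def weight (j : ℕ) : ℝ := 1 / (2 : ℝ) ^ (((j : ℝ) - 1) / 2)

/-- Objective function `f_n(θ) = ∑_j w_j (log₂ W(2^j) - η_j(θ))²` over the octaves in `J`. -/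
def objective (φ ψ : ℝ → ℝ) (B : ℝ → Ω → ℝ) (P : Param → Measure Ω) (J : Finset ℕ) (n : ℕ)
    (ω : Ω) (θ : Param) : ℝ :=
  ∑ j ∈ J, weight j *
    (Real.logb 2 (waveletVar φ ψ B n j ω) - logSpectrum φ ψ B P n j θ) ^ 2

/-- The sample size `n` is large enough for the octaves in `J`: `j ≤ ⌊log₂ n⌋` for `j ∈ J`. -/
def Admissible (J : Finset ℕ) (n : ℕ) : Prop := ∀ j ∈ J, j ≤ Nat.log 2 n

/-- The wavelet spectrum `(E_θ W(2^j))_{j ∈ J}` is identifiable on `S`. (The expectations do not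
depend on the sample size `n`; a difference at one admissible `n` is enough.) -/
def SpectrumIdentifiable (φ ψ : ℝ → ℝ) (B : ℝ → Ω → ℝ) (P : Param → Measure Ω) (J : Finset ℕ)
    (S : Set Param) : Prop :=
  ∀ θ ∈ S, ∀ θ' ∈ S, θ ≠ θ' → ∃ n : ℕ, Admissible J n ∧ ∃ j ∈ J,
    ∫ ω, waveletVar φ ψ B n j ω ∂(P θ) ≠ ∫ ω, waveletVar φ ψ B n j ω ∂(P θ')

/-- `est` is a sequence of random vectors which, for every admissible sample size `n`, minimise the
objective function `f_n` over `S`. -/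
def IsRestrictedMinimum (φ ψ : ℝ → ℝ) (B : ℝ → Ω → ℝ) (P : Param → Measure Ω) (J : Finset ℕ)
    (S : Set Param) (est : ℕ → Ω → Param) : Prop :=
  (∀ n, Measurable (est n)) ∧
    ∀ n, Admissible J n → ∀ ω, est n ω ∈ S ∧ IsMinOn (objective φ ψ B P J n ω) S (est n ω)

/-- Partial derivative in the `i`-th coordinate of the parameter. -/
def partialDeriv (i : Fin 3) (g : Param → ℝ) (θ : Param) : ℝ :=
  lineDeriv ℝ g θ (EuclideanSpace.single i 1)

/-- The matrix
`(∑_j w_j ∂_ℓ E_θ d²(2^j,0) ∂_i E_θ d²(2^j,0) / [E_θ d²(2^j,0)]²)_{i,ℓ}`. -/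
def informationMatrix (φ ψ : ℝ → ℝ) (B : ℝ → Ω → ℝ) (P : Param → Measure Ω) (J : Finset ℕ)
    (θ : Param) : Matrix (Fin 3) (Fin 3) ℝ :=
  Matrix.of fun i l => ∑ j ∈ J,
    weight j * partialDeriv l (spectrum φ ψ B P j) θ * partialDeriv i (spectrum φ ψ B P j) θ /
      spectrum φ ψ B P j θ ^ 2

end TfBm

end

/-!
Write `g` for the tempered power kernel and `γ` for its autocorrelation. The moving average kernel
of tfBm is `g (t - ·) - g (-·)`, and the filters `h_j` sum to zero because `ψ` has a vanishing
moment and `∑ φ(· - k)` is constant. So the wavelet coefficients are jointly Gaussian, centred and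
*stationary across octaves*: `cov(d(2^j, k), d(2^j', k')) = σ² · lagCov (2^j k - 2^j' k')`
(`cov_waveletCoeff`), where `lagCov` is a finite combination of values of `γ`, hence decays
exponentially (`exists_abs_lagCov_le`) and, at lag zero, is differentiable in `(H, λ)`.
The spectrum is positive (`spectrum_pos`): the translates of `g` are linearly
independent (`sum_autocov_pos`) and the filters do not vanish, since otherwise the dilated wavelet
would be orthogonal to `V₀`, and `ψ` to `V₋₁ ∋ ψ` (`exists_filterCoeff_ne_zero`).

*Central limit theorem for the sample wavelet variances.* A linear combination of the variables
`√n (W(2^j) - E d²(2^j, 0))` is a centred quadratic form `∑ aᵢ (Xᵢ² - E Xᵢ²)` in a Gaussian vector.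
Diagonalizing, it has the law of `∑ lᵢ (zᵢ² - 1)` with independent standard normal `zᵢ`, where
`∑ lᵢ² = ∑ᵢⱼ aᵢ aⱼ cov(Xᵢ, Xⱼ)²` and `|lᵢ|` is at most the largest `|aᵢ| ∑ⱼ |cov(Xᵢ, Xⱼ)|`
(`exists_map_quadraticForm_eq`). Exponential decay makes `max |lᵢ|` tend to zero and `∑ lᵢ²`
converge, which gives the limit of the characteristic functions
(`tendsto_integral_exp_quadraticForm`, `exists_tendsto_waveletVar`) as well as tightness.

*The estimator.* With `G(θ)_j = √w_j log₂ E_θ d²(2^j, 0)` the objective function is `‖Yₙ - G(θ)‖²`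
in `ℝ^J`, where `Yₙ` collects the bias-corrected log-variances; a measurable choice of minimiser
exists because a compact metric space is a continuous image of the Cantor set, in which nonempty
closed sets have a least element (`exists_measurable_isMinOn`). Two deterministic statements about
least squares on a compact set do the rest. If `G` is injective, minimisers are near `θ₀` as soon as
`Yₙ` is near `G(θ₀)` (`exists_norm_sub_lt_of_isMinOn`); this is consistency. If moreover the
derivative `A` of `G` at `θ₀` is injective, which is what the determinant condition says, then the
minimiser is `θ₀ + L (Yₙ - G(θ₀))` up to `o(‖Yₙ - G(θ₀)‖)`, with `L` the least squares inverse of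
`A` (`exists_norm_sub_linear_le_of_isMinOn`). No second derivatives are needed. The bias
correction is `O(1/n)` by log-convexity of `Γ`, hence negligible after scaling by `√n`, and the
delta method and Slutsky's theorem carry the central limit theorem over to the estimator.
-/

noncomputable section

namespace TfBm

/-! ### Quadratic forms in Gaussian vectors -/

open scoped MatrixOrder RealInnerProductSpace in
/-- Diagonalization of `∑ aᵢ (√S x)ᵢ²` in an orthonormal basis `b`, as `∑ lₖ xₖ²`. The `lₖ` are the
eigenvalues of `√S D √S`, `D = diag a`. Their first two power sums are traces. The nonzero ones are
also eigenvalues of `D S`, so that the weighted row sums bound them. -/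
theorem exists_diagonalization {ι : Type*} [Fintype ι] [DecidableEq ι] {S : Matrix ι ι ℝ}
    (hS : S.PosSemidef) (a : ι → ℝ) {C : ℝ} (hC : ∀ i, |a i| * ∑ j, |S i j| ≤ C) (hC0 : 0 ≤ C) :
    ∃ (l : ι → ℝ) (b : OrthonormalBasis ι ℝ (EuclideanSpace ℝ ι)),
      (∀ x : ι → ℝ, ∑ i, a i * (Matrix.toEuclideanCLM (𝕜 := ℝ) (CFC.sqrt S)
        (∑ k, x k • b k)) i ^ 2 = ∑ k, l k * x k ^ 2) ∧
      ∑ k, l k = ∑ i, a i * S i i ∧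
      ∑ k, l k ^ 2 = ∑ i, ∑ j, a i * a j * S i j ^ 2 ∧
      ∀ k, |l k| ≤ C := by
  set R : Matrix ι ι ℝ := CFC.sqrt S with hR
  have hRR : R * R = S := CFC.sqrt_mul_sqrt_self _ hS.nonneg
  have hRsa : R.IsHermitian := (CFC.sqrt_nonneg S).isSelfAdjoint
  have hRt : R.transpose = R := by
    simpa only [Matrix.IsHermitian, Matrix.conjTranspose_eq_transpose_of_trivial] using hRsa
  have hSt : S.transpose = S := by
    simpa only [Matrix.IsHermitian, Matrix.conjTranspose_eq_transpose_of_trivial] using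
      hS.isHermitian
  set M : Matrix ι ι ℝ := R * Matrix.diagonal a * R with hMdef
  have hM : M.IsHermitian := by
    have : M.transpose = M := by
      simp [hMdef, Matrix.transpose_mul, hRt, Matrix.mul_assoc]
    simpa only [Matrix.IsHermitian, Matrix.conjTranspose_eq_transpose_of_trivial] using this
  have hMtr : M.trace = ∑ i, a i * S i i := by
    rw [hMdef, Matrix.trace_mul_comm, ← Matrix.mul_assoc, hRR, Matrix.trace_mul_comm]
    simp [Matrix.trace, Matrix.diagonal_mul]
  have hM2tr : (M * M).trace = ∑ i, ∑ j, a i * a j * S i j ^ 2 := by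
    have : M * M = R * (Matrix.diagonal a * S * Matrix.diagonal a * R) := by
      rw [← hRR, hMdef]; simp only [Matrix.mul_assoc]
    rw [this, Matrix.trace_mul_comm, Matrix.mul_assoc, hRR]
    refine Finset.sum_congr rfl fun i _ => ?_
    rw [Matrix.diag_apply, Matrix.mul_apply]
    refine Finset.sum_congr rfl fun j _ => ?_
    rw [Matrix.mul_diagonal, Matrix.diagonal_mul]
    have : S j i = S i j := congrFun (congrFun hSt i) j
    rw [this]; ring
  have hquad : ∀ v : EuclideanSpace ℝ ι, ∑ i, a i * (Matrix.toEuclideanCLM (𝕜 := ℝ) R v) i ^ 2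
      = ⟪v, Matrix.toEuclideanCLM (𝕜 := ℝ) M v⟫ := by
    intro v
    have h1 : Matrix.toEuclideanCLM (𝕜 := ℝ) M v = Matrix.toEuclideanCLM (𝕜 := ℝ) R
        (Matrix.toEuclideanCLM (𝕜 := ℝ) (Matrix.diagonal a)
          (Matrix.toEuclideanCLM (𝕜 := ℝ) R v)) := by
      simp [hMdef, map_mul]
    have h2 : IsSelfAdjoint (Matrix.toEuclideanCLM (𝕜 := ℝ) R) :=
      (CFC.sqrt_nonneg S).isSelfAdjoint.map _
    rw [h1, ← ContinuousLinearMap.adjoint_inner_left, h2.adjoint_eq]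
    simp only [PiLp.inner_apply, Matrix.ofLp_toEuclideanCLM, Matrix.mulVec_diagonal]
    refine Finset.sum_congr rfl fun i _ => ?_
    simp; ring
  have heig : ∀ k, Matrix.toEuclideanCLM (𝕜 := ℝ) M (hM.eigenvectorBasis k)
      = hM.eigenvalues k • hM.eigenvectorBasis k := by
    intro k
    have := hM.mulVec_eigenvectorBasis k
    ext i
    simpa [Matrix.ofLp_toEuclideanCLM] using congrFun this i
  refine ⟨hM.eigenvalues, hM.eigenvectorBasis, fun x => ?_, ?_, ?_, fun k => ?_⟩
  · rw [hquad, map_sum]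
    simp only [map_smul, heig]
    rw [show (∑ k, x k • hM.eigenvalues k • hM.eigenvectorBasis k)
      = ∑ k, (x k * hM.eigenvalues k) • hM.eigenvectorBasis k from by simp [mul_smul],
      hM.eigenvectorBasis.orthonormal.inner_sum]
    refine Finset.sum_congr rfl fun i _ => ?_
    simp; ring
  · rw [← hMtr, hM.trace_eq_sum_eigenvalues]; simp
  · rw [← hM2tr]
    have h := hM.spectral_theorem
    have h2 : M * M = Unitary.conjStarAlgAut ℝ _ hM.eigenvectorUnitary
        (Matrix.diagonal (RCLike.ofReal ∘ hM.eigenvalues) *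
          Matrix.diagonal (RCLike.ofReal ∘ hM.eigenvalues)) := by
      rw [map_mul, ← h]
    rw [h2, Unitary.conjStarAlgAut_apply, Matrix.trace_mul_comm, ← Matrix.mul_assoc]
    simp [Matrix.trace, pow_two]
  · -- a nonzero eigenvalue of `R D R` is an eigenvalue of `D S`, with eigenvector `D R v`
    by_cases hk : hM.eigenvalues k = 0
    · simpa [hk] using hC0
    set v : ι → ℝ := (hM.eigenvectorBasis k).ofLp
    have hv : M.mulVec v = hM.eigenvalues k • v := hM.mulVec_eigenvectorBasis k
    set w : ι → ℝ := (Matrix.diagonal a * R).mulVec v with hw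
    have hRw : R.mulVec w = hM.eigenvalues k • v := by
      rw [hw, Matrix.mulVec_mulVec, ← hv, hMdef, Matrix.mul_assoc]
    have hw0 : w ≠ 0 := by
      intro h0
      rw [h0, Matrix.mulVec_zero] at hRw
      have hv0 : v = 0 := by
        rcases smul_eq_zero.1 hRw.symm with h | h
        · exact absurd h hk
        · exact h
      refine hM.eigenvectorBasis.toBasis.ne_zero k ?_
      rw [OrthonormalBasis.coe_toBasis]
      ext i; exact congrFun hv0 i
    have hDS : ∀ i, a i * ∑ j, S i j * w j = hM.eigenvalues k * w i := by
      intro i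
      have h1 : (Matrix.diagonal a * S).mulVec w = hM.eigenvalues k • w := by
        rw [← hRR, ← Matrix.mul_assoc, ← Matrix.mulVec_mulVec, hRw, Matrix.mulVec_smul]
      have := congrFun h1 i
      rw [← Matrix.mulVec_mulVec, Matrix.mulVec_diagonal] at this
      simpa [Matrix.mulVec, dotProduct] using this
    obtain ⟨i0, hi0⟩ := Function.ne_iff.1 hw0
    obtain ⟨i, -, hi⟩ := Finset.exists_max_image Finset.univ (fun i => |w i|)
      ⟨i0, Finset.mem_univ _⟩
    have hpos : 0 < |w i| := (abs_pos.2 hi0).trans_le (hi i0 (Finset.mem_univ _))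
    have hle : |hM.eigenvalues k| * |w i| ≤ C * |w i| := by
      rw [← abs_mul, ← hDS, abs_mul]
      calc |a i| * |∑ j, S i j * w j| ≤ |a i| * ∑ j, |S i j| * |w i| := by
            gcongr
            refine (Finset.abs_sum_le_sum_abs _ _).trans (Finset.sum_le_sum fun j _ => ?_)
            rw [abs_mul]
            exact mul_le_mul_of_nonneg_left (hi j (Finset.mem_univ _)) (abs_nonneg _)
        _ = (|a i| * ∑ j, |S i j|) * |w i| := by rw [← Finset.sum_mul]; ring
        _ ≤ C * |w i| := by gcongr; exact hC i
    exact le_of_mul_le_mul_right hle hpos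

/-- A centred quadratic form in a centred Gaussian vector has the law of a linear combination of
independent variables `zᵢ² - 1`, with `zᵢ` standard normal. -/
theorem exists_map_quadraticForm_eq {Ω ι : Type*} [MeasurableSpace Ω] [Fintype ι]
    {μ : Measure Ω} [IsProbabilityMeasure μ] {X : ι → Ω → ℝ}
    (hX : HasGaussianLaw (fun ω i => X i ω) μ) (h0 : ∀ i, ∫ ω, X i ω ∂μ = 0) (a : ι → ℝ) {C : ℝ}
    (hC : ∀ i, |a i| * ∑ j, |cov[X i, X j; μ]| ≤ C) (hC0 : 0 ≤ C) :
    ∃ l : ι → ℝ,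
      μ.map (fun ω => ∑ i, a i * (X i ω ^ 2 - cov[X i, X i; μ])) =
        (Measure.pi fun _ : ι => gaussianReal 0 1).map (fun z => ∑ i, l i * (z i ^ 2 - 1)) ∧
      ∑ i, l i ^ 2 = ∑ i, ∑ j, a i * a j * cov[X i, X j; μ] ^ 2 ∧
      ∀ i, |l i| ≤ C := by
  classical
  have hXi : ∀ i, HasGaussianLaw (X i) μ := fun i =>
    hX.map_fun (ContinuousLinearMap.proj (R := ℝ) (φ := fun _ : ι => ℝ) i)
  have hXi2 : ∀ i, MemLp (X i) 2 μ := fun i => (hXi i).memLp_two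
  set Y : Ω → EuclideanSpace ℝ ι := fun ω => WithLp.toLp 2 (X · ω) with hYdef
  have hY : HasGaussianLaw Y μ :=
    hX.map_equiv_fun (PiLp.continuousLinearEquiv 2 ℝ (fun _ : ι => ℝ)).symm
  have hYm : AEMeasurable Y μ := hY.aemeasurable
  have := hY.isGaussian_map
  set S : Matrix ι ι ℝ := Matrix.of fun i j => cov[X i, X j; μ] with hSdef
  have hquad : ∀ x y : EuclideanSpace ℝ ι, covarianceBilin (μ.map Y) x y =
      (x : ι → ℝ) ⬝ᵥ S.mulVec y := by
    intro x y
    rw [hYdef, covarianceBilin_apply_pi hXi2]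
    simp only [dotProduct, Matrix.mulVec, hSdef, Matrix.of_apply, Finset.mul_sum]
    refine Finset.sum_congr rfl fun i _ => Finset.sum_congr rfl fun j _ => by ring
  have hS : S.PosSemidef := by
    refine Matrix.PosSemidef.of_dotProduct_mulVec_nonneg ?_ fun x => ?_
    · ext i j
      simp [hSdef, covariance_comm]
    · have := covarianceBilin_self_nonneg (μ := μ.map Y) (WithLp.toLp 2 x)
      rw [hquad] at this
      simpa using this
  have hlaw : μ.map Y = multivariateGaussian 0 S := by
    refine IsGaussian.ext ?_ ?_
    · rw [integral_id_multivariateGaussian']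
      rw [integral_map hYm (by fun_prop)]
      ext i
      have hint : Integrable Y μ := hY.integrable
      have := (EuclideanSpace.proj (𝕜 := ℝ) i).integral_comp_comm hint
      simp only [id]
      calc (∫ ω, Y ω ∂μ) i = ∫ ω, (EuclideanSpace.proj (𝕜 := ℝ) i) (Y ω) ∂μ :=
            this.symm
        _ = 0 := h0 i
    · ext x y
      rw [hquad, covarianceBilin_multivariateGaussian hS]
  obtain ⟨l, b, hl, hl1, hl2, hlC⟩ := exists_diagonalization hS a hC hC0
  refine ⟨l, ?_, hl2, hlC⟩
  have hQ : (fun ω => ∑ i, a i * (X i ω ^ 2 - cov[X i, X i; μ])) =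
      (fun y : EuclideanSpace ℝ ι => ∑ i, a i * (y i ^ 2 - S i i)) ∘ Y := rfl
  rw [hQ, ← AEMeasurable.map_map_of_aemeasurable (by fun_prop) hYm, hlaw, multivariateGaussian,
    stdGaussian_eq_map_pi_orthonormalBasis b, Measure.map_map (by fun_prop) (by fun_prop),
    Measure.map_map (by fun_prop) (by fun_prop)]
  congr 1
  ext x
  simp only [Function.comp, zero_add, mul_sub, Finset.sum_sub_distrib, mul_one]
  rw [hl x, hl1]

/-- The variance of `z²` for a standard normal `z`. Its value, which is `2`, is never needed: it is
carried along as a constant. -/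
def chiVar : ℝ := ∫ z, (z ^ 2 - 1) ^ 2 ∂(gaussianReal 0 1)

theorem chiVar_nonneg : 0 ≤ chiVar := integral_nonneg fun _ => sq_nonneg _

theorem memLp_sq_sub_one : MemLp (fun z : ℝ => z ^ 2 - 1) 2 (gaussianReal 0 1) := by
  refine MemLp.sub ?_ (memLp_const 1)
  have h : MemLp (id : ℝ → ℝ) 4 (gaussianReal 0 1) := memLp_id_gaussianReal' 4 (by simp)
  have := h.norm_rpow_div (q := 2)
  have h42 : (4 : ENNReal) / 2 = 2 := by
    rw [show (4 : ENNReal) = 2 * 2 by norm_num]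
    exact ENNReal.mul_div_cancel_right (by simp) (by simp)
  rw [h42] at this
  refine this.congr_norm (by fun_prop) (ae_of_all _ fun z => ?_)
  simp

theorem integral_sq_sub_one : ∫ z : ℝ, (z ^ 2 - 1) ∂(gaussianReal 0 1) = 0 := by
  have h2 : MemLp (id : ℝ → ℝ) 2 (gaussianReal 0 1) := memLp_id_gaussianReal' 2 (by simp)
  rw [integral_sub (by simpa using h2.integrable_sq) (integrable_const _)]
  have h := variance_eq_sub h2
  rw [variance_id_gaussianReal] at h
  simp [integral_id_gaussianReal] at h
  simp [← h]

theorem norm_prod_sub_prod_le {ι : Type*} (s : Finset ι) (z w : ι → ℂ)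
    (hz : ∀ i ∈ s, ‖z i‖ ≤ 1) (hw : ∀ i ∈ s, ‖w i‖ ≤ 1) :
    ‖∏ i ∈ s, z i - ∏ i ∈ s, w i‖ ≤ ∑ i ∈ s, ‖z i - w i‖ := by
  classical
  induction s using Finset.induction_on with
  | empty => simp
  | insert i s hi ih =>
    rw [Finset.prod_insert hi, Finset.prod_insert hi, Finset.sum_insert hi]
    have h1 := ih (fun k hk => hz k (Finset.mem_insert_of_mem hk))
      (fun k hk => hw k (Finset.mem_insert_of_mem hk))
    have h2 : ‖∏ k ∈ s, z k‖ ≤ 1 := by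
      rw [norm_prod]
      exact Finset.prod_le_one (fun _ _ => norm_nonneg _)
        fun k hk => hz k (Finset.mem_insert_of_mem hk)
    calc ‖z i * ∏ k ∈ s, z k - w i * ∏ k ∈ s, w k‖
        = ‖(z i - w i) * ∏ k ∈ s, z k + w i * (∏ k ∈ s, z k - ∏ k ∈ s, w k)‖ := by
          congr 1; ring
      _ ≤ ‖z i - w i‖ * 1 + 1 * ∑ k ∈ s, ‖z k - w k‖ := by
          refine (norm_add_le _ _).trans ?_
          rw [norm_mul, norm_mul]
          gcongr
          exact hw i (Finset.mem_insert_self _ _)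
      _ = _ := by ring

/-- The characteristic function of `z² - 1` agrees with the Gaussian one to second order at `0`. -/
theorem exists_norm_charFun_sub_exp_le {ε : ℝ} (hε : 0 < ε) : ∃ δ > 0, ∀ t : ℝ, |t| ≤ δ →
    ‖charFun ((gaussianReal 0 1).map fun z => z ^ 2 - 1) t - Complex.exp (-(chiVar * t ^ 2 / 2))‖
      ≤ ε * t ^ 2 := by
  set ν := (gaussianReal 0 1).map fun z : ℝ => z ^ 2 - 1
  have hm : AEMeasurable (fun z : ℝ => z ^ 2 - 1) (gaussianReal 0 1) := by fun_prop
  have hid : MemLp id 2 ν := by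
    rw [memLp_map_measure_iff (by fun_prop) hm]
    exact memLp_sq_sub_one
  have : IsProbabilityMeasure ν := Measure.isProbabilityMeasure_map hm
  have h1 : (fun t : ℝ => charFun ν t - (1 - (chiVar : ℂ) * t ^ 2 / 2)) =o[𝓝 0]
      fun t : ℝ => t ^ 2 := by
    have h := taylor_isLittleO_univ (f := charFun ν) (n := 2) (x₀ := 0)
      (contDiff_charFun (by simpa using hid))
    refine (h.congr' (.of_forall fun t => ?_) (.of_forall fun t => ?_))
    · have ht := taylorWithinEval_charFun_two_zero hm hid t
      rw [integral_sq_sub_one] at ht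
      change charFun ν t - taylorWithinEval (charFun ν) 2 Set.univ 0 t = _
      rw [ht]
      simp [chiVar]
    · simp
  have h2 : (fun t : ℝ => Complex.exp (-(chiVar * t ^ 2 / 2)) - (1 - (chiVar : ℂ) * t ^ 2 / 2))
      =o[𝓝 0] fun t : ℝ => t ^ 2 := by
    have h3 := (hasDerivAt_iff_isLittleO.1 (Complex.hasDerivAt_exp 0))
    have h4 : Tendsto (fun t : ℝ => (-(chiVar * t ^ 2 / 2) : ℂ)) (𝓝 0) (𝓝 0) := by
      have : Continuous (fun t : ℝ => (-(chiVar * t ^ 2 / 2) : ℂ)) := by fun_prop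
      simpa using this.tendsto 0
    have h5 := h3.comp_tendsto h4
    refine Asymptotics.IsLittleO.trans_isBigO
      (h5.congr_left (f₂ := fun t : ℝ =>
        Complex.exp (-(chiVar * t ^ 2 / 2)) - (1 - (chiVar : ℂ) * t ^ 2 / 2)) fun t => ?_) ?_
    · simp; ring
    · refine Asymptotics.IsBigO.of_bound (chiVar / 2) (.of_forall fun t => ?_)
      simp [abs_of_nonneg chiVar_nonneg]
      exact le_of_eq (by ring)
  have h3 := (h1.sub h2).bound hε
  rw [Metric.eventually_nhds_iff] at h3
  obtain ⟨δ, hδ, h⟩ := h3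
  refine ⟨δ / 2, by positivity, fun t ht => ?_⟩
  have := h (y := t) (by rw [Real.dist_eq, sub_zero]; linarith)
  simpa using this

theorem integral_exp_quadratic {ι : Type*} [Fintype ι] (l : ι → ℝ) :
    ∫ z : ι → ℝ, Complex.exp (((∑ i, l i * (z i ^ 2 - 1) : ℝ) : ℂ) * Complex.I)
      ∂(Measure.pi fun _ : ι => gaussianReal 0 1) =
    ∏ i, charFun ((gaussianReal 0 1).map fun z => z ^ 2 - 1) (l i) := by
  have : ∀ z : ι → ℝ, Complex.exp (((∑ i, l i * (z i ^ 2 - 1) : ℝ) : ℂ) * Complex.I) =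
      ∏ i, Complex.exp ((l i * (z i ^ 2 - 1) : ℝ) * Complex.I) := by
    intro z
    rw [← Complex.exp_sum, ← Finset.sum_mul]
    push_cast; rfl
  simp_rw [this]
  rw [integral_fintype_prod_eq_prod
    (f := fun i z => Complex.exp ((l i * (z ^ 2 - 1) : ℝ) * Complex.I))]
  refine Finset.prod_congr rfl fun i _ => ?_
  rw [charFun_apply_real, integral_map (by fun_prop) (by fun_prop)]
  simp

theorem integral_quadratic_sq {ι : Type*} [Fintype ι] (l : ι → ℝ) :
    MemLp (fun z : ι → ℝ => ∑ i, l i * (z i ^ 2 - 1)) 2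
      (Measure.pi fun _ : ι => gaussianReal 0 1) ∧
    ∫ z : ι → ℝ, (∑ i, l i * (z i ^ 2 - 1)) ^ 2 ∂(Measure.pi fun _ : ι => gaussianReal 0 1) =
      chiVar * ∑ i, l i ^ 2 := by
  set π := Measure.pi fun _ : ι => gaussianReal 0 1
  have hY : ∀ i, MemLp (fun z : ℝ => l i * (z ^ 2 - 1)) 2 (gaussianReal 0 1) := fun i =>
    memLp_sq_sub_one.const_mul _
  have hYi : ∀ i, MemLp (fun z : ι → ℝ => l i * (z i ^ 2 - 1)) 2 π := fun i =>
    (hY i).comp_measurePreserving (measurePreserving_eval (fun _ : ι => gaussianReal 0 1) i)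
  have hm : MemLp (fun z : ι → ℝ => ∑ i, l i * (z i ^ 2 - 1)) 2 π :=
    memLp_finsetSum _ fun i _ => hYi i
  refine ⟨hm, ?_⟩
  have h0 : ∫ z : ι → ℝ, (∑ i, l i * (z i ^ 2 - 1)) ∂π = 0 := by
    rw [integral_finsetSum _ fun i _ => (hYi i).integrable (by norm_num)]
    refine Finset.sum_eq_zero fun i _ => ?_
    have hmp := measurePreserving_eval (fun _ : ι => gaussianReal 0 1) i
    have h := integral_map (μ := π) hmp.measurable.aemeasurable
      (f := fun z : ℝ => l i * (z ^ 2 - 1)) (by fun_prop)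
    rw [hmp.map_eq, integral_const_mul, integral_sq_sub_one, mul_zero] at h
    exact h.symm
  have hv := variance_sum_pi (μ := fun _ : ι => gaussianReal 0 1)
    (X := fun i z => l i * (z ^ 2 - 1)) hY
  have hv1 : ∀ i, Var[fun z : ℝ => l i * (z ^ 2 - 1); gaussianReal 0 1] = l i ^ 2 * chiVar := by
    intro i
    rw [variance_const_mul, variance_eq_integral (by fun_prop), integral_sq_sub_one]
    simp [chiVar]
  rw [variance_eq_integral (Finset.aemeasurable_sum _ fun i _ => (hYi i).aemeasurable)] at hv
  simp only [Finset.sum_apply] at hv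
  rw [h0] at hv
  simp only [sub_zero, hv1] at hv
  rw [hv, Finset.mul_sum]
  exact Finset.sum_congr rfl fun i _ => mul_comm _ _

theorem integral_quadraticForm_sq {Ω ι : Type*} [MeasurableSpace Ω] [Fintype ι]
    {μ : Measure Ω} [IsProbabilityMeasure μ] {X : ι → Ω → ℝ}
    (hX : HasGaussianLaw (fun ω i => X i ω) μ) (h0 : ∀ i, ∫ ω, X i ω ∂μ = 0) (a : ι → ℝ) :
    MemLp (fun ω => ∑ i, a i * (X i ω ^ 2 - cov[X i, X i; μ])) 2 μ ∧
    ∫ ω, (∑ i, a i * (X i ω ^ 2 - cov[X i, X i; μ])) ^ 2 ∂μ =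
      chiVar * ∑ i, ∑ j, a i * a j * cov[X i, X j; μ] ^ 2 := by
  have hXi : ∀ i, AEMeasurable (X i) μ := fun i =>
    (hX.map_fun (ContinuousLinearMap.proj (R := ℝ) (φ := fun _ : ι => ℝ) i)).aemeasurable
  have hQ : AEMeasurable (fun ω => ∑ i, a i * (X i ω ^ 2 - cov[X i, X i; μ])) μ := by fun_prop
  -- only the variance is needed here, so any bound on the eigenvalues will do
  obtain ⟨l, hl, hl2, -⟩ := exists_map_quadraticForm_eq hX h0 a
    (C := ∑ i, |a i| * ∑ j, |cov[X i, X j; μ]|)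
    (fun i => Finset.single_le_sum (f := fun i => |a i| * ∑ j, |cov[X i, X j; μ]|)
      (fun _ _ => by positivity) (Finset.mem_univ i)) (by positivity)
  obtain ⟨hm, hi⟩ := integral_quadratic_sq l
  have hL : Measurable (fun z : ι → ℝ => ∑ i, l i * (z i ^ 2 - 1)) :=
    Finset.measurable_sum _ fun i _ => by fun_prop
  constructor
  · have := (memLp_map_measure_iff (f := fun ω => ∑ i, a i * (X i ω ^ 2 - cov[X i, X i; μ]))
      (g := (id : ℝ → ℝ)) (p := 2) (by fun_prop) hQ).1
    refine this ?_
    rw [hl, memLp_map_measure_iff (by fun_prop) hL.aemeasurable]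
    exact hm
  · rw [← hl2, ← hi]
    have e1 := integral_map hQ (f := fun x : ℝ => x ^ 2) (by fun_prop)
    have e2 := integral_map (μ := Measure.pi fun _ : ι => gaussianReal 0 1) hL.aemeasurable
      (f := fun x : ℝ => x ^ 2) (by fun_prop)
    rw [← e1, ← e2, hl]

/-- Central limit theorem for quadratic forms in Gaussian vectors: if the largest weighted row
sum tends to zero and the variances converge, then the characteristic functions converge at `1` to
that of a centred normal law. (Other arguments are covered by rescaling `a`.) -/
theorem tendsto_integral_exp_quadraticForm {Ω : Type*} {ι : ℕ → Type*} [MeasurableSpace Ω]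
    [∀ n, Fintype (ι n)] {μ : Measure Ω} [IsProbabilityMeasure μ] {X : ∀ n, ι n → Ω → ℝ}
    (hX : ∀ n, HasGaussianLaw (fun ω i => X n i ω) μ) (h0 : ∀ n i, ∫ ω, X n i ω ∂μ = 0)
    (a : ∀ n, ι n → ℝ) {C : ℕ → ℝ} (hC : ∀ n i, |a n i| * ∑ j, |cov[X n i, X n j; μ]| ≤ C n)
    (hC0 : ∀ n, 0 ≤ C n) (hClim : Tendsto C atTop (𝓝 0)) {v : ℝ}
    (hv : Tendsto (fun n => ∑ i, ∑ j, a n i * a n j * cov[X n i, X n j; μ] ^ 2) atTop (𝓝 v)) :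
    Tendsto (fun n => ∫ ω, Complex.exp
        (((∑ i, a n i * (X n i ω ^ 2 - cov[X n i, X n i; μ]) : ℝ) : ℂ) * Complex.I) ∂μ)
      atTop (𝓝 (Complex.exp (-(chiVar * v / 2)))) := by
  choose l hl hl2 hlC using fun n => exists_map_quadraticForm_eq (hX n) (h0 n) (a n) (hC n) (hC0 n)
  have key : ∀ n, ∫ ω, Complex.exp
        (((∑ i, a n i * (X n i ω ^ 2 - cov[X n i, X n i; μ]) : ℝ) : ℂ) * Complex.I) ∂μ =
      ∏ i, charFun ((gaussianReal 0 1).map fun z => z ^ 2 - 1) (l n i) := by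
    intro n
    have hXi : ∀ i, AEMeasurable (X n i) μ := fun i =>
      ((hX n).map_fun (ContinuousLinearMap.proj (R := ℝ) (φ := fun _ : ι n => ℝ) i)).aemeasurable
    have hQ : AEMeasurable (fun ω => ∑ i, a n i * (X n i ω ^ 2 - cov[X n i, X n i; μ])) μ := by
      fun_prop
    have hL : Measurable (fun z : ι n → ℝ => ∑ i, l n i * (z i ^ 2 - 1)) :=
      Finset.measurable_sum _ fun i _ => by fun_prop
    rw [← integral_exp_quadratic]
    have e1 := integral_map hQ (f := fun x : ℝ => Complex.exp (x * Complex.I)) (by fun_prop)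
    have e2 := integral_map (μ := Measure.pi fun _ : ι n => gaussianReal 0 1) hL.aemeasurable
      (f := fun x : ℝ => Complex.exp (x * Complex.I)) (by fun_prop)
    rw [← e1, ← e2, hl]
  simp_rw [key]
  simp_rw [← hl2] at hv
  have hexp : Tendsto (fun n => Complex.exp (-(chiVar * ((∑ i, l n i ^ 2 : ℝ) : ℂ) / 2))) atTop
      (𝓝 (Complex.exp (-(chiVar * v / 2)))) := by
    have hc : Continuous fun x : ℝ => Complex.exp (-(chiVar * (x : ℂ) / 2)) := by fun_prop
    exact (hc.tendsto v).comp hv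
  have hm : IsProbabilityMeasure ((gaussianReal 0 1).map fun z : ℝ => z ^ 2 - 1) :=
    Measure.isProbabilityMeasure_map (by fun_prop)
  have hdiff : Tendsto (fun n => ∏ i, charFun ((gaussianReal 0 1).map fun z => z ^ 2 - 1) (l n i)
      - Complex.exp (-(chiVar * ((∑ i, l n i ^ 2 : ℝ) : ℂ) / 2))) atTop (𝓝 0) := by
    rw [Metric.tendsto_atTop]
    intro ε hε
    have hv0 : 0 ≤ v := ge_of_tendsto' hv fun n => Finset.sum_nonneg fun i _ => sq_nonneg _
    obtain ⟨δ, hδ, hδε⟩ := exists_norm_charFun_sub_exp_le (ε := ε / (v + 2)) (by positivity)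
    have e1 := hClim.eventually_lt_const hδ
    have e2 := hv.eventually_lt_const (show v < v + 1 by linarith)
    obtain ⟨N, hN⟩ := (e1.and e2).exists_forall_of_atTop
    refine ⟨N, fun n hn => ?_⟩
    obtain ⟨hn1, hn2⟩ := hN n hn
    rw [dist_zero_right]
    have hE : Complex.exp (-(chiVar * ((∑ i, l n i ^ 2 : ℝ) : ℂ) / 2)) =
        ∏ i, Complex.exp (-(chiVar * (l n i : ℂ) ^ 2 / 2)) := by
      rw [← Complex.exp_sum]
      congr 1
      push_cast
      rw [Finset.mul_sum, Finset.sum_div, Finset.sum_neg_distrib]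
    rw [hE]
    have hone : ∀ i, ‖Complex.exp (-(chiVar * (l n i : ℂ) ^ 2 / 2))‖ ≤ 1 := by
      intro i
      have : (-(chiVar * (l n i : ℂ) ^ 2 / 2)) = ((-(chiVar * l n i ^ 2 / 2) : ℝ) : ℂ) := by
        push_cast; ring
      rw [this, ← Complex.ofReal_exp, Complex.norm_real, Real.norm_eq_abs, Real.abs_exp,
        Real.exp_le_one_iff]
      have := chiVar_nonneg
      have : 0 ≤ chiVar * l n i ^ 2 / 2 := by positivity
      linarith
    calc _ ≤ ∑ i, ‖charFun ((gaussianReal 0 1).map fun z => z ^ 2 - 1) (l n i) -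
            Complex.exp (-(chiVar * (l n i : ℂ) ^ 2 / 2))‖ :=
          norm_prod_sub_prod_le _ _ _ (fun i _ => norm_charFun_le_one _) fun i _ => hone i
      _ ≤ ∑ i, ε / (v + 2) * l n i ^ 2 :=
          Finset.sum_le_sum fun i _ => hδε _ ((hlC n i).trans hn1.le)
      _ = ε / (v + 2) * ∑ i, l n i ^ 2 := by rw [Finset.mul_sum]
      _ ≤ ε / (v + 2) * (v + 1) := by gcongr
      _ < ε := by rw [div_mul_eq_mul_div, div_lt_iff₀ (by positivity)]; nlinarith
  simpa using hdiff.add hexp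

/-! ### The tempered kernel and its autocorrelation -/

/-- The tempered power kernel `e^{-λ x} x^{H-1/2}` on the positive half-line, extended by zero. -/
def temperedKernel (H lam x : ℝ) : ℝ :=
  if 0 < x then Real.exp (-lam * x) * x ^ (H - 1 / 2) else 0

theorem maKernel_eq (H lam t u : ℝ) :
    maKernel H lam t u = temperedKernel H lam (t - u) - temperedKernel H lam (-u) := by
  simp [maKernel, temperedKernel]

theorem temperedKernel_nonneg (H lam x : ℝ) : 0 ≤ temperedKernel H lam x := by
  unfold temperedKernel
  split_ifs with h <;> positivity

theorem temperedKernel_eq_indicator (H lam : ℝ) : temperedKernel H lam =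
    (Set.Ioi (0 : ℝ)).indicator fun x => Real.exp (-lam * x) * x ^ (H - 1 / 2) := by
  ext x
  simp [temperedKernel, Set.indicator_apply]

theorem measurable_temperedKernel (H lam : ℝ) : Measurable (temperedKernel H lam) := by
  rw [temperedKernel_eq_indicator]
  exact Measurable.indicator (by fun_prop) measurableSet_Ioi

theorem memLp_temperedKernel {H lam : ℝ} (hH : 0 < H) (hl : 0 < lam) :
    MemLp (temperedKernel H lam) 2 volume := by
  rw [memLp_two_iff_integrable_sq (measurable_temperedKernel H lam).aestronglyMeasurable]
  have h := integrableOn_rpow_mul_exp_neg_mul_rpow (s := 2 * H - 1) (p := 1) (b := 2 * lam)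
    (by linarith) one_pos (by positivity)
  rw [← integrable_indicator_iff measurableSet_Ioi] at h
  refine h.congr (ae_of_all _ fun x => ?_)
  simp only [temperedKernel_eq_indicator, Set.indicator_apply, Set.mem_Ioi]
  split_ifs with hx
  · rw [Real.rpow_one, mul_pow, ← Real.exp_nat_mul, ← Real.rpow_mul_natCast hx.le]
    push_cast
    rw [mul_comm]
    congr 2 <;> ring
  · simp

theorem memLp_temperedKernel_sub {H lam : ℝ} (hH : 0 < H) (hl : 0 < lam) (t : ℝ) :
    MemLp (fun u => temperedKernel H lam (t - u)) 2 volume :=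
  (memLp_temperedKernel hH hl).comp_measurePreserving (Measure.measurePreserving_sub_left volume t)

theorem memLp_temperedKernel_add {H lam : ℝ} (hH : 0 < H) (hl : 0 < lam) (t : ℝ) :
    MemLp (fun u => temperedKernel H lam (u + t)) 2 volume :=
  (memLp_temperedKernel hH hl).comp_measurePreserving (measurePreserving_add_right volume t)

/-- The autocorrelation `∫ g(u + τ) g(u) du` of the tempered kernel `g`. It is the autocovariance
function of the stationary moving average of a white noise with kernel `g`. -/
def autocov (H lam τ : ℝ) : ℝ := ∫ u, temperedKernel H lam (u + τ) * temperedKernel H lam u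

theorem integral_temperedKernel_sub_mul (H lam s t : ℝ) :
    ∫ u, temperedKernel H lam (s - u) * temperedKernel H lam (t - u) = autocov H lam (s - t) := by
  rw [autocov, ← integral_sub_left_eq_self
    (fun v => temperedKernel H lam (v + (s - t)) * temperedKernel H lam v) volume t]
  refine integral_congr_ae (ae_of_all _ fun u => ?_)
  simp only
  congr 2; ring

theorem autocov_neg (H lam τ : ℝ) : autocov H lam (-τ) = autocov H lam τ := by
  have h1 := integral_temperedKernel_sub_mul H lam 0 τ
  have h2 := integral_temperedKernel_sub_mul H lam τ 0
  simp only [zero_sub, sub_zero] at h1 h2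
  rw [← h1, ← h2]
  exact integral_congr_ae (ae_of_all _ fun u => mul_comm _ _)

theorem autocov_abs (H lam τ : ℝ) : autocov H lam |τ| = autocov H lam τ := by
  rcases abs_choice τ with h | h <;> rw [h]
  exact autocov_neg _ _ _

theorem integrable_temperedKernel_mul {H lam : ℝ} (hH : 0 < H) (hl : 0 < lam) (s t : ℝ) :
    Integrable fun u => temperedKernel H lam (s - u) * temperedKernel H lam (t - u) :=
  (memLp_temperedKernel_sub hH hl s).integrable_mul (memLp_temperedKernel_sub hH hl t)

theorem integrable_temperedKernel_add_mul {H lam : ℝ} (hH : 0 < H) (hl : 0 < lam) (τ : ℝ) :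
    Integrable fun u => temperedKernel H lam (u + τ) * temperedKernel H lam u :=
  (memLp_temperedKernel_add hH hl τ).integrable_mul (memLp_temperedKernel hH hl)

/-- Exponential decay, from `g_λ(u + t) ≤ e^{-λ t/2} g_{λ/2}(u + t)` for `t ≥ 0`, `u > 0`. -/
theorem exists_abs_autocov_le {H lam : ℝ} (hH : 0 < H) (hl : 0 < lam) :
    ∃ C, 0 ≤ C ∧ ∀ τ, |autocov H lam τ| ≤ C * Real.exp (-(lam / 2) * |τ|) := by
  have hl2 : 0 < lam / 2 := by positivity
  set A := ∫ u, temperedKernel H (lam / 2) u ^ 2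
  set D := ∫ u, temperedKernel H lam u ^ 2
  have hA : 0 ≤ A := integral_nonneg fun _ => sq_nonneg _
  have hD : 0 ≤ D := integral_nonneg fun _ => sq_nonneg _
  refine ⟨A + D, by positivity, fun τ => ?_⟩
  rw [← autocov_abs]
  set t := |τ|
  have ht : 0 ≤ t := abs_nonneg τ
  have hpt : ∀ u, temperedKernel H lam (u + t) * temperedKernel H lam u ≤
      Real.exp (-(lam / 2) * t) *
        (temperedKernel H (lam / 2) (u + t) ^ 2 + temperedKernel H lam u ^ 2) := by
    intro u
    by_cases hu : 0 < u
    · have h1 : temperedKernel H lam (u + t) ≤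
          Real.exp (-(lam / 2) * t) * temperedKernel H (lam / 2) (u + t) := by
        have : 0 < u + t := by positivity
        simp only [temperedKernel, this, if_true]
        rw [← mul_assoc, ← Real.exp_add]
        gcongr
        nlinarith
      have h2 := temperedKernel_nonneg H lam u
      have h3 := Real.exp_pos (-(lam / 2) * t)
      calc _ ≤ Real.exp (-(lam / 2) * t) * temperedKernel H (lam / 2) (u + t)
            * temperedKernel H lam u := by gcongr
        _ = Real.exp (-(lam / 2) * t) * (temperedKernel H (lam / 2) (u + t)
            * temperedKernel H lam u) := by ring
        _ ≤ _ := by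
          gcongr
          nlinarith [sq_nonneg (temperedKernel H (lam / 2) (u + t) - temperedKernel H lam u),
            sq_nonneg (temperedKernel H (lam / 2) (u + t) + temperedKernel H lam u)]
    · have : temperedKernel H lam u = 0 := by simp [temperedKernel, hu]
      rw [this, mul_zero]
      positivity
  have hi1 : Integrable fun u => temperedKernel H (lam / 2) (u + t) ^ 2 :=
    (memLp_temperedKernel_add hH hl2 t).integrable_sq
  have hi2 : Integrable fun u => temperedKernel H lam u ^ 2 :=
    (memLp_temperedKernel hH hl).integrable_sq
  have h0 : 0 ≤ autocov H lam t := integral_nonneg fun u =>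
    mul_nonneg (temperedKernel_nonneg _ _ _) (temperedKernel_nonneg _ _ _)
  rw [abs_of_nonneg h0]
  calc autocov H lam t ≤ ∫ u, Real.exp (-(lam / 2) * t) *
        (temperedKernel H (lam / 2) (u + t) ^ 2 + temperedKernel H lam u ^ 2) :=
        integral_mono (integrable_temperedKernel_add_mul hH hl t)
          ((hi1.add hi2).const_mul _) hpt
    _ = _ := by
      rw [integral_const_mul, integral_add hi1 hi2,
        integral_add_right_eq_self (fun u => temperedKernel H (lam / 2) u ^ 2)]
      ring

/-- The integrand of `autocov` on the positive half-line, as the exponential of an affine function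
of the parameter `p = (H, λ)`. In this form the derivative in `p` can be read off. -/
def autocovIntegrand (τ : ℝ) (p : ℝ × ℝ) (x : ℝ) : ℝ :=
  Real.exp (-p.2 * (2 * x + τ) + (p.1 - 1 / 2) * (Real.log x + Real.log (x + τ)))

theorem indicator_autocovIntegrand {τ : ℝ} (hτ : 0 ≤ τ) (p : ℝ × ℝ) :
    (Set.Ioi (0 : ℝ)).indicator (autocovIntegrand τ p) =
      fun u => temperedKernel p.1 p.2 (u + τ) * temperedKernel p.1 p.2 u := by
  ext x
  simp only [Set.indicator_apply, Set.mem_Ioi]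
  split_ifs with hx
  · have hx' : 0 < x + τ := by positivity
    simp only [temperedKernel, hx, hx', if_true, autocovIntegrand]
    rw [Real.rpow_def_of_pos hx, Real.rpow_def_of_pos hx', ← Real.exp_add, ← Real.exp_add,
      ← Real.exp_add]
    congr 1; ring
  · simp [temperedKernel, hx]

theorem integrableOn_autocovIntegrand {τ : ℝ} (hτ : 0 ≤ τ) {p : ℝ × ℝ} (h1 : 0 < p.1)
    (h2 : 0 < p.2) : IntegrableOn (autocovIntegrand τ p) (Set.Ioi 0) := by
  rw [← integrable_indicator_iff measurableSet_Ioi, indicator_autocovIntegrand hτ]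
  exact integrable_temperedKernel_add_mul h1 h2 τ

theorem autocov_eq_setIntegral {τ : ℝ} (hτ : 0 ≤ τ) (p : ℝ × ℝ) :
    autocov p.1 p.2 τ = ∫ x in Set.Ioi 0, autocovIntegrand τ p x := by
  rw [← integral_indicator measurableSet_Ioi, indicator_autocovIntegrand hτ, autocov]

/-- Differentiation under the integral sign. Near `p`, the derivative of the integrand is dominated
by a multiple of its values at the two parameters `(p.1 ± 2r, p.2 - 2r)`. -/
theorem differentiableAt_autocov (τ : ℝ) {p : ℝ × ℝ} (h1 : 0 < p.1) (h2 : 0 < p.2) :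
    DifferentiableAt ℝ (fun q : ℝ × ℝ => autocov q.1 q.2 τ) p := by
  wlog hτ : 0 ≤ τ generalizing τ
  · have := this (-τ) (by linarith)
    simpa only [autocov_neg] using this
  simp_rw [autocov_eq_setIntegral hτ]
  -- `4 r` is at most both coordinates, so the two dominating parameters below stay positive
  set r := min p.1 p.2 / 4 with hr
  have hmin : 0 < min p.1 p.2 := lt_min h1 h2
  have hr0 : 0 < r := by positivity
  have hr1 : 4 * r ≤ p.1 := by rw [hr]; linarith [min_le_left p.1 p.2]
  have hr2 : 4 * r ≤ p.2 := by rw [hr]; linarith [min_le_right p.1 p.2]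
  have hmeas : ∀ q : ℝ × ℝ, Measurable (autocovIntegrand τ q) := fun q => by
    unfold autocovIntegrand; fun_prop
  have key := hasFDerivAt_integral_of_dominated_of_fderiv_le
    (μ := volume.restrict (Set.Ioi (0 : ℝ))) (F := autocovIntegrand τ) (x₀ := p)
    (s := Metric.ball p r)
    (F' := fun q x => autocovIntegrand τ q x • ((Real.log x + Real.log (x + τ)) •
      ContinuousLinearMap.fst ℝ ℝ ℝ - (2 * x + τ) • ContinuousLinearMap.snd ℝ ℝ ℝ))
    (bound := fun x => 2 / r * (autocovIntegrand τ (p.1 + 2 * r, p.2 - 2 * r) x +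
      autocovIntegrand τ (p.1 - 2 * r, p.2 - 2 * r) x))
    (Metric.ball_mem_nhds p hr0) (.of_forall fun q => (hmeas q).aestronglyMeasurable)
    (integrableOn_autocovIntegrand hτ h1 h2) ?_ ?_ ?_ ?_
  · exact key.differentiableAt
  · refine AEStronglyMeasurable.smul (hmeas p).aestronglyMeasurable ?_
    refine AEStronglyMeasurable.sub ?_ ?_
    · exact AEStronglyMeasurable.smul_const (by fun_prop) _
    · exact AEStronglyMeasurable.smul_const (by fun_prop) _
  · refine (ae_restrict_iff' measurableSet_Ioi).2 (ae_of_all _ fun x hx q hq => ?_)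
    have hx : 0 < x := hx
    set a := 2 * x + τ with ha
    set b := Real.log x + Real.log (x + τ) with hb
    have ha0 : 0 < a := by positivity
    have hnorm : ‖b • ContinuousLinearMap.fst ℝ ℝ ℝ - a • ContinuousLinearMap.snd ℝ ℝ ℝ‖
        ≤ |b| + a := by
      refine (norm_sub_le _ _).trans ?_
      rw [norm_smul, norm_smul, Real.norm_eq_abs, Real.norm_eq_abs, abs_of_pos ha0]
      have e1 := ContinuousLinearMap.norm_fst_le ℝ ℝ ℝ
      have e2 := ContinuousLinearMap.norm_snd_le ℝ ℝ ℝ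
      have := abs_nonneg b
      nlinarith
    have hq' := Metric.mem_ball.1 hq
    rw [Prod.dist_eq, max_lt_iff, Real.dist_eq, Real.dist_eq] at hq'
    obtain ⟨hqa, hqb⟩ := hq'
    -- `r y + 1 ≤ e^{r y}`
    have hlin : ∀ y : ℝ, 0 ≤ y → y ≤ Real.exp (r * y) / r := by
      intro y hy
      rw [le_div_iff₀ hr0]
      linarith [Real.add_one_le_exp (r * y)]
    have hF : autocovIntegrand τ q x ≤
        Real.exp (-(p.2 - r) * a + (p.1 - 1 / 2) * b + r * |b|) := by
      unfold autocovIntegrand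
      rw [Real.exp_le_exp, ← ha, ← hb]
      have e1 : (p.2 - r) * a ≤ q.2 * a := by
        gcongr; linarith [(abs_lt.1 hqb).1]
      have e2 : (q.1 - p.1) * b ≤ r * |b| := by
        calc (q.1 - p.1) * b ≤ |(q.1 - p.1) * b| := le_abs_self _
          _ = |q.1 - p.1| * |b| := abs_mul _ _
          _ ≤ r * |b| := by gcongr
      nlinarith
    -- the polynomial factor of the derivative costs another `r` in both exponents
    have hE : |b| + a ≤ 2 / r * Real.exp (r * |b| + r * a) := by
      have e1 : Real.exp (r * |b|) ≤ Real.exp (r * |b| + r * a) := by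
        rw [Real.exp_le_exp]; nlinarith
      have e2 : Real.exp (r * a) ≤ Real.exp (r * |b| + r * a) := by
        rw [Real.exp_le_exp]; nlinarith [abs_nonneg b]
      calc |b| + a ≤ Real.exp (r * |b|) / r + Real.exp (r * a) / r :=
            add_le_add (hlin _ (abs_nonneg _)) (hlin _ ha0.le)
        _ ≤ Real.exp (r * |b| + r * a) / r + Real.exp (r * |b| + r * a) / r := by gcongr
        _ = _ := by ring
    have h0 : 0 < autocovIntegrand τ q x := Real.exp_pos _
    rw [norm_smul, Real.norm_eq_abs, abs_of_pos h0]
    calc autocovIntegrand τ q x * ‖b • ContinuousLinearMap.fst ℝ ℝ ℝ -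
          a • ContinuousLinearMap.snd ℝ ℝ ℝ‖
        ≤ Real.exp (-(p.2 - r) * a + (p.1 - 1 / 2) * b + r * |b|) *
          (2 / r * Real.exp (r * |b| + r * a)) := by
          gcongr
          exact hnorm.trans hE
      _ = 2 / r * Real.exp (-(p.2 - 2 * r) * a + (p.1 - 1 / 2) * b + 2 * r * |b|) := by
          rw [mul_left_comm, ← Real.exp_add]
          congr 2; ring
      _ ≤ _ := by
          gcongr
          unfold autocovIntegrand
          rcases abs_cases b with ⟨h, -⟩ | ⟨h, -⟩
          · refine le_add_of_le_of_nonneg (le_of_eq ?_) (Real.exp_pos _).le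
            rw [h, ← hb, ← ha]
            congr 1; ring
          · refine le_add_of_nonneg_of_le (Real.exp_pos _).le (le_of_eq ?_)
            rw [h, ← hb, ← ha]
            congr 1; ring
  · refine Integrable.const_mul (Integrable.add ?_ ?_) _
    · exact integrableOn_autocovIntegrand hτ (by simp only; linarith) (by simp only; linarith)
    · exact integrableOn_autocovIntegrand hτ (by simp only; linarith) (by simp only; linarith)
  · refine ae_of_all _ fun x q _ => ?_
    unfold autocovIntegrand
    have h : HasFDerivAt (fun q : ℝ × ℝ => -q.2 * (2 * x + τ) +
        (q.1 - 1 / 2) * (Real.log x + Real.log (x + τ)))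
        ((Real.log x + Real.log (x + τ)) • ContinuousLinearMap.fst ℝ ℝ ℝ -
          (2 * x + τ) • ContinuousLinearMap.snd ℝ ℝ ℝ) q := by
      have h1 := ((hasFDerivAt_snd (𝕜 := ℝ) (p := q)).neg.mul_const (2 * x + τ)).add
        (((hasFDerivAt_fst (𝕜 := ℝ) (p := q)).sub_const (1 / 2)).mul_const
          (Real.log x + Real.log (x + τ)))
      refine h1.congr_fderiv ?_
      ext <;> simp
    exact h.exp

theorem integral_sum_temperedKernel_mul {H lam : ℝ} (hH : 0 < H) (hl : 0 < lam)
    (s s' : Finset ℤ) (h h' : ℤ → ℝ) (t t' : ℝ) :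
    ∫ u, (∑ m ∈ s, h m * temperedKernel H lam (t - m - u)) *
        (∑ m ∈ s', h' m * temperedKernel H lam (t' - m - u)) =
      ∑ m ∈ s, ∑ m' ∈ s', h m * h' m' * autocov H lam (t - m - (t' - m')) := by
  simp_rw [Finset.sum_mul_sum]
  have hint : ∀ m m' : ℤ, Integrable fun u => h m * temperedKernel H lam (t - m - u) *
      (h' m' * temperedKernel H lam (t' - m' - u)) := by
    intro m m'
    refine ((integrable_temperedKernel_mul hH hl (t - m) (t' - m')).const_mul
      (h m * h' m')).congr (ae_of_all _ fun u => ?_)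
    simp only; ring
  rw [integral_finsetSum _ fun m _ => integrable_finsetSum _ fun m' _ => hint m m']
  refine Finset.sum_congr rfl fun m _ => ?_
  rw [integral_finsetSum _ fun m' _ => hint m m']
  refine Finset.sum_congr rfl fun m' _ => ?_
  rw [← integral_temperedKernel_sub_mul, ← integral_const_mul]
  refine integral_congr_ae (ae_of_all _ fun u => ?_)
  simp only; ring

/-- Translates of the tempered kernel by distinct integers are linearly independent, so `autocov` is
strictly positive definite on the integers. -/
theorem sum_autocov_pos {H lam : ℝ} (hH : 0 < H) (hl : 0 < lam) (s : Finset ℤ) (h : ℤ → ℝ)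
    (hne : ∃ m ∈ s, h m ≠ 0) :
    0 < ∑ m ∈ s, ∑ m' ∈ s, h m * h m' * autocov H lam ((m' : ℝ) - m) := by
  classical
  have hsum := integral_sum_temperedKernel_mul hH hl s s h h 0 0
  have e : ∑ m ∈ s, ∑ m' ∈ s, h m * h m' * autocov H lam ((m' : ℝ) - m) =
      ∫ u, (∑ m ∈ s, h m * temperedKernel H lam (0 - m - u)) ^ 2 := by
    simp_rw [pow_two]
    rw [hsum]
    refine Finset.sum_congr rfl fun m _ => Finset.sum_congr rfl fun m' _ => ?_
    congr 2; ring
  rw [e]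
  have hmem : MemLp (fun u => ∑ m ∈ s, h m * temperedKernel H lam (0 - m - u)) 2 volume :=
    memLp_finsetSum _ fun m _ => (memLp_temperedKernel_sub hH hl (0 - m)).const_mul _
  rw [integral_pos_iff_support_of_nonneg (fun u => sq_nonneg _) hmem.integrable_sq]
  -- only the smallest nonzero tap reaches the last unit interval
  have hs : (s.filter fun m => h m ≠ 0).Nonempty := by
    obtain ⟨m, hm, hm0⟩ := hne
    exact ⟨m, Finset.mem_filter.2 ⟨hm, hm0⟩⟩
  set m₀ := (s.filter fun m => h m ≠ 0).min' hs with hm₀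
  have hm₀' := Finset.mem_filter.1 ((s.filter fun m => h m ≠ 0).min'_mem hs)
  rw [← hm₀] at hm₀'
  -- on this interval the kernels of all later taps vanish
  have hsub : Set.Ioo (-(m₀ : ℝ) - 1) (-(m₀ : ℝ)) ⊆
      Function.support fun u => (∑ m ∈ s, h m * temperedKernel H lam (0 - m - u)) ^ 2 := by
    intro u hu
    rw [Function.mem_support]
    refine pow_ne_zero 2 ?_
    rw [Finset.sum_eq_single m₀]
    · refine mul_ne_zero hm₀'.2 ?_
      have : 0 < 0 - (m₀ : ℝ) - u := by linarith [hu.2]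
      simp only [temperedKernel, this, if_true]
      positivity
    · intro m hm hmne
      by_cases hz : h m = 0
      · simp [hz]
      · have hlt : m₀ < m := lt_of_le_of_ne
          (Finset.min'_le _ _ (Finset.mem_filter.2 ⟨hm, hz⟩)) (Ne.symm hmne)
        have hle : (m₀ : ℝ) + 1 ≤ m := by exact_mod_cast hlt
        have : ¬ 0 < 0 - (m : ℝ) - u := by linarith [hu.1]
        rw [temperedKernel, if_neg this, mul_zero]
    · intro hm; exact absurd hm₀'.1 hm
  refine lt_of_lt_of_le ?_ (measure_mono hsub)
  simp

/-! ### Averages of exponentially decaying functions of the lag -/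

theorem summable_pow_natAbs {q : ℝ} (hq0 : 0 ≤ q) (hq1 : q < 1) :
    Summable fun z : ℤ => q ^ z.natAbs := by
  refine Summable.of_nat_of_neg ?_ ?_
  · simpa using summable_geometric_of_lt_one hq0 hq1
  · simpa using summable_geometric_of_lt_one hq0 hq1

theorem sum_pow_natAbs_le {q : ℝ} (hq0 : 0 ≤ q) (hq1 : q < 1) {ι : Type*} (s : Finset ι)
    {f : ι → ℤ} (hf : Function.Injective f) :
    ∑ i ∈ s, q ^ (f i).natAbs ≤ ∑' z : ℤ, q ^ z.natAbs := by
  have hs := summable_pow_natAbs hq0 hq1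
  exact ((hs.comp_injective hf).sum_le_tsum s (fun i _ => pow_nonneg hq0 _)).trans
    (tsum_comp_le_tsum_of_inj hs (fun z => by positivity) hf)

/-- For fixed `k'`, summing `ρ (a k - a c k')` over all integers `k` gives `∑ ρ (a z)`. Cutting the
sum to `1 ≤ k ≤ n / a` costs a term that is exponentially small in the distance of `k'` from the two
ends of its range, so the total error is bounded in `n`. -/
theorem abs_sum_sub_le {q C : ℝ} (hq0 : 0 ≤ q) (hq1 : q < 1) (hC : 0 ≤ C) {ρ : ℤ → ℝ}
    (hρ : ∀ z, |ρ z| ≤ C * q ^ z.natAbs) {a c : ℕ} (ha : 0 < a) (hc : 0 < c) (n : ℕ) :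
    |∑ k ∈ Finset.Icc 1 (n / a), ∑ k' ∈ Finset.Icc 1 (n / (a * c)),
        ρ ((a : ℤ) * k - (a * c : ℕ) * k') - (n / (a * c) : ℕ) * ∑' z : ℤ, ρ (a * z)| ≤
      2 * C * (∑' z : ℤ, q ^ z.natAbs) ^ 2 := by
  set N := n / a with hN
  set N' := n / (a * c) with hN'
  set T := ∑' z : ℤ, q ^ z.natAbs with hT
  have hT0 : 0 ≤ T := tsum_nonneg fun z => by positivity
  have hqs := summable_pow_natAbs hq0 hq1
  have hNc : c * N' ≤ N := by
    rw [hN, hN', ← Nat.div_div_eq_div_mul]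
    exact Nat.mul_div_le _ _
  have haz : (a : ℤ) ≠ 0 := by exact_mod_cast ha.ne'
  have hinj : Function.Injective fun z : ℤ => (a : ℤ) * z := fun x y h => mul_left_cancel₀ haz h
  have hρs : Summable fun z : ℤ => ρ (a * z) := by
    have h1 : Summable ρ := Summable.of_norm_bounded (hqs.mul_left C) hρ
    exact h1.comp_injective hinj
  have hin : ∀ k' ∈ Finset.Icc 1 N', |∑ k ∈ Finset.Icc 1 N, ρ ((a : ℤ) * k - (a * c : ℕ) * k') -
      ∑' z : ℤ, ρ (a * z)| ≤ C * T * (q ^ k' + q ^ (N' - k')) := by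
    intro k' hk'
    obtain ⟨hk1, hk2⟩ := Finset.mem_Icc.1 hk'
    set g : ℤ → ℝ := fun k => ρ ((a : ℤ) * k - (a * c : ℕ) * k') with hg
    have hge : g = (fun z : ℤ => ρ (a * z)) ∘ Equiv.subRight ((c : ℤ) * k') := by
      ext z
      simp only [hg, Function.comp, Equiv.subRight_apply]
      congr 1; push_cast; ring
    have hgs : Summable g := by
      rw [hge]; exact (Equiv.summable_iff _).2 hρs
    have hgt : ∑' z, g z = ∑' z : ℤ, ρ (a * z) := by
      rw [hge]; exact (Equiv.subRight ((c : ℤ) * k')).tsum_eq (fun z : ℤ => ρ (a * z))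
    set s : Finset ℤ := Finset.Icc 1 (N : ℤ) with hs
    have hsum : ∑ k ∈ Finset.Icc 1 N, ρ ((a : ℤ) * k - (a * c : ℕ) * k') = ∑ z ∈ s, g z := by
      refine Finset.sum_bij (fun k _ => (k : ℤ)) ?_ ?_ ?_ ?_
      · intro k hk
        have := Finset.mem_Icc.1 hk
        rw [hs, Finset.mem_Icc]; omega
      · intro x _ y _ h; exact_mod_cast h
      · intro z hz
        rw [hs, Finset.mem_Icc] at hz
        exact ⟨z.toNat, by rw [Finset.mem_Icc]; omega, by omega⟩
      · intro k _; rfl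
    rw [hsum, ← hgt]
    have hind : ∑ z ∈ s, g z = ∑' z, (s : Set ℤ).indicator g z := by
      rw [tsum_eq_sum (s := s)]
      · exact Finset.sum_congr rfl fun z hz => by simp [hz]
      · intro z hz; simp [hz]
    have hdiff : ∑' z, g z - ∑' z, (s : Set ℤ).indicator g z =
        ∑' z, (g z - (s : Set ℤ).indicator g z) := (hgs.tsum_sub (hgs.indicator _)).symm
    rw [hind, abs_sub_comm, ← Real.norm_eq_abs, hdiff]
    have hshift : Summable fun z : ℤ => q ^ (z - (N + 1)).natAbs :=
      (Equiv.summable_iff (f := fun z : ℤ => q ^ z.natAbs) (Equiv.subRight ((N : ℤ) + 1))).2 hqs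
    have hshiftT : ∑' z : ℤ, q ^ (z - (N + 1)).natAbs = T :=
      (Equiv.subRight ((N : ℤ) + 1)).tsum_eq (fun z : ℤ => q ^ z.natAbs)
    have hbs : HasSum (fun z : ℤ => C * (q ^ k' * q ^ z.natAbs + q ^ (N' - k') *
        q ^ (z - (N + 1)).natAbs)) (C * (q ^ k' * T + q ^ (N' - k') * T)) := by
      have h1 := hqs.hasSum.mul_left (q ^ k')
      have h2 := hshift.hasSum.mul_left (q ^ (N' - k'))
      rw [hshiftT] at h2
      exact (h1.add h2).mul_left C
    refine (tsum_of_norm_bounded hbs fun z => ?_).trans (le_of_eq (by ring))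
    by_cases hz : z ∈ s
    · simp only [Set.indicator, Finset.mem_coe, hz, if_true, sub_self, norm_zero]
      positivity
    · simp only [Set.indicator, Finset.mem_coe, hz, if_false, sub_zero]
      rw [Real.norm_eq_abs]
      refine (hρ _).trans ?_
      gcongr
      have ha1 : (1 : ℤ) ≤ a := by exact_mod_cast ha
      have hc1 : (1 : ℤ) ≤ c := by exact_mod_cast hc
      have hNc' : (c : ℤ) * N' ≤ N := by exact_mod_cast hNc
      have hk1' : (1 : ℤ) ≤ k' := by exact_mod_cast hk1
      have hk2' : (k' : ℤ) ≤ N' := by exact_mod_cast hk2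
      have hfac : (a : ℤ) * z - (a * c : ℕ) * k' = a * (z - c * k') := by push_cast; ring
      have habs : (z - c * k' : ℤ).natAbs ≤ ((a : ℤ) * z - (a * c : ℕ) * k').natAbs := by
        rw [hfac, Int.natAbs_mul]
        exact Nat.le_mul_of_pos_left _ (by simpa using ha)
      rw [hs, Finset.mem_Icc, not_and_or, not_le, not_le] at hz
      -- below the range `|z - c k'| ≥ k' + |z|`, above it `|z - c k'| ≥ (N' - k') + |z - (N + 1)|`
      have hck : (k' : ℤ) ≤ c * k' := by nlinarith
      have hckN : (c : ℤ) * k' + (N' - k') ≤ c * N' := by nlinarith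
      rcases hz with hz | hz
      · refine le_add_of_le_of_nonneg ?_ (by positivity)
        rw [← pow_add]
        refine pow_le_pow_of_le_one hq0 hq1.le (le_trans ?_ habs)
        omega
      · refine le_add_of_nonneg_of_le (by positivity) ?_
        rw [← pow_add]
        refine pow_le_pow_of_le_one hq0 hq1.le (le_trans ?_ habs)
        omega
  rw [Finset.sum_comm]
  have hconst : ((N' : ℕ) : ℝ) * ∑' z : ℤ, ρ (a * z) =
      ∑ k' ∈ Finset.Icc 1 N', ∑' z : ℤ, ρ (a * z) := by simp
  rw [hconst, ← Finset.sum_sub_distrib]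
  refine (Finset.abs_sum_le_sum_abs _ _).trans ((Finset.sum_le_sum hin).trans ?_)
  rw [← Finset.mul_sum, Finset.sum_add_distrib]
  have h1 : ∑ k' ∈ Finset.Icc 1 N', q ^ k' ≤ T := by
    simpa using sum_pow_natAbs_le hq0 hq1 (Finset.Icc 1 N') (f := fun k : ℕ => (k : ℤ))
      Nat.cast_injective
  have h2 : ∑ k' ∈ Finset.Icc 1 N', q ^ (N' - k') ≤ T := by
    have := sum_pow_natAbs_le hq0 hq1 (Finset.Icc 1 N') (f := fun k : ℕ => (N' : ℤ) - k)
      (fun x y h => by simpa using h)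
    refine le_trans (le_of_eq (Finset.sum_congr rfl fun k hk => ?_)) this
    have := Finset.mem_Icc.1 hk
    congr 1; omega
  calc C * T * (∑ k' ∈ Finset.Icc 1 N', q ^ k' + ∑ k' ∈ Finset.Icc 1 N', q ^ (N' - k'))
      ≤ C * T * (T + T) := by gcongr
    _ = _ := by ring

theorem tendsto_div_natDiv {a : ℕ} (ha : 0 < a) :
    Tendsto (fun n : ℕ => (n : ℝ) / (n / a : ℕ)) atTop (𝓝 a) := by
  have hd : Tendsto (fun n : ℕ => n / a) atTop atTop := Nat.tendsto_div_const_atTop ha.ne'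
  have hd' : Tendsto (fun n : ℕ => ((n / a : ℕ) : ℝ)) atTop atTop :=
    tendsto_natCast_atTop_atTop.comp hd
  have h0 : Tendsto (fun n : ℕ => (n : ℝ) / (n / a : ℕ) - a) atTop (𝓝 0) := by
    refine squeeze_zero_norm' ?_ ((tendsto_const_nhds (x := (a : ℝ))).div_atTop hd')
    filter_upwards [hd.eventually_ge_atTop 1] with n hn
    have hpos : (0 : ℝ) < (n / a : ℕ) := by exact_mod_cast hn
    have hdm : (n : ℝ) = a * (n / a : ℕ) + (n % a : ℕ) := by
      exact_mod_cast (Nat.div_add_mod n a).symm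
    have hmod : ((n % a : ℕ) : ℝ) ≤ a := by exact_mod_cast (Nat.mod_lt n ha).le
    have : (n : ℝ) / (n / a : ℕ) - a = (n % a : ℕ) / (n / a : ℕ) := by
      field_simp
      linarith
    rw [this, Real.norm_eq_abs, abs_of_nonneg (by positivity)]
    gcongr
  simpa using h0.add_const (a : ℝ)

/-- Averages over two octaves of a function of the lag `2^j k - 2^j' k'` converge, when normalized
by `n / (n_j n_j')`. -/
theorem exists_tendsto_average {q C : ℝ} (hq0 : 0 ≤ q) (hq1 : q < 1) (hC : 0 ≤ C) {ρ : ℤ → ℝ}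
    (hρ : ∀ z, |ρ z| ≤ C * q ^ z.natAbs) (j j' : ℕ) :
    ∃ L, Tendsto (fun n : ℕ => (n : ℝ) / ((numCoeff n j : ℝ) * numCoeff n j') *
      ∑ k ∈ Finset.Icc 1 (numCoeff n j), ∑ k' ∈ Finset.Icc 1 (numCoeff n j'),
        ρ (2 ^ j * k - 2 ^ j' * k')) atTop (𝓝 L) := by
  wlog hjj : j ≤ j' generalizing ρ j j'
  · obtain ⟨L, hL⟩ := this (ρ := fun z => ρ (-z)) (fun z => by simpa using hρ (-z)) j' j
      (by omega)
    refine ⟨L, hL.congr fun n => ?_⟩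
    rw [Finset.sum_comm, mul_comm (numCoeff n j' : ℝ)]
    simp only [neg_sub]
  set a := 2 ^ j with ha
  set c := 2 ^ (j' - j) with hc
  have hac : a * c = 2 ^ j' := by rw [ha, hc, ← pow_add]; congr 1; omega
  have ha0 : 0 < a := by positivity
  have hac0 : 0 < a * c := by positivity
  set S : ℕ → ℝ := fun n => ∑ k ∈ Finset.Icc 1 (n / a), ∑ k' ∈ Finset.Icc 1 (n / (a * c)),
    ρ ((a : ℤ) * k - (a * c : ℕ) * k') with hS
  set K := 2 * C * (∑' z : ℤ, q ^ z.natAbs) ^ 2 with hK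
  set s := ∑' z : ℤ, ρ (a * z)
  have hbd : ∀ n, |S n - (n / (a * c) : ℕ) * s| ≤ K := fun n =>
    abs_sum_sub_le hq0 hq1 hC hρ ha0 (by positivity) n
  have hd : Tendsto (fun n : ℕ => n / (a * c)) atTop atTop := Nat.tendsto_div_const_atTop hac0.ne'
  have hd' : Tendsto (fun n : ℕ => ((n / (a * c) : ℕ) : ℝ)) atTop atTop :=
    tendsto_natCast_atTop_atTop.comp hd
  have h1 : Tendsto (fun n => S n / (n / (a * c) : ℕ)) atTop (𝓝 s) := by
    have h0 : Tendsto (fun n => S n / (n / (a * c) : ℕ) - s) atTop (𝓝 0) := by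
      refine squeeze_zero_norm' ?_ ((tendsto_const_nhds (x := K)).div_atTop hd')
      filter_upwards [hd.eventually_ge_atTop 1] with n hn
      have hpos : (0 : ℝ) < (n / (a * c) : ℕ) := by exact_mod_cast hn
      have : S n / (n / (a * c) : ℕ) - s = (S n - (n / (a * c) : ℕ) * s) / (n / (a * c) : ℕ) := by
        field_simp
      rw [this, Real.norm_eq_abs, abs_div, abs_of_pos hpos]
      gcongr
      exact hbd n
    simpa using h0.add_const s
  refine ⟨a * s, ((tendsto_div_natDiv ha0).mul h1).congr fun n => ?_⟩
  rw [div_mul_div_comm, ← div_mul_eq_mul_div, hS]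
  have haz : (2 : ℤ) ^ j = (a : ℤ) := by rw [ha]; push_cast; rfl
  have hacz : (2 : ℤ) ^ j' = ((a * c : ℕ) : ℤ) := by rw [hac]; push_cast; rfl
  simp only [numCoeff, ← hac, haz, hacz, ← ha]

/-! ### The wavelet filters -/

/-- The set of `ℓ` with `h_{j,ℓ} ≠ 0`, as a finset. It defaults to `∅` if that set is infinite,
which does not happen for compactly supported `φ` and `ψ`, by `mem_filterSupport`. -/
def filterSupport (φ ψ : ℝ → ℝ) (j : ℕ) : Finset ℤ :=
  open Classical in
  if h : (Function.support (filterCoeff φ ψ j)).Finite then h.toFinset else ∅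

theorem exists_finset_mul_eq_zero {φ ψ : ℝ → ℝ} (hφ : HasCompactSupport φ)
    (hψ : HasCompactSupport ψ) (j : ℕ) :
    ∃ s : Finset ℤ, ∀ l ∉ s, ∀ t : ℝ, φ (t + l) * ψ (t / 2 ^ j) = 0 := by
  obtain ⟨R, hR⟩ := (Metric.isBounded_iff_subset_closedBall (0 : ℝ)).1 hφ.isCompact.isBounded
  obtain ⟨R', hR'⟩ := (Metric.isBounded_iff_subset_closedBall (0 : ℝ)).1 hψ.isCompact.isBounded
  have h1 : ∀ t, φ t ≠ 0 → |t| ≤ R := fun t ht => by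
    simpa using hR (subset_tsupport φ ht)
  have h2 : ∀ t, ψ t ≠ 0 → |t| ≤ R' := fun t ht => by
    simpa using hR' (subset_tsupport ψ ht)
  refine ⟨Finset.Icc (-⌈R + 2 ^ j * R'⌉) ⌈R + 2 ^ j * R'⌉, fun l hl t => ?_⟩
  by_contra hne
  have e1 := h1 _ (left_ne_zero_of_mul hne)
  have e2 := h2 _ (right_ne_zero_of_mul hne)
  rw [abs_div, abs_of_pos (by positivity : (0 : ℝ) < 2 ^ j), div_le_iff₀ (by positivity)] at e2
  have e3 : |(l : ℝ)| ≤ R + 2 ^ j * R' := by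
    have := abs_sub (t + l) t
    rw [add_sub_cancel_left] at this
    linarith
  have e4 : |(l : ℝ)| ≤ (⌈R + 2 ^ j * R'⌉ : ℝ) := e3.trans (Int.le_ceil _)
  apply hl
  rw [abs_le] at e4
  rw [Finset.mem_Icc]
  exact ⟨by exact_mod_cast e4.1, by exact_mod_cast e4.2⟩

theorem finite_support_filterCoeff {φ ψ : ℝ → ℝ} (hφ : HasCompactSupport φ)
    (hψ : HasCompactSupport ψ) (j : ℕ) : (Function.support (filterCoeff φ ψ j)).Finite := by
  obtain ⟨s, hs⟩ := exists_finset_mul_eq_zero hφ hψ j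
  refine s.finite_toSet.subset fun l hl => ?_
  by_contra hls
  apply hl
  simp [filterCoeff, hs l hls]

theorem mem_filterSupport {φ ψ : ℝ → ℝ} (hφ : HasCompactSupport φ)
    (hψ : HasCompactSupport ψ) (j : ℕ) (l : ℤ) :
    l ∈ filterSupport φ ψ j ↔ filterCoeff φ ψ j l ≠ 0 := by
  rw [filterSupport, dif_pos (finite_support_filterCoeff hφ hψ j)]
  simp

theorem memLp_comp_div_sub {f : ℝ → ℝ} (hf : MemLp f 2 volume) {c : ℝ} (hc : c ≠ 0) (x : ℝ) :
    MemLp (fun t => f (t / c - x)) 2 volume := by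
  have hq : Measure.QuasiMeasurePreserving (fun t : ℝ => t / c - x) volume volume := by
    have h1 : Measure.QuasiMeasurePreserving (fun t : ℝ => t - x) volume volume :=
      (measurePreserving_sub_right volume x).quasiMeasurePreserving
    have h2 : Measure.QuasiMeasurePreserving (fun t : ℝ => t / c) volume volume := by
      refine ⟨by fun_prop, ?_⟩
      simp_rw [div_eq_mul_inv]
      rw [Real.map_volume_mul_right (inv_ne_zero hc)]
      exact Measure.smul_absolutelyContinuous
    exact h1.comp h2
  refine (memLp_two_iff_integrable_sq
    (hf.aestronglyMeasurable.comp_quasiMeasurePreserving hq)).2 ?_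
  exact (hf.integrable_sq.comp_sub_right x).comp_div hc

theorem memLp_comp_div {f : ℝ → ℝ} (hf : MemLp f 2 volume) {c : ℝ} (hc : c ≠ 0) :
    MemLp (fun t => f (t / c)) 2 volume := by
  simpa using memLp_comp_div_sub hf hc 0

theorem memLp_comp_add {f : ℝ → ℝ} (hf : MemLp f 2 volume) (x : ℝ) :
    MemLp (fun t => f (t + x)) 2 volume :=
  hf.comp_measurePreserving (measurePreserving_add_right volume x)

/-- The filter sums to zero: `∑ φ(· + ℓ)` is constant and `ψ` has integral zero. -/
theorem sum_filterCoeff_eq_zero {φ ψ : ℝ → ℝ} {N : ℕ} {α : ℝ} (h : IsWaveletSystem φ ψ N α)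
    (j : ℕ) : ∑ l ∈ filterSupport φ ψ j, filterCoeff φ ψ j l = 0 := by
  obtain ⟨s, hs⟩ := exists_finset_mul_eq_zero h.compact_scaling h.compact_wavelet j
  have h2 : ((2 : ℝ) ^ j) ≠ 0 := by positivity
  have hsub : filterSupport φ ψ j ⊆ s := fun l hl => by
    by_contra hls
    refine (mem_filterSupport h.compact_scaling h.compact_wavelet j l).1 hl ?_
    simp [filterCoeff, hs l hls]
  rw [Finset.sum_subset hsub fun l _ hl => by
    simpa using mt (mem_filterSupport h.compact_scaling h.compact_wavelet j l).2 hl]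
  simp only [filterCoeff]
  have hint : ∀ l ∈ s, Integrable fun t : ℝ => φ (t + l) * ψ (t / 2 ^ j) := fun l _ =>
    (memLp_comp_add h.memLp_scaling (l : ℝ)).integrable_mul (memLp_comp_div h.memLp_wavelet h2)
  rw [← Finset.mul_sum, ← integral_finsetSum s hint]
  obtain ⟨p, hp, hpt⟩ := h.polynomial 0 h.one_le
  rw [Polynomial.eq_C_of_degree_le_zero (p := p) (by simpa using hp.le)] at hpt
  have : ∫ t : ℝ, ∑ l ∈ s, φ (t + l) * ψ (t / 2 ^ j) = ∫ t : ℝ, p.coeff 0 * ψ (t / 2 ^ j) := by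
    refine integral_congr_ae ?_
    filter_upwards [hpt] with t ht
    by_cases hψt : ψ (t / 2 ^ j) = 0
    · simp [hψt]
    rw [← Finset.sum_mul]
    congr 1
    simp only [pow_zero, one_mul, Polynomial.eval_C] at ht
    rw [← ht, ← (Equiv.neg ℤ).tsum_eq, tsum_eq_sum (s := s)]
    · simp
    · intro l hl
      have := (mul_eq_zero.1 (hs l hl t)).resolve_right hψt
      simpa using this
  rw [this, integral_const_mul, Measure.integral_comp_div]
  have h0 := h.vanishing_moments 0 h.one_le
  simp only [pow_zero, one_mul] at h0
  simp [h0]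

theorem octaveSpace_le_orthogonal {f : ℝ → ℝ} {j : ℤ} (Ψ : Lp ℝ 2 (volume : Measure ℝ))
    (h : ∀ k : ℤ, ∫ t, atom f j k t * Ψ t = 0) :
    octaveSpace f j ≤ (Submodule.span ℝ {Ψ})ᗮ := by
  refine Submodule.topologicalClosure_minimal _ ?_ (Submodule.isClosed_orthogonal _)
  rw [Submodule.span_le]
  rintro g ⟨k, hk⟩
  rw [SetLike.mem_coe, Submodule.mem_orthogonal_singleton_iff_inner_left, L2.inner_def]
  rw [← h k]
  refine integral_congr_ae ?_
  filter_upwards [hk] with t ht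
  simp [ht, mul_comm]

theorem memLp_atom {f : ℝ → ℝ} (hf : MemLp f 2 volume) (j k : ℤ) :
    MemLp (atom f j k) 2 volume :=
  (memLp_comp_div_sub hf (zpow_ne_zero j two_ne_zero) k).const_mul _

theorem toLp_atom_mem {f : ℝ → ℝ} (hf : MemLp f 2 volume) (j k : ℤ) :
    (memLp_atom hf j k).toLp ∈ octaveSpace f j :=
  Submodule.le_topologicalClosure _ (Submodule.subset_span ⟨k, MemLp.coeFn_toLp _⟩)

/-- The filter does not vanish. If it did, the wavelet dilated to octave `j` would be orthogonal to
`V_0 ⊇ V_{j-1}`. Dilating back, `ψ` would be orthogonal to `V_{-1}`, which contains it. -/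
theorem exists_filterCoeff_ne_zero {φ ψ : ℝ → ℝ} {N : ℕ} {α : ℝ} (h : IsWaveletSystem φ ψ N α)
    {j : ℕ} (hj : 1 ≤ j) : ∃ l ∈ filterSupport φ ψ j, filterCoeff φ ψ j l ≠ 0 := by
  by_contra! hcon
  have hz : ∀ l : ℤ, ∫ t : ℝ, φ (t + l) * ψ (t / 2 ^ j) = 0 := by
    intro l
    have h0 : filterCoeff φ ψ j l = 0 := by
      by_contra hl
      exact hl (hcon l ((mem_filterSupport h.compact_scaling h.compact_wavelet j l).2 hl))
    exact (mul_eq_zero.1 h0).resolve_left (by positivity)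
  have h2 : ((2 : ℝ) ^ j) ≠ 0 := by positivity
  have hψj := memLp_comp_div h.memLp_wavelet h2
  set Ψ := hψj.toLp with hΨ
  have h0 : octaveSpace φ 0 ≤ (Submodule.span ℝ {Ψ})ᗮ := by
    refine octaveSpace_le_orthogonal Ψ fun k => ?_
    rw [← hz (-k)]
    refine integral_congr_ae ?_
    filter_upwards [hψj.coeFn_toLp] with t ht
    rw [hΨ, ht]
    simp [atom, sub_eq_add_neg]
  have hnest : ∀ i : ℕ, octaveSpace φ i ≤ octaveSpace φ 0 := by
    intro i
    induction i with
    | zero => exact le_rfl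
    | succ i ih => exact le_trans (by exact_mod_cast h.nested i) ih
  -- `V_{j-1} ⊆ V_0`, as larger octaves are coarser
  have hj1 : octaveSpace φ ((j : ℤ) - 1) ≤ (Submodule.span ℝ {Ψ})ᗮ := by
    have := (hnest (j - 1)).trans h0
    rwa [Nat.cast_sub hj, Nat.cast_one] at this
  -- dilate from octave `j - 1` down to octave `-1`
  have hort : ∀ k : ℤ, ∫ t, φ (2 * t - k) * ψ t = 0 := by
    intro k
    have e1 := hj1 (toLp_atom_mem h.memLp_scaling ((j : ℤ) - 1) k)
    rw [Submodule.mem_orthogonal_singleton_iff_inner_left, L2.inner_def] at e1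
    have e2 : ∫ t : ℝ, atom φ ((j : ℤ) - 1) k t * ψ (t / 2 ^ j) = 0 := by
      rw [← e1]
      refine integral_congr_ae ?_
      filter_upwards [hψj.coeFn_toLp, (memLp_atom h.memLp_scaling ((j : ℤ) - 1) k).coeFn_toLp]
        with t ht ht'
      rw [hΨ, ht, ht']
      simp [mul_comm]
    have e3 : ∀ t : ℝ, atom φ ((j : ℤ) - 1) k t * ψ (t / 2 ^ j) =
        (2 : ℝ) ^ (-(((j : ℤ) - 1 : ℤ) : ℝ) / 2) *
          (fun x => φ (2 * x - k) * ψ x) (t / 2 ^ j) := by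
      intro t
      have : t / (2 : ℝ) ^ ((j : ℤ) - 1) = 2 * (t / 2 ^ j) := by
        rw [zpow_sub₀ two_ne_zero]; simp; field_simp
      simp only [atom, this]
      ring
    simp_rw [e3] at e2
    rw [integral_const_mul, Measure.integral_comp_div (fun x => φ (2 * x - k) * ψ x)] at e2
    simpa [h2, Real.rpow_eq_zero_iff_of_nonneg] using e2
  set Ψ0 := h.memLp_wavelet.toLp with hΨ0
  have hperp : octaveSpace φ (-1) ≤ (Submodule.span ℝ {Ψ0})ᗮ := by
    refine octaveSpace_le_orthogonal Ψ0 fun k => ?_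
    have : ∫ t, atom φ (-1) k t * Ψ0 t =
        ∫ t, (2 : ℝ) ^ (-((-1 : ℤ) : ℝ) / 2) * (φ (2 * t - k) * ψ t) := by
      refine integral_congr_ae ?_
      filter_upwards [h.memLp_wavelet.coeFn_toLp] with t ht
      rw [hΨ0, ht]
      simp only [atom, zpow_neg_one, div_inv_eq_mul, mul_comm t]
      ring
    rw [this, integral_const_mul, hort, mul_zero]
  have hmem : Ψ0 ∈ octaveSpace φ (-1) := by
    rw [h.detail]
    refine Submodule.mem_sup_right (Submodule.le_topologicalClosure _
      (Submodule.subset_span ⟨0, ?_⟩))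
    filter_upwards [h.memLp_wavelet.coeFn_toLp] with t ht
    rw [hΨ0, ht]
    simp [atom]
  have hself := hperp hmem
  rw [Submodule.mem_orthogonal_singleton_iff_inner_left, L2.inner_def] at hself
  have hone := h.unit_norm
  rw [show ∫ t, ψ t ^ 2 = 0 by
    rw [← hself]
    refine integral_congr_ae ?_
    filter_upwards [h.memLp_wavelet.coeFn_toLp] with t ht
    rw [hΨ0, ht]
    simp [pow_two]] at hone
  exact zero_ne_one hone

/-! ### The wavelet coefficients of tfBm -/

section WaveletCoefficients

theorem waveletCoeff_eq_sum {Ω : Type*} {φ ψ : ℝ → ℝ} (hφ : HasCompactSupport φ)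
    (hψ : HasCompactSupport ψ) (B : ℝ → Ω → ℝ) (j : ℕ) (k : ℤ) :
    waveletCoeff φ ψ B j k = fun ω => ∑ m ∈ filterSupport φ ψ j,
      filterCoeff φ ψ j m * B ((2 ^ j * k - m : ℤ) : ℝ) ω := by
  ext ω
  rw [waveletCoeff, ← (Equiv.subLeft (2 ^ j * k : ℤ)).tsum_eq,
    tsum_eq_sum (s := filterSupport φ ψ j)]
  · refine Finset.sum_congr rfl fun m _ => ?_
    simp only [Equiv.subLeft_apply, sub_sub_cancel]
    rw [mul_comm]
  · intro m hm
    have : filterCoeff φ ψ j m = 0 := by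
      by_contra h
      exact hm ((mem_filterSupport hφ hψ j m).2 h)
    simp [this]

variable {Ω : Type*} [MeasurableSpace Ω]

theorem measurable_waveletCoeff {φ ψ : ℝ → ℝ} (hφ : HasCompactSupport φ)
    (hψ : HasCompactSupport ψ) {B : ℝ → Ω → ℝ} (hB : ∀ t, Measurable (B t)) (j : ℕ) (k : ℤ) :
    Measurable (waveletCoeff φ ψ B j k) := by
  rw [waveletCoeff_eq_sum hφ hψ]
  exact Finset.measurable_sum _ fun m _ => (hB _).const_mul _

/-- The covariance, for `σ² = 1`, of two wavelet coefficients at octaves `j` and `j'` whose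
positions `2^j k` and `2^j' k'` differ by `z`. -/
def lagCov (φ ψ : ℝ → ℝ) (H lam : ℝ) (j j' : ℕ) (z : ℤ) : ℝ :=
  ∑ m ∈ filterSupport φ ψ j, ∑ m' ∈ filterSupport φ ψ j',
    filterCoeff φ ψ j m * filterCoeff φ ψ j' m' * autocov H lam ((z : ℝ) - m + m')

theorem exists_abs_lagCov_le (φ ψ : ℝ → ℝ) {H lam : ℝ} (hH : 0 < H) (hl : 0 < lam) (j j' : ℕ) :
    ∃ C, 0 ≤ C ∧ ∀ z, |lagCov φ ψ H lam j j' z| ≤ C * Real.exp (-(lam / 2)) ^ z.natAbs := by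
  obtain ⟨C, hC, hd⟩ := exists_abs_autocov_le hH hl
  refine ⟨∑ m ∈ filterSupport φ ψ j, ∑ m' ∈ filterSupport φ ψ j',
    |filterCoeff φ ψ j m * filterCoeff φ ψ j' m'| *
      (C * Real.exp (lam / 2 * (|(m : ℝ)| + |(m' : ℝ)|))),
    by positivity, fun z => ?_⟩
  rw [lagCov, Finset.sum_mul]
  refine (Finset.abs_sum_le_sum_abs _ _).trans (Finset.sum_le_sum fun m _ => ?_)
  rw [Finset.sum_mul]
  refine (Finset.abs_sum_le_sum_abs _ _).trans (Finset.sum_le_sum fun m' _ => ?_)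
  rw [abs_mul, mul_assoc]
  refine mul_le_mul_of_nonneg_left ((hd _).trans ?_) (abs_nonneg _)
  rw [mul_assoc]
  refine mul_le_mul_of_nonneg_left ?_ hC
  rw [← Real.exp_nat_mul, ← Real.exp_add, Real.exp_le_exp, Nat.cast_natAbs, Int.cast_abs]
  have h : |(z : ℝ)| ≤ |(z : ℝ) - m + m'| + (|(m : ℝ)| + |(m' : ℝ)|) := by
    have e1 : (z : ℝ) = ((z : ℝ) - m + m') + (m - m') := by ring
    have e2 := abs_add_le ((z : ℝ) - m + m') (m - m')
    rw [← e1] at e2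
    linarith [abs_sub (m : ℝ) (m' : ℝ)]
  nlinarith

theorem lagCov_zero_pos {φ ψ : ℝ → ℝ} {N : ℕ} {α : ℝ} (hW : IsWaveletSystem φ ψ N α) {H lam : ℝ}
    (hH : 0 < H) (hl : 0 < lam) {j : ℕ} (hj : 1 ≤ j) : 0 < lagCov φ ψ H lam j j 0 := by
  have h := sum_autocov_pos hH hl (filterSupport φ ψ j) (filterCoeff φ ψ j)
    (exists_filterCoeff_ne_zero hW hj)
  convert h using 1
  refine Finset.sum_congr rfl fun m _ => Finset.sum_congr rfl fun m' _ => ?_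
  congr 2
  push_cast; ring

theorem integral_maKernel_mul {H lam : ℝ} (hH : 0 < H) (hl : 0 < lam) (s t : ℝ) :
    ∫ u, maKernel H lam s u * maKernel H lam t u =
      autocov H lam (s - t) - autocov H lam s - autocov H lam t + autocov H lam 0 := by
  have hi := integrable_temperedKernel_mul hH hl
  have e : ∀ u, maKernel H lam s u * maKernel H lam t u =
      temperedKernel H lam (s - u) * temperedKernel H lam (t - u) -
      temperedKernel H lam (s - u) * temperedKernel H lam (0 - u) -
      temperedKernel H lam (0 - u) * temperedKernel H lam (t - u) +
      temperedKernel H lam (0 - u) * temperedKernel H lam (0 - u) := by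
    intro u
    simp only [maKernel_eq, zero_sub]
    ring
  simp_rw [e]
  have h1 : Integrable fun u => temperedKernel H lam (s - u) * temperedKernel H lam (t - u) -
      temperedKernel H lam (s - u) * temperedKernel H lam (0 - u) := (hi s t).sub (hi s 0)
  have h2 : Integrable fun u => temperedKernel H lam (s - u) * temperedKernel H lam (t - u) -
      temperedKernel H lam (s - u) * temperedKernel H lam (0 - u) -
      temperedKernel H lam (0 - u) * temperedKernel H lam (t - u) := h1.sub (hi 0 t)
  rw [integral_add h2 (hi 0 0), integral_sub h1 (hi 0 t), integral_sub (hi s t) (hi s 0)]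
  rw [integral_temperedKernel_sub_mul, integral_temperedKernel_sub_mul,
    integral_temperedKernel_sub_mul, integral_temperedKernel_sub_mul, sub_zero, zero_sub,
    autocov_neg, sub_zero]

variable {φ ψ : ℝ → ℝ} {N : ℕ} {α : ℝ} {B : ℝ → Ω → ℝ} {μ : Measure Ω} {H lam v : ℝ}

/-- As the filters sum to zero, the terms of the tfBm covariance that depend on one time only drop
out, and the wavelet coefficients are stationary. -/
theorem cov_waveletCoeff (hW : IsWaveletSystem φ ψ N α) (hB : IsTfBm B μ H lam v)
    (hH : 0 < H) (hl : 0 < lam) (j j' : ℕ) (k k' : ℤ) :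
    cov[waveletCoeff φ ψ B j k, waveletCoeff φ ψ B j' k'; μ] =
      v * lagCov φ ψ H lam j j' (2 ^ j * k - 2 ^ j' * k') := by
  have := hB.gaussian.isProbabilityMeasure
  have hm : ∀ t, MemLp (B t) 2 μ := fun t => (hB.gaussian.hasGaussianLaw_eval t).memLp_two
  rw [waveletCoeff_eq_sum hW.compact_scaling hW.compact_wavelet,
    waveletCoeff_eq_sum hW.compact_scaling hW.compact_wavelet,
    covariance_fun_sum_fun_sum' (fun m _ => (hm _).const_mul _) (fun m _ => (hm _).const_mul _)]
  simp only [covariance_const_mul_left, covariance_const_mul_right, hB.covariance_eq,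
    integral_maKernel_mul hH hl]
  set s := filterSupport φ ψ j
  set s' := filterSupport φ ψ j'
  set h := filterCoeff φ ψ j with hh
  set h' := filterCoeff φ ψ j' with hh'
  have z : ∑ m ∈ s, h m = 0 := sum_filterCoeff_eq_zero hW j
  have z' : ∑ m ∈ s', h' m = 0 := sum_filterCoeff_eq_zero hW j'
  have k1 : ∀ f : ℤ → ℝ, ∑ m ∈ s, ∑ m' ∈ s', h m * (h' m' * f m) = 0 := by
    intro f
    refine Finset.sum_eq_zero fun m _ => ?_
    rw [← Finset.mul_sum, ← Finset.sum_mul, z']; simp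
  have k2 : ∀ f : ℤ → ℝ, ∑ m ∈ s, ∑ m' ∈ s', h m * (h' m' * f m') = 0 := by
    intro f
    simp_rw [← Finset.mul_sum]
    rw [← Finset.sum_mul, z, zero_mul]
  have e : ∀ m m' : ℤ, h' m' * (h m * (v * (
        autocov H lam (((2 ^ j * k - m : ℤ) : ℝ) - ((2 ^ j' * k' - m' : ℤ) : ℝ)) -
        autocov H lam ((2 ^ j * k - m : ℤ) : ℝ) - autocov H lam ((2 ^ j' * k' - m' : ℤ) : ℝ) +
        autocov H lam 0))) =
      v * (h m * h' m' * autocov H lam ((2 ^ j * k - 2 ^ j' * k' : ℤ) - m + m')) -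
      h m * (h' m' * (v * autocov H lam ((2 ^ j * k - m : ℤ) : ℝ) - v * autocov H lam 0)) -
      h m * (h' m' * (v * autocov H lam ((2 ^ j' * k' - m' : ℤ) : ℝ))) := by
    intro m m'
    rw [show (((2 ^ j * k - m : ℤ) : ℝ) - ((2 ^ j' * k' - m' : ℤ) : ℝ)) =
      ((2 ^ j * k - 2 ^ j' * k' : ℤ) : ℝ) - m + m' by push_cast; ring]
    ring
  simp_rw [e, Finset.sum_sub_distrib]
  rw [k1 (fun m => v * autocov H lam ((2 ^ j * k - m : ℤ) : ℝ) - v * autocov H lam 0),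
    k2 (fun m' => v * autocov H lam ((2 ^ j' * k' - m' : ℤ) : ℝ))]
  simp only [sub_zero, lagCov, Finset.mul_sum]
  rfl

theorem isGaussianProcess_waveletCoeff (hW : IsWaveletSystem φ ψ N α) (hB : IsTfBm B μ H lam v) :
    IsGaussianProcess (fun p : ℕ × ℤ => waveletCoeff φ ψ B p.1 p.2) μ := by
  classical
  refine hB.gaussian.of_isGaussianProcess fun p => ?_
  set s := filterSupport φ ψ p.1
  refine ⟨s.image fun m : ℤ => ((2 ^ p.1 * p.2 - m : ℤ) : ℝ),
    ∑ m ∈ s.attach, filterCoeff φ ψ p.1 m • ContinuousLinearMap.proj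
      (R := ℝ) (φ := fun _ => ℝ) (⟨((2 ^ p.1 * p.2 - m : ℤ) : ℝ), Finset.mem_image_of_mem _ m.2⟩ :
        (s.image fun m : ℤ => ((2 ^ p.1 * p.2 - m : ℤ) : ℝ))), fun ω => ?_⟩
  rw [waveletCoeff_eq_sum hW.compact_scaling hW.compact_wavelet]
  simp only [sum_apply, smul_apply,
    ContinuousLinearMap.proj_apply, Finset.restrict, smul_eq_mul]
  rw [Finset.sum_attach s (fun m => filterCoeff φ ψ p.1 m * B ((2 ^ p.1 * p.2 - m : ℤ) : ℝ) ω)]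

theorem hasGaussianLaw_waveletCoeff (hW : IsWaveletSystem φ ψ N α) (hB : IsTfBm B μ H lam v)
    {ι : Type*} [Fintype ι] (f : ι → ℕ × ℤ) :
    HasGaussianLaw (fun ω i => waveletCoeff φ ψ B (f i).1 (f i).2 ω) μ := by
  have h := ((isGaussianProcess_waveletCoeff hW hB).comp_right f).hasGaussianLaw Finset.univ
  exact h.map_fun (ContinuousLinearMap.pi fun i => ContinuousLinearMap.proj
    (R := ℝ) (φ := fun _ => ℝ) (⟨i, Finset.mem_univ i⟩ : (Finset.univ : Finset ι)))

theorem memLp_waveletCoeff (hW : IsWaveletSystem φ ψ N α) (hB : IsTfBm B μ H lam v)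
    (j : ℕ) (k : ℤ) : MemLp (waveletCoeff φ ψ B j k) 2 μ :=
  ((isGaussianProcess_waveletCoeff hW hB).hasGaussianLaw_eval (j, k)).memLp_two

theorem integral_waveletCoeff (hW : IsWaveletSystem φ ψ N α) (hB : IsTfBm B μ H lam v)
    (j : ℕ) (k : ℤ) : ∫ ω, waveletCoeff φ ψ B j k ω ∂μ = 0 := by
  have hi : ∀ t, Integrable (B t) μ := fun t => (hB.gaussian.hasGaussianLaw_eval t).integrable
  rw [waveletCoeff_eq_sum hW.compact_scaling hW.compact_wavelet,
    integral_finsetSum _ fun m _ => (hi _).const_mul _]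
  exact Finset.sum_eq_zero fun m _ => by rw [integral_const_mul, hB.centered, mul_zero]

theorem integral_waveletCoeff_sq (hW : IsWaveletSystem φ ψ N α) (hB : IsTfBm B μ H lam v)
    (hH : 0 < H) (hl : 0 < lam) (j : ℕ) (k : ℤ) :
    ∫ ω, waveletCoeff φ ψ B j k ω ^ 2 ∂μ = v * lagCov φ ψ H lam j j 0 := by
  have := hB.gaussian.isProbabilityMeasure
  have h := cov_waveletCoeff hW hB hH hl j j k k
  have hm := memLp_waveletCoeff hW hB j k
  rw [covariance_self hm.aemeasurable, variance_of_integral_eq_zero hm.aemeasurable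
    (integral_waveletCoeff hW hB j k), sub_self] at h
  exact h

end WaveletCoefficients

/-! ### The wavelet spectrum -/

section Spectrum

variable {Ω : Type*} [MeasurableSpace Ω] {φ ψ : ℝ → ℝ} {N : ℕ} {α : ℝ} {B : ℝ → Ω → ℝ}
  {P : Param → Measure Ω}

theorem isOpen_paramSpace : IsOpen paramSpace := by
  have h : ∀ i : Fin 3, IsOpen {θ : Param | 0 < θ i} := fun i =>
    isOpen_lt continuous_const (EuclideanSpace.proj (𝕜 := ℝ) i).continuous
  exact (h 0).inter ((h 1).inter (h 2))

theorem spectrum_eq (hW : IsWaveletSystem φ ψ N α) (hB : IsTfBmModel B P) {θ : Param}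
    (hθ : θ ∈ paramSpace) (j : ℕ) :
    spectrum φ ψ B P j θ = θ 2 * lagCov φ ψ (θ 0) (θ 1) j j 0 :=
  integral_waveletCoeff_sq hW (hB.isTfBm θ hθ) hθ.1 hθ.2.1 j 0

theorem spectrum_pos (hW : IsWaveletSystem φ ψ N α) (hB : IsTfBmModel B P) {θ : Param}
    (hθ : θ ∈ paramSpace) {j : ℕ} (hj : 1 ≤ j) : 0 < spectrum φ ψ B P j θ := by
  rw [spectrum_eq hW hB hθ]
  exact mul_pos hθ.2.2 (lagCov_zero_pos hW hθ.1 hθ.2.1 hj)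

theorem differentiableAt_spectrum (hW : IsWaveletSystem φ ψ N α) (hB : IsTfBmModel B P)
    {θ : Param} (hθ : θ ∈ paramSpace) (j : ℕ) :
    DifferentiableAt ℝ (spectrum φ ψ B P j) θ := by
  have hev : spectrum φ ψ B P j =ᶠ[𝓝 θ] fun θ => θ 2 * lagCov φ ψ (θ 0) (θ 1) j j 0 := by
    filter_upwards [isOpen_paramSpace.mem_nhds hθ] with θ' hθ'
    exact spectrum_eq hW hB hθ' j
  refine DifferentiableAt.congr_of_eventuallyEq ?_ hev
  have hp : ∀ i : Fin 3, DifferentiableAt ℝ (fun θ : Param => θ i) θ := fun i =>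
    (EuclideanSpace.proj (𝕜 := ℝ) i).differentiableAt
  refine (hp 2).mul ?_
  unfold lagCov
  refine DifferentiableAt.fun_sum fun m _ => DifferentiableAt.fun_sum fun m' _ => ?_
  refine DifferentiableAt.const_mul ?_ _
  exact (differentiableAt_autocov _ (p := (θ 0, θ 1)) hθ.1 hθ.2.1).comp θ
    (f := fun θ : Param => (θ 0, θ 1)) ((hp 0).prodMk (hp 1))

theorem integral_waveletVar (hW : IsWaveletSystem φ ψ N α) (hB : IsTfBmModel B P) {θ : Param}
    (hθ : θ ∈ paramSpace) {n j : ℕ} (hn : 1 ≤ numCoeff n j) :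
    ∫ ω, waveletVar φ ψ B n j ω ∂(P θ) = spectrum φ ψ B P j θ := by
  have hT := hB.isTfBm θ hθ
  have hn' : (numCoeff n j : ℝ) ≠ 0 := by positivity
  unfold waveletVar
  rw [integral_const_mul, integral_finsetSum (Finset.Icc 1 (numCoeff n j))
    (f := fun (k : ℕ) ω => waveletCoeff φ ψ B j k ω ^ 2)
    fun k _ => (memLp_waveletCoeff hW hT j k).integrable_sq, spectrum_eq hW hB hθ]
  simp_rw [integral_waveletCoeff_sq hW hT hθ.1 hθ.2.1]
  simp only [Finset.sum_const, Nat.card_Icc, add_tsub_cancel_right, nsmul_eq_mul]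
  field_simp

end Spectrum

/-! ### Least squares on a compact set -/

section LeastSquares

open scoped RealInnerProductSpace

variable {E F : Type*} [NormedAddCommGroup E] [InnerProductSpace ℝ E]
  [NormedAddCommGroup F] [InnerProductSpace ℝ F] [FiniteDimensional ℝ F]

/-- The least squares inverse `L` of an injective linear map `A`: the vector `A (L x)` is the
orthogonal projection of `x` to the range of `A`. -/
theorem exists_normal_equations (A : F →L[ℝ] E) (hA : Function.Injective A) :
    ∃ L : E →L[ℝ] F, ∀ x v, ⟪x - A (L x), A v⟫ = 0 := by
  obtain ⟨g, hg⟩ := (A : F →ₗ[ℝ] E).exists_leftInverse_of_injective (LinearMap.ker_eq_bot.2 hA)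
  set R : Submodule ℝ E := LinearMap.range (A : F →ₗ[ℝ] E) with hR
  have hfin : FiniteDimensional ℝ R := inferInstance
  let g' : R →L[ℝ] F := LinearMap.toContinuousLinearMap (g ∘ₗ R.subtype)
  refine ⟨g' ∘L R.orthogonalProjectionOnto, fun x v => ?_⟩
  have h1 : A ((g' ∘L R.orthogonalProjectionOnto) x) = R.orthogonalProjectionOnto x := by
    obtain ⟨w, hw⟩ := (R.orthogonalProjectionOnto x).2
    have : g ((R.orthogonalProjectionOnto x : R) : E) = w := by
      rw [← hw]
      exact LinearMap.congr_fun hg w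
    change A (g ((R.orthogonalProjectionOnto x : R) : E)) = _
    rw [this]
    exact hw
  rw [h1, real_inner_comm]
  exact R.sub_starProjection_mem_orthogonal x (A v) ⟨v, rfl⟩

variable {G : F → E} {K : Set F} {θ₀ : F}

omit [InnerProductSpace ℝ E] [InnerProductSpace ℝ F] [FiniteDimensional ℝ F] in
/-- Least squares fits depend continuously on the data at exact data: data near `G θ₀` are fitted by
parameters near `θ₀`. -/
theorem exists_norm_sub_lt_of_isMinOn (hK : IsCompact K) (hG : ContinuousOn G K)
    (hinj : Set.InjOn G K) (hθ₀ : θ₀ ∈ K) {ε : ℝ} (hε : 0 < ε) :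
    ∃ r > 0, ∀ Y, ‖Y - G θ₀‖ < r → ∀ θ ∈ K, IsMinOn (fun θ => ‖Y - G θ‖ ^ 2) K θ →
      ‖θ - θ₀‖ < ε := by
  have hK' : IsCompact (K \ Metric.ball θ₀ ε) := hK.diff Metric.isOpen_ball
  rcases (K \ Metric.ball θ₀ ε).eq_empty_or_nonempty with hemp | hne
  · refine ⟨1, one_pos, fun Y _ θ hθ _ => ?_⟩
    by_contra hcon
    have : θ ∈ K \ Metric.ball θ₀ ε := ⟨hθ, by rwa [Metric.mem_ball, dist_eq_norm]⟩
    rw [hemp] at this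
    exact this
  have hcont : ContinuousOn (fun θ => ‖G θ - G θ₀‖) (K \ Metric.ball θ₀ ε) :=
    ((hG.mono Set.sdiff_subset).sub continuousOn_const).norm
  obtain ⟨θ₁, hθ₁, hmin⟩ := hK'.exists_isMinOn hne hcont
  have hpos : 0 < ‖G θ₁ - G θ₀‖ := by
    rw [norm_pos_iff, sub_ne_zero]
    intro h
    have := hinj hθ₁.1 hθ₀ h
    exact hθ₁.2 (this ▸ Metric.mem_ball_self hε)
  refine ⟨‖G θ₁ - G θ₀‖ / 2, by positivity, fun Y hY θ hθ hθmin => ?_⟩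
  by_contra hcon
  have h1 : ‖G θ₁ - G θ₀‖ ≤ ‖G θ - G θ₀‖ :=
    hmin (show θ ∈ K \ Metric.ball θ₀ ε from ⟨hθ, by rwa [Metric.mem_ball, dist_eq_norm]⟩)
  have h2 : ‖Y - G θ‖ ≤ ‖Y - G θ₀‖ :=
    (pow_le_pow_iff_left₀ (norm_nonneg _) (norm_nonneg _) two_ne_zero).1 (hθmin hθ₀)
  have h3 : ‖G θ - G θ₀‖ ≤ ‖Y - G θ₀‖ + ‖Y - G θ‖ := by
    have : G θ - G θ₀ = (Y - G θ₀) - (Y - G θ) := by abel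
    rw [this]; exact norm_sub_le _ _
  linarith

/-- Linearization of the least squares fit. Comparing the minimiser `θ` with `θ₀` shows
`‖θ - θ₀‖ = O(‖Y - G θ₀‖)`. Comparing it with the linear fit `θ₀ + L (Y - G θ₀)` shows that `θ - θ₀`
almost minimises `‖Y - G θ₀ - A v‖` over `v`, and by Pythagoras it is then close to the exact
minimiser `L (Y - G θ₀)`. Differentiability of `G` at the single point `θ₀` is enough. -/
theorem exists_norm_sub_linear_le_of_isMinOn (hK : IsCompact K) (hG : ContinuousOn G K)
    (hinj : Set.InjOn G K) (hθ₀ : K ∈ 𝓝 θ₀) {A : F →L[ℝ] E} (hA : HasFDerivAt G A θ₀)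
    (hAinj : Function.Injective A) {L : E →L[ℝ] F} (hL : ∀ x v, ⟪x - A (L x), A v⟫ = 0)
    {η : ℝ} (hη : 0 < η) :
    ∃ r > 0, ∀ Y, ‖Y - G θ₀‖ < r → ∀ θ ∈ K, IsMinOn (fun θ => ‖Y - G θ‖ ^ 2) K θ →
      ‖θ - θ₀ - L (Y - G θ₀)‖ ≤ η * ‖Y - G θ₀‖ := by
  have hθK : θ₀ ∈ K := mem_of_mem_nhds hθ₀
  -- an injective linear map on a finite-dimensional space is bounded below
  obtain ⟨c, hc, hAc⟩ : ∃ c > 0, ∀ v, c * ‖v‖ ≤ ‖A v‖ := by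
    obtain ⟨C, hC, hanti⟩ := (A : F →ₗ[ℝ] E).exists_antilipschitzWith
      (LinearMap.ker_eq_bot.2 hAinj)
    refine ⟨(C : ℝ)⁻¹, by positivity, fun v => ?_⟩
    have := hanti.le_mul_dist v 0
    simp only [dist_zero_right, map_zero] at this
    rw [inv_mul_le_iff₀ (by positivity)]
    exact this
  set M := ‖L‖
  set D := 4 / c + M with hD
  have hD0 : 0 < D := by positivity
  -- `κ` is the linearization error allowed: `c / 2` gives the bound `4 / c` on `‖δ‖ / ‖e‖`,
  -- and the other terms turn the final error `3 κ D ‖e‖²` into `(c η ‖e‖)²`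
  set κ := min (c / 2) (min (1 / D) (c ^ 2 * η ^ 2 / (3 * D))) with hκ
  have hκ0 : 0 < κ := by positivity
  have hκ1 : κ ≤ c / 2 := min_le_left _ _
  have hκ2 : κ * D ≤ 1 := by
    rw [← le_div_iff₀ hD0]; exact (min_le_right _ _).trans (min_le_left _ _)
  have hκ3 : 3 * (κ * D) ≤ c ^ 2 * η ^ 2 := by
    have : κ ≤ c ^ 2 * η ^ 2 / (3 * D) := (min_le_right _ _).trans (min_le_right _ _)
    rw [le_div_iff₀ (by positivity)] at this
    linarith
  have hnear : ∀ᶠ θ in 𝓝 θ₀, ‖G θ - G θ₀ - A (θ - θ₀)‖ ≤ κ * ‖θ - θ₀‖ ∧ θ ∈ K :=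
    ((hasFDerivAt_iff_isLittleO.1 hA).bound hκ0).and hθ₀
  obtain ⟨ρ, hρ, hball⟩ := Metric.eventually_nhds_iff.1 hnear
  obtain ⟨r₁, hr₁, hcons⟩ := exists_norm_sub_lt_of_isMinOn hK hG hinj hθK hρ
  refine ⟨min r₁ (ρ / (M + 1)), by positivity, fun Y hY θ hθ hmin => ?_⟩
  have hY1 : ‖Y - G θ₀‖ < r₁ := hY.trans_le (min_le_left _ _)
  have hY2 : ‖Y - G θ₀‖ * (M + 1) < ρ := by
    rw [← lt_div_iff₀ (by positivity)]; exact hY.trans_le (min_le_right _ _)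
  set e := Y - G θ₀ with he
  set δ := θ - θ₀ with hδ
  have hδρ : ‖δ‖ < ρ := hcons Y hY1 θ hθ hmin
  have hLe : ‖L e‖ ≤ M * ‖e‖ := L.le_opNorm e
  have hLρ : ‖L e‖ < ρ := by nlinarith [norm_nonneg e]
  obtain ⟨hlin1, -⟩ := hball (y := θ) (by rwa [dist_eq_norm])
  obtain ⟨hlin2, hmemK⟩ := hball (y := θ₀ + L e) (by rwa [dist_eq_norm, add_sub_cancel_left])
  rw [add_sub_cancel_left] at hlin2
  rw [← hδ] at hlin1
  have hle : ∀ θ' ∈ K, ‖Y - G θ‖ ≤ ‖Y - G θ'‖ := fun θ' hθ' =>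
    (pow_le_pow_iff_left₀ (norm_nonneg _) (norm_nonneg _) two_ne_zero).1 (hmin hθ')
  have hδe : ‖δ‖ ≤ 4 / c * ‖e‖ := by
    have h1 : ‖A δ‖ ≤ 2 * ‖e‖ + κ * ‖δ‖ := by
      have : A δ = e - (Y - G θ) - (G θ - G θ₀ - A δ) := by rw [he]; abel
      rw [this]
      have h2 := norm_sub_le (e - (Y - G θ)) (G θ - G θ₀ - A δ)
      have h3 := norm_sub_le e (Y - G θ)
      have h4 := hle θ₀ hθK
      rw [← he] at h4
      linarith
    have h2 := hAc δ
    have h3 : κ * ‖δ‖ ≤ c / 2 * ‖δ‖ := by gcongr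
    rw [div_mul_eq_mul_div, le_div_iff₀ hc]
    linarith
  have hcomp : ‖e - A δ‖ ≤ ‖e - A (L e)‖ + κ * D * ‖e‖ := by
    have e1 : e - A δ = (Y - G θ) + (G θ - G θ₀ - A δ) := by rw [he]; abel
    have e2 : Y - G (θ₀ + L e) = (e - A (L e)) - (G (θ₀ + L e) - G θ₀ - A (L e)) := by
      rw [he]; abel
    have h1 := norm_add_le (Y - G θ) (G θ - G θ₀ - A δ)
    have h2 := norm_sub_le (e - A (L e)) (G (θ₀ + L e) - G θ₀ - A (L e))
    rw [← e1] at h1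
    rw [← e2] at h2
    have h3 := hle _ hmemK
    have h4 : κ * ‖δ‖ + κ * ‖L e‖ ≤ κ * D * ‖e‖ := by
      rw [← mul_add, mul_assoc]
      gcongr
      rw [hD, add_mul]
      linarith
    linarith
  -- Pythagoras, by the normal equations
  have hpyth : ∀ w, ‖e - A w‖ ^ 2 = ‖e - A (L e)‖ ^ 2 + ‖A (w - L e)‖ ^ 2 := by
    intro w
    have : e - A w = (e - A (L e)) - A (w - L e) := by
      rw [A.map_sub w (L e)]; abel
    rw [this, norm_sub_sq_real, hL]
    ring
  have hres : ‖e - A (L e)‖ ≤ ‖e‖ := by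
    have := hpyth 0
    rw [map_zero, sub_zero] at this
    refine (pow_le_pow_iff_left₀ (norm_nonneg _) (norm_nonneg _) two_ne_zero).1 ?_
    nlinarith [sq_nonneg ‖A (0 - L e)‖]
  have hA2 : ‖A (δ - L e)‖ ^ 2 ≤ c ^ 2 * η ^ 2 * ‖e‖ ^ 2 := by
    have h1 := hpyth δ
    have h2 : ‖e - A δ‖ ^ 2 ≤ (‖e - A (L e)‖ + κ * D * ‖e‖) ^ 2 := by gcongr
    have hx : 0 ≤ κ * D := by positivity
    have h3 : ‖e - A (L e)‖ * (κ * D * ‖e‖) ≤ ‖e‖ * (κ * D * ‖e‖) := by gcongr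
    have h4 : (κ * D) * (κ * D) ≤ κ * D * 1 := by gcongr
    have h5 : (κ * D) * (κ * D) * ‖e‖ ^ 2 ≤ κ * D * 1 * ‖e‖ ^ 2 := by gcongr
    have h6 : 3 * (κ * D) * ‖e‖ ^ 2 ≤ c ^ 2 * η ^ 2 * ‖e‖ ^ 2 := by gcongr
    nlinarith
  have hfin : c * ‖δ - L e‖ ≤ c * (η * ‖e‖) := by
    refine (hAc _).trans ?_
    refine (pow_le_pow_iff_left₀ (norm_nonneg _) (by positivity) two_ne_zero).1 ?_
    refine hA2.trans (le_of_eq (by ring))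
  exact le_of_mul_le_mul_left hfin hc

omit [InnerProductSpace ℝ F] [FiniteDimensional ℝ F] [InnerProductSpace ℝ E] in
/-- Measurable selection of a minimiser. Parametrize `K` by the Cantor set and take the least point
of the Cantor set whose image is a minimiser: its sublevel sets are projections of closed sets along
a compact factor. -/
theorem exists_measurable_isMinOn [MeasurableSpace E] [BorelSpace E] [MeasurableSpace F]
    [BorelSpace F] (hK : IsCompact K) (hne : K.Nonempty) (hG : ContinuousOn G K) :
    ∃ sel : E → F, Measurable sel ∧
      ∀ Y, sel Y ∈ K ∧ IsMinOn (fun θ => ‖Y - G θ‖ ^ 2) K (sel Y) := by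
  have : CompactSpace K := isCompact_iff_compactSpace.1 hK
  have : Nonempty K := hne.to_subtype
  obtain ⟨γ₀, hγ₀c, hγ₀s⟩ := exists_nat_bool_continuous_surjective_of_compact K
  set γ : cantorSet → K := γ₀ ∘ cantorSetHomeomorphNatToBool with hγ
  have hγc : Continuous γ := hγ₀c.comp cantorSetHomeomorphNatToBool.continuous
  have hγs : Function.Surjective γ := hγ₀s.comp cantorSetHomeomorphNatToBool.surjective
  have hcomp : CompactSpace cantorSet := cantorSetHomeomorphNatToBool.symm.compactSpace
  have hGγ : Continuous fun c => G (γ c) := by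
    have := continuousOn_iff_continuous_domRestrict.1 hG
    exact this.comp hγc
  set f : E → cantorSet → ℝ := fun Y c => ‖Y - G (γ c)‖ ^ 2 with hf
  have hfc : Continuous fun p : E × cantorSet => f p.1 p.2 := by
    have h2 : Continuous fun p : E × cantorSet => G (γ p.2) := hGγ.comp continuous_snd
    exact ((continuous_fst.sub h2).norm).pow 2
  -- the pairs of data and parameter at which the minimum is attained
  set Gr : Set (E × cantorSet) := {p | ∀ c', f p.1 p.2 ≤ f p.1 c'} with hGr
  have hGrc : IsClosed Gr := by
    rw [hGr, Set.ofPred_forall]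
    refine isClosed_iInter fun c' => isClosed_le hfc ?_
    exact hfc.comp (continuous_fst.prodMk continuous_const)
  -- projections along the compact Cantor set are closed maps
  have hproj : ∀ a : ℝ, IsClosed {Y : E | ∃ c : cantorSet, (Y, c) ∈ Gr ∧ (c : ℝ) ≤ a} := by
    intro a
    have h1 : IsClosed (Gr ∩ {p | (p.2 : ℝ) ≤ a}) :=
      hGrc.inter (isClosed_le (continuous_subtype_val.comp continuous_snd) continuous_const)
    have h2 := isClosedMap_fst_of_compactSpace _ h1
    convert h2 using 1
    ext Y
    simp
  have hleast : ∀ Y, ∃ c : cantorSet, (Y, c) ∈ Gr ∧ ∀ c', (Y, c') ∈ Gr → (c : ℝ) ≤ c' := by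
    intro Y
    have hc1 : IsClosed {c : cantorSet | (Y, c) ∈ Gr} :=
      hGrc.preimage (continuous_const.prodMk continuous_id)
    have hn : {c : cantorSet | (Y, c) ∈ Gr}.Nonempty := by
      have : Nonempty cantorSet := ⟨cantorSetHomeomorphNatToBool.symm fun _ => true⟩
      have hfY : Continuous (f Y) := hfc.comp (continuous_const.prodMk continuous_id)
      obtain ⟨c, -, hc⟩ := isCompact_univ.exists_isMinOn Set.univ_nonempty hfY.continuousOn
      exact ⟨c, fun c' => hc (Set.mem_univ c')⟩
    obtain ⟨c, hc, hmin⟩ := hc1.isCompact.exists_isMinOn hn continuous_subtype_val.continuousOn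
    exact ⟨c, hc, fun c' hc' => hmin hc'⟩
  choose c hcG hcmin using hleast
  have hcmeas : Measurable c := by
    refine Measurable.subtype_mk (f := fun Y => (c Y : ℝ)) (measurable_of_Iic fun a => ?_)
    have : (fun Y => (c Y : ℝ)) ⁻¹' Set.Iic a =
        {Y : E | ∃ c : cantorSet, (Y, c) ∈ Gr ∧ (c : ℝ) ≤ a} := by
      ext Y
      constructor
      · intro h; exact ⟨c Y, hcG Y, h⟩
      · rintro ⟨c', hc', hle⟩; exact (hcmin Y c' hc').trans hle
    rw [this]
    exact (hproj a).measurableSet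
  refine ⟨fun Y => (γ (c Y) : F), ?_, fun Y => ⟨(γ (c Y)).2, fun θ hθ => ?_⟩⟩
  · exact (continuous_subtype_val.comp hγc).measurable.comp hcmeas
  · obtain ⟨c', hc'⟩ := hγs ⟨θ, hθ⟩
    have := hcG Y c'
    simp only [hf, hc'] at this
    exact this

end LeastSquares

/-! ### The bias correction -/

section Digamma

/-- By convexity of `log Γ`, its derivative at `x` lies between the increments of `log Γ` over
`[x - 1, x]` and `[x, x + 1]`. -/
theorem logDeriv_Gamma_bounds {x : ℝ} (hx : 1 < x) :
    Real.log (x - 1) ≤ logDeriv Real.Gamma x ∧ logDeriv Real.Gamma x ≤ Real.log x := by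
  have hx0 : 0 < x := by linarith
  have hconv := Real.convexOn_log_Gamma
  have hd : HasDerivAt (Real.log ∘ Real.Gamma) (logDeriv Real.Gamma x) x := by
    have h1 := (Real.differentiableAt_Gamma (s := x) fun m h => by
      have : (0 : ℝ) ≤ m := Nat.cast_nonneg m
      linarith).hasDerivAt
    exact h1.log (Real.Gamma_pos_of_pos hx0).ne'
  have hstep : ∀ y : ℝ, 0 < y →
      Real.log (Real.Gamma (y + 1)) - Real.log (Real.Gamma y) = Real.log y := by
    intro y hy
    rw [Real.Gamma_add_one hy.ne', Real.log_mul hy.ne' (Real.Gamma_pos_of_pos hy).ne']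
    ring
  constructor
  · have h := hconv.slope_le_of_hasDerivAt (x := x - 1) (y := x) (by simpa using hx)
      (by simpa using hx0) (by linarith) hd
    rw [slope_def_field] at h
    have h2 := hstep (x - 1) (by linarith)
    simp only [sub_add_cancel] at h2
    simpa [h2] using h
  · have h := hconv.le_slope_of_hasDerivAt (x := x) (y := x + 1) (by simpa using hx0)
      (by simp; linarith) (by linarith) hd
    rw [slope_def_field] at h
    simpa [hstep x hx0] using h

theorem abs_biasCorrection_le {n j : ℕ} (h : 2 < numCoeff n j) :
    |biasCorrection n j| ≤ 2 / (Real.log 2 * (numCoeff n j - 2)) := by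
  have h' : (2 : ℝ) < numCoeff n j := by exact_mod_cast h
  have hl : 0 < Real.log 2 := Real.log_pos one_lt_two
  set y : ℝ := (numCoeff n j : ℝ) / 2 with hy
  have hy1 : 1 < y := by rw [hy]; linarith
  obtain ⟨h1, h2⟩ := logDeriv_Gamma_bounds hy1
  have h3 : Real.log y - Real.log (y - 1) ≤ 1 / (y - 1) := by
    rw [← Real.log_div (by linarith) (by linarith)]
    refine (Real.log_le_sub_one_of_pos (div_pos (by linarith) (by linarith))).trans (le_of_eq ?_)
    have : y - 1 ≠ 0 := by linarith
    field_simp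
    ring
  have e : biasCorrection n j = (logDeriv Real.Gamma y - Real.log y) / Real.log 2 := by
    rw [biasCorrection, Real.logb, sub_div]
  have e2 : 2 / (Real.log 2 * (numCoeff n j - 2)) = 1 / (y - 1) / Real.log 2 := by
    have e3 : y - 1 = (numCoeff n j - 2) / 2 := by rw [hy]; ring
    have : (numCoeff n j : ℝ) - 2 ≠ 0 := by linarith
    rw [e3]
    field_simp
  rw [e, e2, abs_div, abs_of_pos hl]
  gcongr
  rw [abs_le]
  constructor <;> linarith

theorem tendsto_numCoeff (j : ℕ) : Tendsto (fun n => (numCoeff n j : ℝ)) atTop atTop :=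
  tendsto_natCast_atTop_atTop.comp (Nat.tendsto_div_const_atTop (by positivity))

theorem tendsto_div_numCoeff (j : ℕ) :
    Tendsto (fun n : ℕ => (n : ℝ) / numCoeff n j) atTop (𝓝 (2 ^ j)) := by
  simpa [numCoeff] using tendsto_div_natDiv (a := 2 ^ j) (by positivity)

theorem tendsto_sqrt_mul_biasCorrection (j : ℕ) :
    Tendsto (fun n : ℕ => Real.sqrt n * biasCorrection n j) atTop (𝓝 0) := by
  have hl : 0 < Real.log 2 := Real.log_pos one_lt_two
  have hN := tendsto_numCoeff j
  have h1 : Tendsto (fun n : ℕ => (1 : ℝ) / Real.sqrt n) atTop (𝓝 0) :=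
    tendsto_const_nhds.div_atTop (Real.tendsto_sqrt_atTop.comp tendsto_natCast_atTop_atTop)
  have h2 := ((tendsto_div_numCoeff j).mul h1).const_mul (4 / Real.log 2)
  rw [mul_zero, mul_zero] at h2
  refine squeeze_zero_norm' ?_ h2
  filter_upwards [hN.eventually_ge_atTop 4, eventually_ge_atTop 1] with n hn hn1
  have hn' : 2 < numCoeff n j := by
    have : (2 : ℝ) < numCoeff n j := by linarith
    exact_mod_cast this
  have hs : 0 < Real.sqrt n := Real.sqrt_pos.2 (by exact_mod_cast hn1)
  have hss : (n : ℝ) = Real.sqrt n * Real.sqrt n := (Real.mul_self_sqrt (Nat.cast_nonneg n)).symm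
  rw [norm_mul, Real.norm_eq_abs, Real.norm_eq_abs, abs_of_pos hs]
  have h3 : 2 / (Real.log 2 * (numCoeff n j - 2)) ≤ 4 / Real.log 2 * (1 / numCoeff n j) := by
    have : (2 : ℝ) / (Real.log 2 * (numCoeff n j - 2)) ≤
        2 / (Real.log 2 * ((numCoeff n j : ℝ) / 2)) := by
      gcongr
      linarith
    refine this.trans (le_of_eq ?_)
    field_simp
    ring
  calc Real.sqrt n * |biasCorrection n j|
      ≤ Real.sqrt n * (4 / Real.log 2 * (1 / numCoeff n j)) := by
        gcongr
        exact (abs_biasCorrection_le hn').trans h3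
    _ = _ := by
      rw [div_eq_mul_one_div (n : ℝ) (numCoeff n j : ℝ)]
      nth_rewrite 2 [hss]
      field_simp

end Digamma

/-! ### Central limit theorem for the sample wavelet variances -/

section CentralLimit

variable {Ω : Type*} {φ ψ : ℝ → ℝ} {N : ℕ} {α : ℝ} {B : ℝ → Ω → ℝ} {H lam v : ℝ}

theorem waveletVar_sub_eq {n j : ℕ} (hn : 1 ≤ numCoeff n j) (s : ℝ) (ω : Ω) :
    waveletVar φ ψ B n j ω - s =
      (1 / (numCoeff n j : ℝ)) * ∑ k ∈ Finset.Icc 1 (numCoeff n j),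
        (waveletCoeff φ ψ B j (k : ℤ) ω ^ 2 - s) := by
  have hn' : (numCoeff n j : ℝ) ≠ 0 := by positivity
  rw [waveletVar, Finset.sum_sub_distrib]
  simp only [Finset.sum_const, Nat.card_Icc, add_tsub_cancel_right, nsmul_eq_mul]
  field_simp

theorem tendsto_sqrt_div_numCoeff (j : ℕ) :
    Tendsto (fun n : ℕ => Real.sqrt n / numCoeff n j) atTop (𝓝 0) := by
  have h1 : Tendsto (fun n : ℕ => (1 : ℝ) / Real.sqrt n) atTop (𝓝 0) :=
    tendsto_const_nhds.div_atTop (Real.tendsto_sqrt_atTop.comp tendsto_natCast_atTop_atTop)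
  have h2 := (tendsto_div_numCoeff j).mul h1
  rw [mul_zero] at h2
  refine h2.congr' ?_
  filter_upwards [eventually_ge_atTop 1] with n hn
  have hs : 0 < Real.sqrt n := Real.sqrt_pos.2 (by exact_mod_cast hn)
  have hss : (n : ℝ) = Real.sqrt n * Real.sqrt n := (Real.mul_self_sqrt (Nat.cast_nonneg n)).symm
  nth_rewrite 1 [hss]
  field_simp

variable [MeasurableSpace Ω] {μ : Measure Ω}

/-- Second moments and characteristic functions of linear combinations of the normalized errors
`√n (W(2^j) - σ² lagCov j j 0)` converge to those of a centred normal law. -/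
theorem exists_tendsto_waveletVar (hW : IsWaveletSystem φ ψ N α) (hB : IsTfBm B μ H lam v)
    (hH : 0 < H) (hl : 0 < lam) (J : Finset ℕ) :
    ∃ Γ : J → J → ℝ, (∀ j j', Γ j j' = Γ j' j) ∧ ∀ c : J → ℝ,
      (∀ᶠ n : ℕ in atTop, MemLp (fun ω => ∑ j : J, c j * (Real.sqrt n *
        (waveletVar φ ψ B n j ω - v * lagCov φ ψ H lam j j 0))) 2 μ) ∧
      Tendsto (fun n : ℕ => ∫ ω, (∑ j : J, c j * (Real.sqrt n *
        (waveletVar φ ψ B n j ω - v * lagCov φ ψ H lam j j 0))) ^ 2 ∂μ) atTop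
        (𝓝 (chiVar * ∑ j, ∑ j', c j * c j' * Γ j j')) ∧
      Tendsto (fun n : ℕ => ∫ ω, Complex.exp (((∑ j : J, c j * (Real.sqrt n *
        (waveletVar φ ψ B n j ω - v * lagCov φ ψ H lam j j 0)) : ℝ) : ℂ) * Complex.I) ∂μ) atTop
        (𝓝 (Complex.exp (-(chiVar * ((∑ j, ∑ j', c j * c j' * Γ j j' : ℝ) : ℂ) / 2)))) := by
  have hμ := hB.gaussian.isProbabilityMeasure
  set q := Real.exp (-(lam / 2)) with hq
  have hq0 : 0 ≤ q := (Real.exp_pos _).le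
  have hq1 : q < 1 := by rw [hq, Real.exp_lt_one_iff]; linarith
  choose C hC0 hC using fun j j' => exists_abs_lagCov_le φ ψ hH hl j j'
  have hcov := cov_waveletCoeff hW hB hH hl
  -- the limits of the averaged squared covariances
  have hlim : ∀ j j' : J, ∃ L, Tendsto (fun n : ℕ =>
      (n : ℝ) / ((numCoeff n j : ℝ) * numCoeff n j') *
      ∑ k ∈ Finset.Icc 1 (numCoeff n j), ∑ k' ∈ Finset.Icc 1 (numCoeff n j'),
        cov[waveletCoeff φ ψ B j k, waveletCoeff φ ψ B j' k'; μ] ^ 2) atTop (𝓝 L) := by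
    intro j j'
    have hb : ∀ z, |(v * lagCov φ ψ H lam j j' z) ^ 2| ≤
        v ^ 2 * C j j' ^ 2 * (q ^ 2) ^ z.natAbs := by
      intro z
      have hz := pow_le_pow_left₀ (abs_nonneg _) (hC j j' z) 2
      calc |(v * lagCov φ ψ H lam j j' z) ^ 2| = v ^ 2 * |lagCov φ ψ H lam j j' z| ^ 2 := by
            rw [abs_pow, abs_mul, mul_pow, sq_abs]
        _ ≤ v ^ 2 * (C j j' * q ^ z.natAbs) ^ 2 := mul_le_mul_of_nonneg_left hz (sq_nonneg v)
        _ = v ^ 2 * C j j' ^ 2 * (q ^ 2) ^ z.natAbs := by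
            rw [mul_pow, ← pow_mul, ← pow_mul, mul_comm 2 z.natAbs, mul_assoc]
    obtain ⟨L, hL⟩ := exists_tendsto_average (sq_nonneg q) (by nlinarith) (by positivity) hb j j'
    refine ⟨L, hL.congr fun n => ?_⟩
    simp only [hcov]
  choose Γ hΓ using hlim
  have hsymm : ∀ j j', Γ j j' = Γ j' j := by
    intro j j'
    refine tendsto_nhds_unique (hΓ j j') ((hΓ j' j).congr fun n => ?_)
    rw [Finset.sum_comm, mul_comm (numCoeff n j' : ℝ)]
    simp only [covariance_comm]
  refine ⟨Γ, hsymm, fun c => ?_⟩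
  -- the coefficients of all octaves form one Gaussian vector, indexed by the pairs `(j, k)`
  let ι : ℕ → Type := fun n => (j : J) × Finset.Icc 1 (numCoeff n j)
  let f : ∀ n, ι n → ℕ × ℤ := fun n i => ((i.1 : ℕ), ((i.2 : ℕ) : ℤ))
  let X : ∀ n, ι n → Ω → ℝ := fun n i => waveletCoeff φ ψ B (f n i).1 (f n i).2
  let a : ∀ n, ι n → ℝ := fun n i => c i.1 * (Real.sqrt n / numCoeff n i.1)
  have hX : ∀ n, HasGaussianLaw (fun ω i => X n i ω) μ := fun n =>
    hasGaussianLaw_waveletCoeff hW hB (f n)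
  have hX0 : ∀ n i, ∫ ω, X n i ω ∂μ = 0 := fun n i => integral_waveletCoeff hW hB _ _
  have hXv : ∀ n i, cov[X n i, X n i; μ] = v * lagCov φ ψ H lam i.1 i.1 0 := by
    intro n i
    simp only [X, hcov, sub_self, f]
  have hquad : ∀ᶠ n : ℕ in atTop, ∀ ω, ∑ i, a n i * (X n i ω ^ 2 - cov[X n i, X n i; μ]) =
      ∑ j : J, c j * (Real.sqrt n *
        (waveletVar φ ψ B n j ω - v * lagCov φ ψ H lam j j 0)) := by
    have : ∀ᶠ n : ℕ in atTop, ∀ j : J, 1 ≤ numCoeff n j := by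
      rw [eventually_all]
      exact fun j => (Nat.tendsto_div_const_atTop (by positivity)).eventually_ge_atTop 1
    filter_upwards [this] with n hn ω
    rw [Fintype.sum_sigma]
    refine Finset.sum_congr rfl fun j _ => ?_
    rw [waveletVar_sub_eq (hn j)]
    simp only [hXv]
    simp only [a, X, f]
    rw [← Finset.mul_sum, Finset.sum_coe_sort (Finset.Icc 1 (numCoeff n j))
      (fun k => waveletCoeff φ ψ B j (k : ℤ) ω ^ 2 - v * lagCov φ ψ H lam j j 0)]
    ring
  have hdouble : ∀ n, ∑ i, ∑ i', a n i * a n i' * cov[X n i, X n i'; μ] ^ 2 =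
      ∑ j : J, ∑ j' : J, c j * c j' * ((n : ℝ) / ((numCoeff n j : ℝ) * numCoeff n j') *
      ∑ k ∈ Finset.Icc 1 (numCoeff n j), ∑ k' ∈ Finset.Icc 1 (numCoeff n j'),
        cov[waveletCoeff φ ψ B j k, waveletCoeff φ ψ B j' k'; μ] ^ 2) := by
    intro n
    have hsig : ∀ g : ι n → ℝ, ∑ i, g i =
        ∑ j : J, ∑ k : Finset.Icc 1 (numCoeff n j), g ⟨j, k⟩ := fun g => Fintype.sum_sigma g
    rw [hsig]
    refine Finset.sum_congr rfl fun j _ => ?_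
    rw [Finset.sum_congr rfl fun k _ => hsig _, Finset.sum_comm]
    refine Finset.sum_congr rfl fun j' _ => ?_
    rw [← Finset.sum_coe_sort (Finset.Icc 1 (numCoeff n j)), Finset.mul_sum, Finset.mul_sum]
    refine Finset.sum_congr rfl fun k _ => ?_
    rw [← Finset.sum_coe_sort (Finset.Icc 1 (numCoeff n j')), Finset.mul_sum, Finset.mul_sum]
    refine Finset.sum_congr rfl fun k' _ => ?_
    simp only [a, X, f]
    have hss : (n : ℝ) = Real.sqrt n * Real.sqrt n :=
      (Real.mul_self_sqrt (Nat.cast_nonneg n)).symm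
    nth_rewrite 3 [hss]
    ring
  have hv : Tendsto (fun n => ∑ i, ∑ i', a n i * a n i' * cov[X n i, X n i'; μ] ^ 2) atTop
      (𝓝 (∑ j, ∑ j', c j * c j' * Γ j j')) := by
    simp_rw [hdouble]
    exact tendsto_finsetSum _ fun j _ => tendsto_finsetSum _ fun j' _ => (hΓ j j').const_mul _
  -- row sums of the covariance matrix are bounded uniformly in `n`
  set T := ∑' z : ℤ, q ^ z.natAbs with hT
  have hT0 : 0 ≤ T := tsum_nonneg fun z => by positivity
  set R := ∑ j : J, ∑ j' : J, |v| * (C j j' * T) with hR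
  have hrow : ∀ n (i : ι n), ∑ i', |cov[X n i, X n i'; μ]| ≤ R := by
    intro n i
    rw [Fintype.sum_sigma]
    refine le_trans ?_ (Finset.single_le_sum (f := fun j : J => ∑ j' : J, |v| * (C j j' * T))
      (fun j _ => Finset.sum_nonneg fun j' _ => by have := hC0 j j'; positivity)
      (Finset.mem_univ i.1))
    refine Finset.sum_le_sum fun j' _ => ?_
    have hinj : Function.Injective fun k' : Finset.Icc 1 (numCoeff n j') =>
        (2 ^ (i.1 : ℕ) * ((i.2 : ℕ) : ℤ) - 2 ^ (j' : ℕ) * ((k' : ℕ) : ℤ) : ℤ) := by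
      intro x y hxy
      have h2 : (2 : ℤ) ^ (j' : ℕ) ≠ 0 := by positivity
      have := mul_left_cancel₀ h2 (sub_right_injective hxy)
      exact Subtype.ext (by exact_mod_cast this)
    have hsum := sum_pow_natAbs_le hq0 hq1 Finset.univ hinj
    calc ∑ k', |cov[X n i, X n ⟨j', k'⟩; μ]|
        ≤ ∑ k' : Finset.Icc 1 (numCoeff n j'), |v| * (C i.1 j' *
          q ^ (2 ^ (i.1 : ℕ) * ((i.2 : ℕ) : ℤ) - 2 ^ (j' : ℕ) * ((k' : ℕ) : ℤ) : ℤ).natAbs) := by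
          refine Finset.sum_le_sum fun k' _ => ?_
          simp only [X, hcov, f, abs_mul]
          have := hC i.1 j' (2 ^ (i.1 : ℕ) * ((i.2 : ℕ) : ℤ) - 2 ^ (j' : ℕ) * ((k' : ℕ) : ℤ))
          gcongr
      _ ≤ |v| * (C i.1 j' * T) := by
          rw [← Finset.mul_sum, ← Finset.mul_sum]
          have := hC0 i.1 j'
          gcongr
  have hR0 : 0 ≤ R := Finset.sum_nonneg fun j _ => Finset.sum_nonneg fun j' _ => by
    have := hC0 j j'; positivity
  set D : ℕ → ℝ := fun n => (∑ j : J, |c j| * (Real.sqrt n / numCoeff n j)) * R with hD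
  have hD0 : ∀ n, 0 ≤ D n := fun n => by positivity
  have hDlim : Tendsto D atTop (𝓝 0) := by
    have : Tendsto (fun n : ℕ => ∑ j : J, |c j| * (Real.sqrt n / numCoeff n j)) atTop
        (𝓝 (∑ j : J, |c j| * 0)) :=
      tendsto_finsetSum _ fun j _ => (tendsto_sqrt_div_numCoeff j).const_mul _
    have h := this.mul_const R
    simp only [mul_zero, Finset.sum_const_zero, zero_mul] at h
    exact h
  have hbound : ∀ n (i : ι n), |a n i| * ∑ i', |cov[X n i, X n i'; μ]| ≤ D n := by
    intro n i
    refine mul_le_mul ?_ (hrow n i) (by positivity) (by positivity)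
    simp only [a, abs_mul]
    rw [abs_of_nonneg (by positivity : 0 ≤ Real.sqrt n / (numCoeff n i.1 : ℝ))]
    exact Finset.single_le_sum (f := fun j : J => |c j| * (Real.sqrt n / numCoeff n j))
      (fun j _ => by positivity) (Finset.mem_univ i.1)
  refine ⟨?_, ?_, ?_⟩
  · filter_upwards [hquad] with n hn
    simp_rw [← hn]
    exact (integral_quadraticForm_sq (hX n) (hX0 n) (a n)).1
  · refine (hv.const_mul chiVar).congr' ?_
    filter_upwards [hquad] with n hn
    simp_rw [← hn]
    exact (integral_quadraticForm_sq (hX n) (hX0 n) (a n)).2.symm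
  · refine (tendsto_integral_exp_quadraticForm hX hX0 a hbound hD0 hDlim hv).congr' ?_
    filter_upwards [hquad] with n hn
    simp_rw [hn]

end CentralLimit

/-! ### Negligible remainders -/

section DeltaMethod

variable {Ω E F : Type*} [MeasurableSpace Ω] {μ : Measure Ω}
  [NormedAddCommGroup E] [NormedAddCommGroup F]

/-- If `V n` is tight, with a quadratic tail bound uniform in `n`, and `R n` is at most
`η (‖V n‖ + 1)` on the event `‖V n‖ < r √n`, for every `η` and some `r = r(η)`, then `R n` tends
to zero in probability. -/
theorem tendstoInMeasure_zero_of_le_of_tight [IsProbabilityMeasure μ] {V : ℕ → Ω → E}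
    {R : ℕ → Ω → F} {C : ℝ}
    (hV : ∀ᶠ n in atTop, ∀ t > 0, μ.real {ω | t ≤ ‖V n ω‖} ≤ C / t ^ 2)
    (hR : ∀ η > 0, ∃ r > 0, ∀ᶠ n : ℕ in atTop, ∀ ω, ‖V n ω‖ < Real.sqrt n * r →
      ‖R n ω‖ ≤ η * (‖V n ω‖ + 1)) :
    TendstoInMeasure μ R atTop (fun _ => 0) := by
  rw [tendstoInMeasure_iff_measureReal_norm]
  intro ε hε
  simp only [sub_zero]
  rw [Metric.tendsto_atTop']
  intro δ hδ
  have hC : Tendsto (fun t : ℝ => C / t ^ 2) atTop (𝓝 0) :=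
    tendsto_const_nhds.div_atTop (tendsto_pow_atTop two_ne_zero)
  obtain ⟨t, ht, ht0⟩ := ((hC.eventually_lt_const hδ).and (eventually_gt_atTop 0)).exists
  obtain ⟨r, hr, hRr⟩ := hR (ε / (2 * (t + 1))) (by positivity)
  have hsq : Tendsto (fun n : ℕ => Real.sqrt n * r) atTop atTop :=
    (Real.tendsto_sqrt_atTop.comp tendsto_natCast_atTop_atTop).atTop_mul_const hr
  obtain ⟨n₀, hn₀⟩ := (hV.and (hRr.and (hsq.eventually_ge_atTop t))).exists_forall_of_atTop
  refine ⟨n₀, fun n hn => ?_⟩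
  obtain ⟨h1, h2, h3⟩ := hn₀ n hn.le
  rw [Real.dist_0_eq_abs, abs_of_nonneg measureReal_nonneg]
  refine lt_of_le_of_lt (measureReal_mono fun ω hω => ?_) ((h1 t ht0).trans_lt ht)
  simp only [Set.mem_ofPred_eq] at hω ⊢
  by_contra hlt
  rw [not_le] at hlt
  have h4 := h2 ω (hlt.trans_le h3)
  have h5 : ε / (2 * (t + 1)) * (‖V n ω‖ + 1) ≤ ε / (2 * (t + 1)) * (t + 1) := by gcongr
  have h6 : ε / (2 * (t + 1)) * (t + 1) = ε / 2 := by field_simp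
  linarith

theorem measureReal_le_norm_le [IsFiniteMeasure μ] {V : Ω → E} {C : ℝ}
    (hV : Integrable (fun ω => ‖V ω‖ ^ 2) μ)
    (hC : ∫ ω, ‖V ω‖ ^ 2 ∂μ ≤ C) {t : ℝ} (ht : 0 < t) :
    μ.real {ω | t ≤ ‖V ω‖} ≤ C / t ^ 2 := by
  have h := mul_meas_ge_le_integral_of_nonneg (μ := μ) (f := fun ω => ‖V ω‖ ^ 2)
    (ae_of_all _ fun _ => by positivity) hV (t ^ 2)
  have hset : {ω | t ^ 2 ≤ ‖V ω‖ ^ 2} = {ω | t ≤ ‖V ω‖} := by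
    ext ω
    exact pow_le_pow_iff_left₀ ht.le (norm_nonneg _) two_ne_zero
  rw [hset] at h
  rw [le_div_iff₀ (by positivity), mul_comm]
  exact h.trans hC

end DeltaMethod

/-! ### Gaussian limits of linear images -/

section GaussianLimit

open scoped RealInnerProductSpace

variable {Ω ι κ : Type*} [MeasurableSpace Ω] {μ : Measure Ω} [IsProbabilityMeasure μ]
  [Fintype ι] [DecidableEq ι] [Fintype κ]

theorem inner_map_eq_sum (T : EuclideanSpace ℝ ι →L[ℝ] EuclideanSpace ℝ κ)
    (y : EuclideanSpace ℝ ι) (x : EuclideanSpace ℝ κ) :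
    ⟪T y, x⟫ = ∑ j, ⟪T (EuclideanSpace.single j 1), x⟫ * y j := by
  have hy : y = ∑ j, y j • EuclideanSpace.single j (1 : ℝ) := by
    ext i
    simp [Pi.single_apply]
  conv_lhs => rw [hy, map_sum, sum_inner]
  refine Finset.sum_congr rfl fun j _ => ?_
  rw [map_smul, real_inner_smul_left, mul_comm]

/-- Cramér–Wold device: if all linear combinations of the coordinates of `V n` have asymptotically
centred normal characteristic functions, then every linear image of `V n` has a multivariate
Gaussian limit. The covariance matrix of the limit is positive semidefinite as a limit of second
moments. -/
theorem exists_tendstoInDistribution_map [DecidableEq κ] {V : ℕ → Ω → EuclideanSpace ℝ ι}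
    (hV : ∀ n, Measurable (V n)) {a : ℝ} {Γ : ι → ι → ℝ} (hΓ : ∀ j j', Γ j j' = Γ j' j)
    (hsq : ∀ c : ι → ℝ, Tendsto (fun n => ∫ ω, (∑ j, c j * V n ω j) ^ 2 ∂μ) atTop
      (𝓝 (a * ∑ j, ∑ j', c j * c j' * Γ j j')))
    (hexp : ∀ c : ι → ℝ, Tendsto
      (fun n => ∫ ω, Complex.exp (((∑ j, c j * V n ω j : ℝ) : ℂ) * Complex.I) ∂μ) atTop
      (𝓝 (Complex.exp (-(a * ((∑ j, ∑ j', c j * c j' * Γ j j' : ℝ) : ℂ) / 2)))))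
    (T : EuclideanSpace ℝ ι →L[ℝ] EuclideanSpace ℝ κ) :
    ∃ S : Matrix κ κ ℝ, S.PosSemidef ∧
      TendstoInDistribution (fun n ω => T (V n ω)) atTop id (fun _ => μ)
        (multivariateGaussian 0 S) := by
  set e : ι → EuclideanSpace ℝ κ := fun j => T (EuclideanSpace.single j 1) with he
  set S : Matrix κ κ ℝ := Matrix.of fun i l => a * ∑ j, ∑ j', e j i * e j' l * Γ j j' with hS
  have hquad : ∀ x : EuclideanSpace ℝ κ, x.ofLp ⬝ᵥ S.mulVec x.ofLp =
      a * ∑ j, ∑ j', ⟪e j, x⟫ * ⟪e j', x⟫ * Γ j j' := by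
    intro x
    have h1 : ∀ j j', ⟪e j, x⟫ * ⟪e j', x⟫ * Γ j j' =
        ∑ i, ∑ l, x i * (e j i * e j' l * Γ j j' * x l) := by
      intro j j'
      simp only [PiLp.inner_apply, RCLike.inner_apply, conj_trivial]
      rw [Finset.sum_mul_sum, Finset.sum_mul]
      refine Finset.sum_congr rfl fun i _ => ?_
      rw [Finset.sum_mul]
      exact Finset.sum_congr rfl fun l _ => by ring
    simp only [dotProduct, Matrix.mulVec, hS, Matrix.of_apply, h1]
    simp only [Finset.mul_sum, Finset.sum_mul]
    calc ∑ i, ∑ l, ∑ j, ∑ j', x i * (a * (e j i * e j' l * Γ j j') * x l)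
        = ∑ i, ∑ j, ∑ l, ∑ j', x i * (a * (e j i * e j' l * Γ j j') * x l) :=
          Finset.sum_congr rfl fun i _ => Finset.sum_comm
      _ = ∑ j, ∑ i, ∑ l, ∑ j', x i * (a * (e j i * e j' l * Γ j j') * x l) := Finset.sum_comm
      _ = ∑ j, ∑ i, ∑ j', ∑ l, x i * (a * (e j i * e j' l * Γ j j') * x l) :=
          Finset.sum_congr rfl fun j _ => Finset.sum_congr rfl fun i _ => Finset.sum_comm
      _ = ∑ j, ∑ j', ∑ i, ∑ l, x i * (a * (e j i * e j' l * Γ j j') * x l) :=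
          Finset.sum_congr rfl fun j _ => Finset.sum_comm
      _ = _ := by
          refine Finset.sum_congr rfl fun j _ => Finset.sum_congr rfl fun j' _ =>
            Finset.sum_congr rfl fun i _ => Finset.sum_congr rfl fun l _ => ?_
          ring
  have hpsd : S.PosSemidef := by
    refine Matrix.PosSemidef.of_dotProduct_mulVec_nonneg ?_ fun x => ?_
    · ext i l
      simp only [hS, Matrix.conjTranspose_apply, Matrix.of_apply, star_trivial]
      rw [Finset.sum_comm]
      refine congrArg _ (Finset.sum_congr rfl fun j _ => Finset.sum_congr rfl fun j' _ => ?_)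
      rw [hΓ j' j]
      ring
    · have h := hquad (WithLp.toLp 2 x)
      simp only [star_trivial]
      change x ⬝ᵥ S.mulVec x = _ at h
      rw [h]
      exact ge_of_tendsto' (hsq _) fun n => integral_nonneg fun ω => sq_nonneg _
  have hm : ∀ n, Measurable fun ω => T (V n ω) := fun n => T.continuous.measurable.comp (hV n)
  refine ⟨S, hpsd, ⟨fun n => (hm n).aemeasurable, aemeasurable_id, ?_⟩⟩
  refine ProbabilityMeasure.tendsto_of_tendsto_charFun fun x => ?_
  have hlim : charFun (Measure.map id (multivariateGaussian 0 S)) x =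
      Complex.exp (-(a * ((∑ j, ∑ j', ⟪e j, x⟫ * ⟪e j', x⟫ * Γ j j' : ℝ) : ℂ) / 2)) := by
    rw [Measure.map_id, charFun_multivariateGaussian hpsd, hquad]
    rw [inner_zero_right, Complex.ofReal_zero, zero_mul, zero_sub, Complex.ofReal_mul]
  have hchar : ∀ n, charFun (μ.map fun ω => T (V n ω)) x =
      ∫ ω, Complex.exp (((∑ j, ⟪e j, x⟫ * V n ω j : ℝ) : ℂ) * Complex.I) ∂μ := by
    intro n
    rw [charFun_apply, integral_map (hm n).aemeasurable (by fun_prop)]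
    refine integral_congr_ae (ae_of_all _ fun ω => ?_)
    beta_reduce
    rw [inner_map_eq_sum T (V n ω) x]
  simp only [ProbabilityMeasure.coe_mk]
  rw [hlim]
  simp_rw [hchar]
  exact hexp _

end GaussianLimit

/-! ### The delta method -/

section Linearization

variable {E F : Type*} [NormedAddCommGroup E] [NormedSpace ℝ E] [NormedAddCommGroup F]
  [NormedSpace ℝ F] {Φ : E → F} {T : E →L[ℝ] F} {b : ℕ → F}

/-- Delta method for the data `Φ (v / √n) - b n`, with an asymptotically negligible bias `b n`. -/
theorem exists_norm_sqrt_smul_sub_le (hΦ : HasFDerivAt Φ T 0)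
    (hb : Tendsto (fun n : ℕ => Real.sqrt n • b n) atTop (𝓝 0)) {η : ℝ} (hη : 0 < η) :
    ∃ r > 0, ∀ᶠ n : ℕ in atTop, ∀ v, ‖v‖ < Real.sqrt n * r →
      ‖Real.sqrt n • (Φ ((Real.sqrt n)⁻¹ • v) - b n - Φ 0) - T v‖ ≤ η * (‖v‖ + 1) := by
  have h := (hasFDerivAt_iff_isLittleO_nhds_zero.1 hΦ).def hη
  obtain ⟨r, hr, hball⟩ := Metric.eventually_nhds_iff.1 h
  refine ⟨r, hr, ?_⟩
  filter_upwards [eventually_ge_atTop 1,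
    (tendsto_zero_iff_norm_tendsto_zero.1 hb).eventually_le_const hη] with n hn hbn v hv
  have hs : 0 < Real.sqrt n := Real.sqrt_pos.2 (by exact_mod_cast hn)
  have hlt : ‖(Real.sqrt n)⁻¹ • v‖ < r := by
    rw [norm_smul, norm_inv, Real.norm_of_nonneg hs.le, inv_mul_lt_iff₀ hs]
    exact hv
  have h1 := hball (y := (Real.sqrt n)⁻¹ • v) (by rwa [dist_zero_right])
  rw [zero_add] at h1
  have h2 : Real.sqrt n • (Φ ((Real.sqrt n)⁻¹ • v) - b n - Φ 0) - T v =
      Real.sqrt n • (Φ ((Real.sqrt n)⁻¹ • v) - Φ 0 - T ((Real.sqrt n)⁻¹ • v)) -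
        Real.sqrt n • b n := by
    rw [map_smul]
    simp only [smul_sub, smul_inv_smul₀ hs.ne']
    abel
  rw [h2]
  refine (norm_sub_le _ _).trans ?_
  have h3 : ‖Real.sqrt n • (Φ ((Real.sqrt n)⁻¹ • v) - Φ 0 - T ((Real.sqrt n)⁻¹ • v))‖ ≤
      η * ‖v‖ := by
    rw [norm_smul, Real.norm_of_nonneg hs.le]
    calc _ ≤ Real.sqrt n * (η * ‖(Real.sqrt n)⁻¹ • v‖) := by gcongr
      _ = η * ‖v‖ := by
        rw [norm_smul, norm_inv, Real.norm_of_nonneg hs.le]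
        field_simp
  linarith

theorem exists_norm_sub_lt (hΦ : ContinuousAt Φ 0)
    (hb : Tendsto (fun n : ℕ => Real.sqrt n • b n) atTop (𝓝 0)) {ε : ℝ} (hε : 0 < ε) :
    ∃ r > 0, ∀ᶠ n : ℕ in atTop, ∀ v, ‖v‖ < Real.sqrt n * r →
      ‖Φ ((Real.sqrt n)⁻¹ • v) - b n - Φ 0‖ < ε := by
  obtain ⟨r, hr, hball⟩ := Metric.continuousAt_iff.1 hΦ (ε / 2) (by positivity)
  refine ⟨r, hr, ?_⟩
  filter_upwards [eventually_ge_atTop 1,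
    (tendsto_zero_iff_norm_tendsto_zero.1 hb).eventually_lt_const (half_pos hε)] with n hn hbn v hv
  have hs1 : 1 ≤ Real.sqrt n := Real.one_le_sqrt.2 (by exact_mod_cast hn)
  have hs : 0 < Real.sqrt n := one_pos.trans_le hs1
  have hlt : ‖(Real.sqrt n)⁻¹ • v‖ < r := by
    rw [norm_smul, norm_inv, Real.norm_of_nonneg hs.le, inv_mul_lt_iff₀ hs]
    exact hv
  have h1 := hball (x := (Real.sqrt n)⁻¹ • v) (by rwa [dist_zero_right])
  rw [dist_eq_norm] at h1
  have h2 : ‖b n‖ ≤ ‖Real.sqrt n • b n‖ := by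
    rw [norm_smul, Real.norm_of_nonneg hs.le]
    exact le_mul_of_one_le_left (norm_nonneg _) hs1
  calc _ = ‖(Φ ((Real.sqrt n)⁻¹ • v) - Φ 0) - b n‖ := by congr 1; abel
    _ ≤ _ := norm_sub_le _ _
    _ < ε := by linarith

end Linearization

/-! ### The estimator -/

section Estimator

variable {Ω : Type*}

theorem weight_pos (j : ℕ) : 0 < weight j := by unfold weight; positivity

/-- The vector `(√w_j log₂ s_j)_{j ∈ J}`. With these weights the objective function is a squared
Euclidean distance. -/
def weightedLog (J : Finset ℕ) (s : J → ℝ) : EuclideanSpace ℝ J :=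
  WithLp.toLp 2 fun j => Real.sqrt (weight j) * Real.logb 2 (s j)

/-- The vector of bias corrections, with the weights of `weightedLog`. -/
def weightedBias (J : Finset ℕ) (n : ℕ) : EuclideanSpace ℝ J :=
  WithLp.toLp 2 fun j => Real.sqrt (weight j) * biasCorrection n j

theorem tendsto_sqrt_smul_weightedBias (J : Finset ℕ) :
    Tendsto (fun n : ℕ => Real.sqrt n • weightedBias J n) atTop (𝓝 0) := by
  rw [← WithLp.toLp_zero 2]
  have h : Tendsto (fun n : ℕ => fun j : J => Real.sqrt (weight j) *
      (Real.sqrt n * biasCorrection n j)) atTop (𝓝 0) := by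
    rw [tendsto_pi_nhds]
    intro j
    simpa using (tendsto_sqrt_mul_biasCorrection j).const_mul (Real.sqrt (weight j))
  refine ((PiLp.continuous_toLp 2 _).tendsto _).comp h |>.congr fun n => ?_
  ext j
  simp only [Function.comp, weightedBias, PiLp.smul_apply, smul_eq_mul]
  ring

theorem differentiableAt_weightedLog {G : Type*} [NormedAddCommGroup G] [NormedSpace ℝ G]
    {J : Finset ℕ} {s : G → J → ℝ} {x : G} (hs : ∀ j, DifferentiableAt ℝ (fun y => s y j) x)
    (hs0 : ∀ j, s x j ≠ 0) : DifferentiableAt ℝ (fun y => weightedLog J (s y)) x := by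
  rw [differentiableAt_piLp]
  intro j
  simp only [weightedLog, Real.logb, div_eq_mul_inv]
  exact ((DifferentiableAt.log (hs j) (hs0 j)).mul_const _).const_mul _

/-- The normalized errors `√n (W(2^j) - s_j)` of the sample wavelet variances. -/
def scaledError (φ ψ : ℝ → ℝ) (B : ℝ → Ω → ℝ) (J : Finset ℕ) (s : J → ℝ) (n : ℕ) (ω : Ω) :
    EuclideanSpace ℝ J :=
  WithLp.toLp 2 fun j => Real.sqrt n * (waveletVar φ ψ B n j ω - s j)

theorem weightedLog_waveletVar_eq {φ ψ : ℝ → ℝ} {B : ℝ → Ω → ℝ} {J : Finset ℕ} {n : ℕ} (hn : 1 ≤ n)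
    (s : J → ℝ) (ω : Ω) :
    weightedLog J (fun j => waveletVar φ ψ B n j ω) =
      weightedLog J fun j => s j + ((Real.sqrt n)⁻¹ • scaledError φ ψ B J s n ω) j := by
  have hs : 0 < Real.sqrt n := Real.sqrt_pos.2 (by exact_mod_cast hn)
  congr 1
  ext j
  simp only [scaledError, PiLp.smul_apply, smul_eq_mul]
  field_simp
  ring

variable [MeasurableSpace Ω] {φ ψ : ℝ → ℝ} {N : ℕ} {α : ℝ} {B : ℝ → Ω → ℝ}
  {P : Param → Measure Ω} {J : Finset ℕ}

theorem objective_eq (n : ℕ) (ω : Ω) (θ : Param) :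
    objective φ ψ B P J n ω θ =
      ‖weightedLog J (fun j => waveletVar φ ψ B n j ω) - weightedBias J n -
        weightedLog J (fun j => spectrum φ ψ B P j θ)‖ ^ 2 := by
  rw [EuclideanSpace.norm_sq_eq, objective, ← Finset.sum_coe_sort]
  refine Finset.sum_congr rfl fun j _ => ?_
  simp only [weightedLog, weightedBias, PiLp.sub_apply, Real.norm_eq_abs, sq_abs, logSpectrum]
  rw [← mul_sub, ← mul_sub, mul_pow, Real.sq_sqrt (weight_pos _).le]
  ring

theorem measurable_waveletVar (hφ : HasCompactSupport φ) (hψ : HasCompactSupport ψ)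
    (hB : ∀ t, Measurable (B t)) (n j : ℕ) : Measurable (waveletVar φ ψ B n j) := by
  unfold waveletVar
  exact (Finset.measurable_fun_sum _ fun (k : ℕ) _ =>
    (measurable_waveletCoeff hφ hψ hB j (k : ℤ)).pow_const 2).const_mul _

theorem measurable_weightedLog_waveletVar (hφ : HasCompactSupport φ) (hψ : HasCompactSupport ψ)
    (hB : ∀ t, Measurable (B t)) (n : ℕ) :
    Measurable fun ω => weightedLog J fun j => waveletVar φ ψ B n j ω := by
  refine (PiLp.continuous_toLp 2 _).measurable.comp (measurable_pi_lambda _ fun j => ?_)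
  exact ((Real.measurable_log.comp (measurable_waveletVar hφ hψ hB n j)).div_const _).const_mul _

theorem differentiableAt_weightedLog_spectrum (hW : IsWaveletSystem φ ψ N α)
    (hB : IsTfBmModel B P) (hJ : ∀ j ∈ J, 1 ≤ j) {θ : Param} (hθ : θ ∈ paramSpace) :
    DifferentiableAt ℝ (fun θ => weightedLog J fun j => spectrum φ ψ B P j θ) θ :=
  differentiableAt_weightedLog (fun j => differentiableAt_spectrum hW hB hθ j)
    fun j => (spectrum_pos hW hB hθ (hJ j j.2)).ne'

theorem injOn_weightedLog_spectrum (hW : IsWaveletSystem φ ψ N α)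
    (hB : IsTfBmModel B P) (hJ : ∀ j ∈ J, 1 ≤ j) {K : Set Param} (hK : K ⊆ paramSpace)
    (hid : SpectrumIdentifiable φ ψ B P J K) :
    Set.InjOn (fun θ => weightedLog J fun j => spectrum φ ψ B P j θ) K := by
  intro θ hθ θ' hθ' heq
  by_contra hne
  obtain ⟨n, hn, j, hj, hnej⟩ := hid θ hθ θ' hθ' hne
  have hnum : 1 ≤ numCoeff n j := by
    have hlog := hn j hj
    have hn0 : n ≠ 0 := by
      rintro rfl
      have := hJ j hj
      simp at hlog
      omega
    exact (Nat.one_le_div_iff (by positivity)).2 (Nat.pow_le_of_le_log hn0 hlog)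
  rw [integral_waveletVar hW hB (hK hθ) hnum, integral_waveletVar hW hB (hK hθ') hnum] at hnej
  apply hnej
  have h := congrArg (fun x : EuclideanSpace ℝ J => x ⟨j, hj⟩) heq
  simp only [weightedLog] at h
  have hw := mul_left_cancel₀ (Real.sqrt_pos.2 (weight_pos j)).ne' h
  exact Real.logb_injOn_pos one_lt_two (spectrum_pos hW hB (hK hθ) (hJ j hj))
    (spectrum_pos hW hB (hK hθ') (hJ j hj)) hw

theorem exists_isRestrictedMinimum (hW : IsWaveletSystem φ ψ N α)
    (hB : IsTfBmModel B P) (hJ : ∀ j ∈ J, 1 ≤ j) {K : Set Param} (hK : K ⊆ paramSpace)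
    (hKc : IsCompact K) (hne : K.Nonempty) :
    ∃ est : ℕ → Ω → Param, IsRestrictedMinimum φ ψ B P J K est := by
  have hG : ContinuousOn (fun θ => weightedLog J fun j => spectrum φ ψ B P j θ) K := fun θ hθ =>
    (differentiableAt_weightedLog_spectrum hW hB hJ (hK hθ)).continuousAt.continuousWithinAt
  obtain ⟨sel, hsel, hmin⟩ := exists_measurable_isMinOn hKc hne hG
  refine ⟨fun n ω => sel (weightedLog J (fun j => waveletVar φ ψ B n j ω) - weightedBias J n),
    fun n => hsel.comp ((measurable_weightedLog_waveletVar hW.compact_scaling hW.compact_wavelet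
      hB.measurable n).sub_const _), fun n _ ω => ⟨(hmin _).1, ?_⟩⟩
  have hobj : objective φ ψ B P J n ω = _ := funext (objective_eq n ω)
  rw [hobj]
  exact (hmin _).2

/-- A vector in the kernel of the derivative is annihilated by all derivatives of the spectrum,
hence by the information matrix. -/
theorem fderiv_weightedLog_spectrum_injective (hW : IsWaveletSystem φ ψ N α)
    (hB : IsTfBmModel B P) (hJ : ∀ j ∈ J, 1 ≤ j) {θ : Param} (hθ : θ ∈ paramSpace)
    (hdet : 0 < (informationMatrix φ ψ B P J θ).det) :
    Function.Injective
      (fderiv ℝ (fun θ => weightedLog J fun j => spectrum φ ψ B P j θ) θ) := by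
  rw [injective_iff_map_eq_zero]
  intro v hv
  have hd := differentiableAt_weightedLog_spectrum hW hB hJ hθ
  have hs : ∀ j ∈ J, fderiv ℝ (spectrum φ ψ B P j) θ v = 0 := by
    intro j hj
    have hpos := spectrum_pos hW hB hθ (hJ j hj)
    have h1 : HasFDerivAt (fun θ => Real.sqrt (weight j) * Real.logb 2 (spectrum φ ψ B P j θ))
        ((EuclideanSpace.proj (𝕜 := ℝ) (⟨j, hj⟩ : J)) ∘L
          fderiv ℝ (fun θ => weightedLog J fun j => spectrum φ ψ B P j θ) θ) θ :=
      (EuclideanSpace.proj (𝕜 := ℝ) (⟨j, hj⟩ : J)).hasFDerivAt.comp θ hd.hasFDerivAt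
    have h2 : HasFDerivAt (fun θ => Real.sqrt (weight j) * Real.logb 2 (spectrum φ ψ B P j θ))
        (Real.sqrt (weight j) • ((Real.log 2)⁻¹ • ((spectrum φ ψ B P j θ)⁻¹ •
          fderiv ℝ (spectrum φ ψ B P j) θ))) θ := by
      have h := ((differentiableAt_spectrum hW hB hθ j).hasFDerivAt.log hpos.ne').const_mul
        (Real.log 2)⁻¹ |>.const_mul (Real.sqrt (weight j))
      refine h.congr_of_eventuallyEq (Eventually.of_forall fun θ => ?_)
      simp only [Real.logb]
      ring
    have h3 := congrArg (fun A => A v) (h1.unique h2)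
    simp only [ContinuousLinearMap.comp_apply, hv, map_zero, smul_apply, smul_eq_mul] at h3
    have hw := (Real.sqrt_pos.2 (weight_pos j)).ne'
    have hl := (Real.log_pos one_lt_two).ne'
    have := hpos.ne'
    simpa [hw, hl, this] using h3.symm
  have hpart : ∀ j ∈ J, ∑ l, partialDeriv l (spectrum φ ψ B P j) θ * v l = 0 := by
    intro j hj
    have hv' : v = ∑ l, v l • EuclideanSpace.single l (1 : ℝ) := by
      ext i
      simp [Pi.single_apply]
    rw [← hs j hj]
    conv_rhs => rw [hv', map_sum]
    refine Finset.sum_congr rfl fun l _ => ?_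
    rw [partialDeriv, (differentiableAt_spectrum hW hB hθ j).lineDeriv_eq_fderiv, map_smul,
      smul_eq_mul, mul_comm]
  have hmul : (informationMatrix φ ψ B P J θ).mulVec v.ofLp = 0 := by
    ext i
    simp only [Matrix.mulVec, dotProduct, informationMatrix, Matrix.of_apply, Pi.zero_apply,
      Finset.sum_mul]
    rw [Finset.sum_comm]
    refine Finset.sum_eq_zero fun j hj => ?_
    calc _ = weight j * partialDeriv i (spectrum φ ψ B P j) θ / spectrum φ ψ B P j θ ^ 2 *
          ∑ l, partialDeriv l (spectrum φ ψ B P j) θ * v l := by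
          rw [Finset.mul_sum]
          exact Finset.sum_congr rfl fun l _ => by ring
      _ = 0 := by rw [hpart j hj, mul_zero]
  have := Matrix.eq_zero_of_mulVec_eq_zero hdet.ne' hmul
  ext i
  exact congrFun this i

theorem measurable_scaledError (hφ : HasCompactSupport φ) (hψ : HasCompactSupport ψ)
    (hB : ∀ t, Measurable (B t)) (s : J → ℝ) (n : ℕ) :
    Measurable (scaledError φ ψ B J s n) := by
  refine (PiLp.continuous_toLp 2 _).measurable.comp (measurable_pi_lambda _ fun j => ?_)
  exact ((measurable_waveletVar hφ hψ hB n j).sub_const _).const_mul _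

/-- Tightness of the normalized errors, by Markov's inequality for the second moment. -/
theorem exists_measureReal_scaledError_le (hW : IsWaveletSystem φ ψ N α) {μ : Measure Ω}
    {H lam v : ℝ} (hB : IsTfBm B μ H lam v) (hH : 0 < H) (hl : 0 < lam) (J : Finset ℕ) :
    ∃ C, ∀ᶠ n in atTop, ∀ t > 0, μ.real {ω | t ≤ ‖scaledError φ ψ B J
      (fun j => v * lagCov φ ψ H lam j j 0) n ω‖} ≤ C / t ^ 2 := by
  have hμ := hB.gaussian.isProbabilityMeasure
  obtain ⟨Γ, -, h⟩ := exists_tendsto_waveletVar hW hB hH hl J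
  have hsingle : ∀ (j : J) (n : ℕ) (ω : Ω), ∑ i : J, (Pi.single j 1 : J → ℝ) i * (Real.sqrt n *
      (waveletVar φ ψ B n i ω - v * lagCov φ ψ H lam i i 0)) = Real.sqrt n *
      (waveletVar φ ψ B n j ω - v * lagCov φ ψ H lam j j 0) := by
    intro j n ω
    rw [Finset.sum_eq_single j (fun i _ hi => by simp [hi]) (by simp)]
    simp
  have hmem : ∀ᶠ n : ℕ in atTop, ∀ j : J, MemLp (fun ω => Real.sqrt n *
      (waveletVar φ ψ B n j ω - v * lagCov φ ψ H lam j j 0)) 2 μ := by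
    rw [eventually_all]
    intro j
    filter_upwards [(h (Pi.single j 1)).1] with n hn
    simpa only [hsingle] using hn
  have hlim := tendsto_finsetSum Finset.univ fun (j : J) _ => (h (Pi.single j 1)).2.1
  simp only [hsingle] at hlim
  obtain ⟨C, hC⟩ := hlim.isBoundedUnder_le
  rw [eventually_map] at hC
  refine ⟨C, ?_⟩
  filter_upwards [hmem, hC] with n hn hCn t ht
  have hnorm : ∀ ω, ‖scaledError φ ψ B J (fun j => v * lagCov φ ψ H lam j j 0) n ω‖ ^ 2 =
      ∑ j : J, (Real.sqrt n * (waveletVar φ ψ B n j ω - v * lagCov φ ψ H lam j j 0)) ^ 2 := by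
    intro ω
    simp only [EuclideanSpace.norm_sq_eq, scaledError, Real.norm_eq_abs, sq_abs]
  refine measureReal_le_norm_le ?_ ?_ ht
  · simp_rw [hnorm]
    exact integrable_finsetSum _ fun j _ => (hn j).integrable_sq
  · simp_rw [hnorm]
    rw [integral_finsetSum _ fun j _ => (hn j).integrable_sq]
    exact hCn

variable [∀ θ, IsProbabilityMeasure (P θ)]

theorem eventually_admissible (J : Finset ℕ) : ∀ᶠ n in atTop, Admissible J n := by
  filter_upwards [eventually_ge_atTop (2 ^ J.sup id)] with n hn j hj
  exact Nat.le_log_of_pow_le one_lt_two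
    ((Nat.pow_le_pow_right two_pos (Finset.le_sup (f := id) hj)).trans hn)

theorem tendstoInMeasure_estimator (hW : IsWaveletSystem φ ψ N α)
    (hB : IsTfBmModel B P) (hJ : ∀ j ∈ J, 1 ≤ j) {K : Set Param} (hK : K ⊆ paramSpace)
    (hKc : IsCompact K) (hid : SpectrumIdentifiable φ ψ B P J K) {θ₀ : Param} (hθ₀ : θ₀ ∈ K)
    {est : ℕ → Ω → Param} (hest : IsRestrictedMinimum φ ψ B P J K est) :
    TendstoInMeasure (P θ₀) est atTop (fun _ => θ₀) := by
  have hθ := hK hθ₀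
  set s : J → ℝ := fun j => spectrum φ ψ B P j θ₀ with hs
  have hG : ContinuousOn (fun θ => weightedLog J fun j => spectrum φ ψ B P j θ) K := fun θ hθ =>
    (differentiableAt_weightedLog_spectrum hW hB hJ (hK hθ)).continuousAt.continuousWithinAt
  obtain ⟨C, hC⟩ := exists_measureReal_scaledError_le hW (hB.isTfBm θ₀ hθ) hθ.1 hθ.2.1 J
  simp only [← spectrum_eq hW hB hθ] at hC
  have hΦ : DifferentiableAt ℝ (fun x : EuclideanSpace ℝ J => weightedLog J fun j => s j + x j) 0 :=
    differentiableAt_weightedLog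
      (fun j => (EuclideanSpace.proj (𝕜 := ℝ) j).differentiableAt.const_add _) fun j => by
        simpa using (spectrum_pos hW hB hθ (hJ j j.2)).ne'
  have hzero : TendstoInMeasure (P θ₀) (fun n ω => est n ω - θ₀) atTop (fun _ => 0) := by
    refine tendstoInMeasure_zero_of_le_of_tight hC fun η hη => ?_
    obtain ⟨ρ, hρ, hmin⟩ := exists_norm_sub_lt_of_isMinOn hKc hG
      (injOn_weightedLog_spectrum hW hB hJ hK hid) hθ₀ hη
    obtain ⟨r, hr, hev⟩ := exists_norm_sub_lt hΦ.continuousAt (tendsto_sqrt_smul_weightedBias J) hρ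
    refine ⟨r, hr, ?_⟩
    filter_upwards [hev, eventually_admissible J, eventually_ge_atTop 1] with n hn hadm hn1 ω hω
    have h1 := hn _ hω
    obtain ⟨hmem, hobj⟩ := hest.2 n hadm ω
    have hobj' : objective φ ψ B P J n ω = _ := funext (objective_eq n ω)
    rw [hobj'] at hobj
    have h2 := hmin _ (by
      rw [weightedLog_waveletVar_eq hn1 s]
      simpa [hs] using h1) _ hmem hobj
    have : 0 ≤ ‖scaledError φ ψ B J s n ω‖ := norm_nonneg _
    nlinarith
  rw [tendstoInMeasure_iff_norm] at hzero ⊢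
  simpa using hzero

/-- Asymptotic normality. The limit law depends on `θ₀` only, not on the set over which the
objective function is minimised. -/
theorem exists_tendstoInDistribution_estimator (hW : IsWaveletSystem φ ψ N α)
    (hB : IsTfBmModel B P) (hJ : ∀ j ∈ J, 1 ≤ j) {θ₀ : Param} (hθ : θ₀ ∈ paramSpace)
    (hdet : 0 < (informationMatrix φ ψ B P J θ₀).det) :
    ∃ S : Matrix (Fin 3) (Fin 3) ℝ, S.PosSemidef ∧ ∀ K : Set Param, K ⊆ paramSpace →
      IsCompact K → K ∈ 𝓝 θ₀ → SpectrumIdentifiable φ ψ B P J K → ∀ est : ℕ → Ω → Param,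
      IsRestrictedMinimum φ ψ B P J K est →
      TendstoInDistribution (fun (n : ℕ) ω => Real.sqrt n • (est n ω - θ₀)) atTop id
        (fun _ => P θ₀) (multivariateGaussian 0 S) := by
  set s : J → ℝ := fun j => spectrum φ ψ B P j θ₀ with hs
  set G : Param → EuclideanSpace ℝ J := fun θ => weightedLog J fun j => spectrum φ ψ B P j θ
    with hGdef
  set Φ : EuclideanSpace ℝ J → EuclideanSpace ℝ J := fun x => weightedLog J fun j => s j + x j
    with hΦdef
  have hΦ : DifferentiableAt ℝ Φ 0 :=
    differentiableAt_weightedLog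
      (fun j => (EuclideanSpace.proj (𝕜 := ℝ) j).differentiableAt.const_add _) fun j => by
        simpa using (spectrum_pos hW hB hθ (hJ j j.2)).ne'
  have hΦ0 : Φ 0 = G θ₀ := by simp [hΦdef, hGdef, hs]
  set T := fderiv ℝ Φ 0 with hT
  have hA : HasFDerivAt G (fderiv ℝ G θ₀) θ₀ :=
    (differentiableAt_weightedLog_spectrum hW hB hJ hθ).hasFDerivAt
  have hAinj := fderiv_weightedLog_spectrum_injective hW hB hJ hθ hdet
  obtain ⟨L, hL⟩ := exists_normal_equations (fderiv ℝ G θ₀) hAinj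
  obtain ⟨Γ, hΓ, hlim⟩ := exists_tendsto_waveletVar hW (hB.isTfBm θ₀ hθ) hθ.1 hθ.2.1 J
  obtain ⟨C, hC⟩ := exists_measureReal_scaledError_le hW (hB.isTfBm θ₀ hθ) hθ.1 hθ.2.1 J
  simp only [← spectrum_eq hW hB hθ] at hC hlim
  have hVm := measurable_scaledError hW.compact_scaling hW.compact_wavelet hB.measurable s
  obtain ⟨S, hS, hdist⟩ := exists_tendstoInDistribution_map (μ := P θ₀) hVm hΓ
    (fun c => (hlim c).2.1) (fun c => (hlim c).2.2) (L ∘L T)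
  refine ⟨S, hS, fun K hK hKc hKn hid est hest => ?_⟩
  have hG : ContinuousOn G K := fun θ hθ =>
    (differentiableAt_weightedLog_spectrum hW hB hJ (hK hθ)).continuousAt.continuousWithinAt
  refine tendstoInDistribution_of_tendstoInMeasure_sub _ _ hdist ?_
    fun n => (((hest.1 n).sub_const θ₀).fun_const_smul (Real.sqrt n)).aemeasurable
  refine tendstoInMeasure_zero_of_le_of_tight hC fun η hη => ?_
  -- half of `η` for the error of the least squares linearization, half for that of the delta
  -- method
  set δ : ℝ := η / (2 * (‖T‖ + 1)) with hδ
  set ε : ℝ := min 1 (η / (2 * (‖L‖ + 1))) with hε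
  have hT0 : 0 ≤ ‖T‖ := norm_nonneg _
  have hL0 : 0 ≤ ‖L‖ := norm_nonneg _
  have hδ0 : 0 < δ := by positivity
  have hε0 : 0 < ε := by positivity
  obtain ⟨ρ, hρ, hmin⟩ := exists_norm_sub_linear_le_of_isMinOn hKc hG
    (injOn_weightedLog_spectrum hW hB hJ hK hid) hKn hA hAinj hL hδ0
  obtain ⟨r₁, hr₁, hev₁⟩ :=
    exists_norm_sub_lt hΦ.continuousAt (tendsto_sqrt_smul_weightedBias J) hρ
  obtain ⟨r₂, hr₂, hev₂⟩ :=
    exists_norm_sqrt_smul_sub_le hΦ.hasFDerivAt (tendsto_sqrt_smul_weightedBias J) hε0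
  refine ⟨min r₁ r₂, lt_min hr₁ hr₂, ?_⟩
  filter_upwards [hev₁, hev₂, eventually_admissible J, eventually_ge_atTop 1]
    with n hn₁ hn₂ hadm hn1 ω hω
  have hs0 : 0 < Real.sqrt n := Real.sqrt_pos.2 (by exact_mod_cast hn1)
  set V := scaledError φ ψ B J s n ω with hV
  have h1 := hn₁ V (hω.trans_le (by gcongr; exact min_le_left _ _))
  have h2 := hn₂ V (hω.trans_le (by gcongr; exact min_le_right _ _))
  obtain ⟨hmem, hobj⟩ := hest.2 n hadm ω
  have hobj' : objective φ ψ B P J n ω = _ := funext (objective_eq n ω)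
  rw [hobj', weightedLog_waveletVar_eq hn1 s] at hobj
  change IsMinOn (fun θ => ‖Φ ((Real.sqrt n)⁻¹ • V) - weightedBias J n - G θ‖ ^ 2) K _ at hobj
  rw [hΦ0] at h1 h2
  have h3 := hmin _ h1 _ hmem hobj
  set Z := Φ ((Real.sqrt n)⁻¹ • V) - weightedBias J n - G θ₀ with hZ
  have h4 : ‖Real.sqrt n • (est n ω - θ₀) - Real.sqrt n • L Z‖ ≤ δ * ‖Real.sqrt n • Z‖ := by
    rw [← smul_sub, norm_smul, norm_smul, Real.norm_of_nonneg hs0.le]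
    calc _ ≤ Real.sqrt n * (δ * ‖Z‖) := by gcongr
      _ = _ := by ring
  have h5 : ‖Real.sqrt n • Z‖ ≤ ‖T‖ * ‖V‖ + ε * (‖V‖ + 1) := by
    calc _ = ‖T V + (Real.sqrt n • Z - T V)‖ := by congr 1; abel
      _ ≤ ‖T V‖ + ‖Real.sqrt n • Z - T V‖ := norm_add_le _ _
      _ ≤ _ := add_le_add (T.le_opNorm V) h2
  have h6 : ‖L (Real.sqrt n • Z - T V)‖ ≤ ‖L‖ * (ε * (‖V‖ + 1)) :=
    (L.le_opNorm _).trans (by gcongr)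
  have h7 : ‖T‖ * ‖V‖ + ε * (‖V‖ + 1) ≤ (‖T‖ + 1) * (‖V‖ + 1) := by
    have : ε ≤ 1 := min_le_left _ _
    have := norm_nonneg V
    nlinarith
  have h8 : δ * ((‖T‖ + 1) * (‖V‖ + 1)) = η / 2 * (‖V‖ + 1) := by
    rw [hδ]; field_simp
  have h9 : ‖L‖ * (ε * (‖V‖ + 1)) ≤ η / 2 * (‖V‖ + 1) := by
    rw [← mul_assoc]
    gcongr
    calc ‖L‖ * ε ≤ (‖L‖ + 1) * (η / (2 * (‖L‖ + 1))) := by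
          gcongr
          · linarith
          · exact min_le_right _ _
      _ = η / 2 := by field_simp
  calc ‖Real.sqrt n • (est n ω - θ₀) - (L ∘L T) V‖
      = ‖(Real.sqrt n • (est n ω - θ₀) - Real.sqrt n • L Z) + L (Real.sqrt n • Z - T V)‖ := by
        congr 1
        rw [map_sub L (Real.sqrt n • Z), map_smul L, ContinuousLinearMap.comp_apply]
        abel
    _ ≤ δ * ‖Real.sqrt n • Z‖ + ‖L‖ * (ε * (‖V‖ + 1)) :=
        (norm_add_le _ _).trans (add_le_add h4 h6)
    _ ≤ δ * ((‖T‖ + 1) * (‖V‖ + 1)) + η / 2 * (‖V‖ + 1) :=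
        add_le_add (mul_le_mul_of_nonneg_left (h5.trans h7) hδ0.le) h9
    _ = η * (‖V‖ + 1) := by rw [h8]; ring

end Estimator

end TfBm

end

theorem theorem1 {Ω : Type*} [MeasurableSpace Ω]
    (φ ψ : ℝ → ℝ) (N : ℕ) (α : ℝ) (hφψ : TfBm.IsWaveletSystem φ ψ N α)
    (J : Finset ℕ) (hJ : J.Nonempty) (hJ1 : ∀ j ∈ J, 1 ≤ j)
    (B : ℝ → Ω → ℝ) (P : TfBm.Param → Measure Ω) [∀ θ, IsProbabilityMeasure (P θ)]
    (hB : TfBm.IsTfBmModel B P) :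
    ∃ Cov : TfBm.Param → Matrix (Fin 3) (Fin 3) ℝ,
      (∀ θ, (Cov θ).PosSemidef) ∧
      ∀ (θ₀ : TfBm.Param) (U₀ : Set TfBm.Param),
        U₀ ∈ 𝓝 θ₀ → Bornology.IsBounded U₀ → closure U₀ ⊆ TfBm.paramSpace →
        TfBm.SpectrumIdentifiable φ ψ B P J (closure U₀) →
        (∃ est : ℕ → Ω → TfBm.Param,
          TfBm.IsRestrictedMinimum φ ψ B P J (closure U₀) est) ∧
        ∀ est : ℕ → Ω → TfBm.Param,
          TfBm.IsRestrictedMinimum φ ψ B P J (closure U₀) est →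
          TendstoInMeasure (P θ₀) est atTop (fun _ => θ₀) ∧
          (0 < (TfBm.informationMatrix φ ψ B P J θ₀).det →
            TendstoInDistribution (fun (n : ℕ) ω => Real.sqrt n • (est n ω - θ₀)) atTop id
              (fun _ => P θ₀) (multivariateGaussian 0 (Cov θ₀))) := by
  have hcov : ∀ θ₀ : TfBm.Param, ∃ S : Matrix (Fin 3) (Fin 3) ℝ, S.PosSemidef ∧
      (θ₀ ∈ TfBm.paramSpace → 0 < (TfBm.informationMatrix φ ψ B P J θ₀).det →
      ∀ K : Set TfBm.Param, K ⊆ TfBm.paramSpace → IsCompact K → K ∈ 𝓝 θ₀ →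
        TfBm.SpectrumIdentifiable φ ψ B P J K → ∀ est : ℕ → Ω → TfBm.Param,
        TfBm.IsRestrictedMinimum φ ψ B P J K est →
        TendstoInDistribution (fun (n : ℕ) ω => Real.sqrt n • (est n ω - θ₀)) atTop id
          (fun _ => P θ₀) (multivariateGaussian 0 S)) := by
    intro θ₀
    -- when the determinant is not positive nothing is claimed about the limit law
    by_cases h : θ₀ ∈ TfBm.paramSpace ∧ 0 < (TfBm.informationMatrix φ ψ B P J θ₀).det
    · obtain ⟨S, hS, hlim⟩ :=
        TfBm.exists_tendstoInDistribution_estimator hφψ hB hJ1 h.1 h.2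
      exact ⟨S, hS, fun _ _ => hlim⟩
    · exact ⟨0, Matrix.PosSemidef.zero, fun h1 h2 => (h ⟨h1, h2⟩).elim⟩
  choose Cov hCov hlim using hcov
  refine ⟨Cov, hCov, fun θ₀ U₀ hU hbdd hsub hid => ?_⟩
  have hK : IsCompact (closure U₀) := hbdd.isCompact_closure
  have hKn : closure U₀ ∈ 𝓝 θ₀ := mem_of_superset hU subset_closure
  have hθ₀ : θ₀ ∈ closure U₀ := mem_of_mem_nhds hKn
  exact ⟨TfBm.exists_isRestrictedMinimum hφψ hB hJ1 hsub hK ⟨θ₀, hθ₀⟩, fun est hest =>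
    ⟨TfBm.tendstoInMeasure_estimator hφψ hB hJ1 hsub hK hid hθ₀ hest,
      fun hdet => hlim θ₀ (hsub hθ₀) hdet _ hsub hK hKn hid est hest⟩⟩
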